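/- **Setting.** Let $\mathcal X\subset\mathbb R^{d_x}$ ($d_x\ge 1$), let $B\supseteq\overline{\mathcal X}$ be open, let $\Delta:B\to\mathbb R$, and let $\mu$ be a probability distribution on $B$ with Lebesgue density $\mu'$. Let $Z=(X,Y)$ with $X\sim\mu$ and $Y\in\mathbb R^{d_y}$ ($d_y\ge 0$; $d_y=0$ means $Z=X$), and let $\mu(\cdot\mid x)$ be the conditional law of $Y$ given $X=x$, with distribution function $\mu(y\mid x)$. Let $\mathcal M_\Delta(\delta)=\{x\in\mathcal X:\Delta(x)=\delta\}$ and $F_{\Delta,\mu}(\delta)=\int 1\{\Delta\le\delta\}\,d\mu$. A number $\delta$ is a regular value of $\Delta$ on $\overline{\mathcal X}$ if $\partial\Delta(x)\ne0$ for all $x\in\overline{\mathcal X}$ with $\Delta(x)=\delta$. * **S.1.** $\mathcal X$ is open and $\overline{\mathcal X}$ compact; $\Delta$ is $C^1$ on $B$; $\mu'$ is continuous on $B$ and zero on $B\setminus\mathcal X$. * **S.2.** For every regular value $\delta$ of $\Delta$ on $\overline{\mathcal X}$, the closure of $\mathcal M_\Delta(\delta)$ has finitely many connected components. * **Y.** $Y$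 takes values in a compact set and, for every $y\in\mathbb R^{d_y}$, $x\mapsto\mu(y\mid x)$ is continuous on $B$. For a fixed integer $M\ge0$, let $\mathcal F_M$ be the set of functions $x\mapsto\int z_1^{t_1}\cdots z_{d_z}^{t_{d_z}}\,d\mu(y\mid x)$ with $t_j\in\{0,1,2,\dots\}$, $\sum_j t_j\le M$ and $E|Z_1^{t_1}\cdots Z_{d_z}^{t_{d_z}}|<\infty$. Let $\mathcal F_I$ be the set of functions $x\mapsto\int 1\{z\le t\}\,d\mu(y\mid x)$, $t\in\mathbb R^{d_z}$. Let $\mathcal F$ be a set of continuous functions on $B$ containing $\Delta$, let $\mathcal V\subset\mathbb R$ be compact, and let $\widetilde{\mathcal G}=\{\varphi 1\{f\le d\}: f\in\mathcal F,\ \varphi\in\mathcal F_M\cup\mathcal F_I,\ d\in\mathcal V\}$. Let $\widetilde{\mathbb H}$ be the space of linear functionals on the span of $\widetilde{\mathcal G}$ that are bounded on $\widetilde{\mathcal G}$ and uniformly continuous on $\widetilde{\mathcal G}$ for the $L^2(\mu)$ norm, with norm $\|H\|=\sup_{g\in\widetilde{\mathcal G}}|H(g)|$; then $\mu\in\widetilde{\mathbb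 H}$ via $g\mapsto\int g\,d\mu$. Let $\widetilde{\mathbb D}=C(B)\times\widetilde{\mathbb H}\times\mathbb R$ (sup-norm on $C(B)$), and let $\widetilde{\mathbb D}_0\subset\widetilde{\mathbb D}$ be the subspace of those $(G,H,K)$ with $G$ uniformly continuous. For $f\in\mathcal F$, $\nu\in\widetilde{\mathbb H}$, $d\in\mathcal V$ with $\nu(1\{f\le d\})\neq0$ put $$\Lambda^-_{f,\nu,d}(\varphi)=\nu(\varphi1\{f\le d\})/\nu(1\{f\le d\}).$$ * **AS.1.** For every $\epsilon>0$ there is $\eta_0>0$ such that for all $0<\eta<\eta_0$, $\delta'\in\mathcal V$, $s\in\mathbb R$ and $k=1,\dots,d_x$, the marginal distribution of $x_{-k}$ under $\mu$ gives mass at most $\epsilon$ to $\{x_{-k}: (s,x_{-k})\in B,\ |\Delta(s,x_{-k})-\delta'|<\eta\}$, where $(s,x_{-k})$ is the point with $k$-th coordinate $s$ and remaining coordinates $x_{-k}$. *Hadamard differentiability of $\Lambda^-$ at $(\Delta,\mu,\delta)$ tangentially to $\widetilde{\mathbb D}_0$, uniformly in $\varphi\in\Theta$,* with derivative $\partial\Lambda^-(\varphi)$,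 means: each $\partial\Lambda^-(\varphi)$ is linear on $\widetilde{\mathbb D}_0$; for all real $t_n\to0$, $t_n\ne0$, and $h_n\to h\in\widetilde{\mathbb D}_0$ in $\widetilde{\mathbb D}$ such that every $(\Delta,\mu,\delta)+t_nh_n$ lies in the domain of $\Lambda^-$, $$\bigl[\Lambda^-_{(\Delta,\mu,\delta)+t_nh_n}(\varphi)-\Lambda^-_{\Delta,\mu,\delta}(\varphi)\bigr]/t_n\to\partial\Lambda^-(\varphi)[h]\quad\text{uniformly in }\varphi\in\Theta;$$ and $(\varphi,h)\mapsto\partial\Lambda^-(\varphi)[h]$ is continuous on $\Theta\times\widetilde{\mathbb D}_0$, where $\Theta$ carries the $L^1(\mu)$ distance. **Lemma.** Assume S.1, S.2 and Y, let $\delta\in\mathcal V$ be a regular value of $\Delta$ on $\overline{\mathcal X}$, and let $F_{\Delta,\mu}(\delta)>0$. (a) $\Lambda^-$ is Hadamard differentiable at $(\Delta,\mu,\delta)$ tangentially to $\widetilde{\mathbb D}_0$, uniformly in $\varphi\in\mathcal F_M$. (b) If in addition AS.1 holds and $x\mapsto\mu(y\mid x)$ is continuous on $B$ uniformly in $y$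 (that is, the family $\{x\mapsto\mu(y\mid x)\}_{y\in\mathbb R^{d_y}}$ is equicontinuous at every point of $B$), the same holds uniformly in $\varphi\in\mathcal F_I$. (c) In both cases the derivative is $$(G,H,K)\mapsto\int_{\mathcal M_\Delta(\delta)}\widetilde\varphi(x)\,\frac{K-G(x)}{\|\partial\Delta(x)\|}\,\mu'(x)\,d\mathrm{Vol}+H\bigl(\widetilde\varphi\,1\{\Delta\le\delta\}\bigr),\qquad \widetilde\varphi=\frac{\varphi-\Lambda^-_{\Delta,\mu,\delta}(\varphi)}{F_{\Delta,\mu}(\delta)},$$ where $d\mathrm{Vol}$ is the $(d_x-1)$-dimensional volume, and the integrand of the surface integral is integrable for every $\varphi\in\mathcal F_M\cup\mathcal F_I$, every uniformly continuous $G$ and every real $K$. -/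

import Mathlib

open MeasureTheory ProbabilityTheory Filter Topology
open scoped ENNReal

set_option linter.unusedSectionVars false

noncomputable section

namespace Classification

/-! ## Uniform Hadamard differentiability -/

/-- `φ θ : Dom ⊆ D → E` is Hadamard differentiable at `f`, uniformly in `θ ∈ Θ₀`, tangentially to
the subspace `D₀`, with derivative `L θ` on `D₀`.  The vector space `D` carries the (extended)
norm `N`, and the index set `Θ` the (extended) pseudometric `ρ`. -/
structure HasUniformHadamardDeriv {Θ D E : Type*} [AddCommGroup D] [Module ℝ D]
    [NormedAddCommGroup E] [NormedSpace ℝ E]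
    (N : D → ℝ≥0∞) (ρ : Θ → Θ → ℝ≥0∞) (Θ₀ : Set Θ) (Dom : Set D) (D₀ : Submodule ℝ D)
    (φ : Θ → D → E) (f : D) (L : Θ → D → E) : Prop where
  mem_dom : f ∈ Dom
  isLinear : ∀ θ ∈ Θ₀, IsLinearMap ℝ (fun h : D₀ => L θ h)
  tendsto : ∀ (t : ℕ → ℝ) (h : ℕ → D) (h₀ : D),
    Tendsto t atTop (𝓝 0) → (∀ k, t k ≠ 0) →
    Tendsto (fun k => N (h k - h₀)) atTop (𝓝 0) → h₀ ∈ D₀ →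
    (∀ k, f + t k • h k ∈ Dom) →
    TendstoUniformlyOn (fun k θ => (t k)⁻¹ • (φ θ (f + t k • h k) - φ θ f))
      (fun θ => L θ h₀) atTop Θ₀
  continuous : ∀ θ ∈ Θ₀, ∀ h ∈ D₀, ∀ ε : ℝ, 0 < ε → ∃ η : ℝ≥0∞, 0 < η ∧ ∀ θ' ∈ Θ₀, ∀ h' ∈ D₀,
    ρ θ' θ < η → N (h' - h) < η → ‖L θ' h' - L θ h‖ < ε

/-! ## The domain, the level sets and the standing assumptions -/

/-- The covariate space `ℝ^{d_x}` with `d_x = n + 1 ≥ 1`. -/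
abbrev Cov (n : ℕ) : Type := EuclideanSpace ℝ (Fin (n + 1))

/-- `δ` is a regular value of `Δ` on `S`: no point of `S` at level `δ` is critical. -/
def IsRegularValue {n : ℕ} (Δ : Cov n → ℝ) (S : Set (Cov n)) (δ : ℝ) : Prop :=
  ∀ x ∈ S, Δ x = δ → gradient Δ x ≠ 0

/-- The level set `M_Δ(δ) = {x ∈ X : Δ x = δ}`. -/
def levelSet {n : ℕ} (X : Set (Cov n)) (Δ : Cov n → ℝ) (δ : ℝ) : Set (Cov n) :=
  {x | x ∈ X ∧ Δ x = δ}

/-- Condition S.1; `B` is the open neighbourhood of the closure of `X`, `dens` the density of the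
distribution `μ` with respect to Lebesgue measure on `B`. -/
structure CondS1 {n : ℕ} (X B : Set (Cov n)) (Δ : Cov n → ℝ) (dens : B → ℝ)
    (μ : Measure B) : Prop where
  isOpen_X : IsOpen X
  isCompact_closure : IsCompact (closure X)
  isOpen_B : IsOpen B
  closure_subset : closure X ⊆ B
  contDiffOn : ContDiffOn ℝ 1 Δ B
  dens_nonneg : ∀ x, 0 ≤ dens x
  dens_continuous : Continuous dens
  dens_eq_zero : ∀ x : B, (x : Cov n) ∉ X → dens x = 0
  eq_withDensity : μ = ((volume : Measure (Cov n)).comap (Subtype.val : B → Cov n)).withDensity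
    (fun x => ENNReal.ofReal (dens x))

/-- Condition S.2: for every regular value, the closure of the level set has finitely many
connected components. -/
def CondS2 {n : ℕ} (X : Set (Cov n)) (Δ : Cov n → ℝ) : Prop :=
  ∀ δ : ℝ, IsRegularValue Δ (closure X) δ →
    Finite (ConnectedComponents (closure (levelSet X Δ δ)))

/-- `Z̃_{k,η}(δ,s) = {x_{-k} : (s, x_{-k}) ∈ B, |Δ(s, x_{-k}) - δ| < η}`, with `s` inserted as the
`k`-th coordinate. -/
def sliceTube {n : ℕ} (B : Set (Cov n)) (Δ : Cov n → ℝ) (k : Fin (n + 1)) (η δ s : ℝ) :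
    Set (Fin n → ℝ) :=
  {w | (WithLp.toLp 2 (k.insertNth s w : Fin (n + 1) → ℝ) : Cov n) ∈ B ∧
    Δ (WithLp.toLp 2 (k.insertNth s w : Fin (n + 1) → ℝ)) ∈ Set.Ioo (δ - η) (δ + η)}

/-- Condition AS.1; the measure in question is the marginal distribution of `x_{-k}` under `μ`. -/
def CondAS1 {n : ℕ} (B : Set (Cov n)) (Δ : Cov n → ℝ) (μ : Measure B) (V : Set ℝ) : Prop :=
  ∀ ε : ℝ, 0 < ε → ∃ η₀ : ℝ, 0 < η₀ ∧ ∀ η : ℝ, 0 < η → η < η₀ →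
    ∀ δ ∈ V, ∀ (s : ℝ) (k : Fin (n + 1)),
      (μ.map (fun x : B => (k.removeNth (x : Cov n).ofLp : Fin n → ℝ))) (sliceTube B Δ k η δ s)
        ≤ ENNReal.ofReal ε

/-- The restriction of `Δ` to `B`, as a continuous function. -/
def CondS1.toC {n : ℕ} {X B : Set (Cov n)} {Δ : Cov n → ℝ} {dens : B → ℝ} {μ : Measure B}
    (h : CondS1 X B Δ dens μ) : C(B, ℝ) :=
  ⟨B.domRestrict Δ, h.contDiffOn.continuousOn.domRestrict⟩

/-! ## The classes of moment and indicator functions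

`Z = (X, Y)` with `Y` in `ℝ^p`, whose conditional law given `X = x` is `κ x`; the case `p = 0` is
`Z = X`. -/

section classes

variable {n p : ℕ} {B : Set (Cov n)}

/-- The monomial `z ↦ ∏ x_i^{a_i} ∏ y_j^{b_j}`. -/
def zMonomial (a : Fin (n + 1) → ℕ) (b : Fin p → ℕ) (z : B × (Fin p → ℝ)) : ℝ :=
  (∏ i, (z.1 : Cov n) i ^ a i) * ∏ j, z.2 j ^ b j

/-- The indicator `z ↦ 1(x ≤ s, y ≤ t)`, componentwise inequalities. -/
def zIndicator (s : Fin (n + 1) → ℝ) (t : Fin p → ℝ) (z : B × (Fin p → ℝ)) : ℝ :=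
  Set.indicator {z : B × (Fin p → ℝ) | (∀ i, (z.1 : Cov n) i ≤ s i) ∧ ∀ j, z.2 j ≤ t j} 1 z

/-- `x ↦ ∫ h(x, y) dμ(y | x)`. -/
def condMean (κ : Kernel B (Fin p → ℝ)) (h : B × (Fin p → ℝ) → ℝ) (x : B) : ℝ :=
  ∫ y, h (x, y) ∂(κ x)

/-- Moment functions of order at most `M`, for those monomials that are integrable under the
distribution of `Z`. -/
def momentClass (μ : Measure B) (κ : Kernel B (Fin p → ℝ)) (M : ℕ) : Set (B → ℝ) :=
  {φ | ∃ (a : Fin (n + 1) → ℕ) (b : Fin p → ℕ), (∑ i, a i) + (∑ j, b j) ≤ M ∧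
    Integrable (zMonomial a b : B × (Fin p → ℝ) → ℝ) (μ ⊗ₘ κ) ∧ φ = condMean κ (zMonomial a b)}

/-- Indicator functions. -/
def indicatorClass (κ : Kernel B (Fin p → ℝ)) : Set (B → ℝ) :=
  {φ | ∃ (s : Fin (n + 1) → ℝ) (t : Fin p → ℝ), φ = condMean κ (zIndicator s t)}

/-- The conditional distribution function `μ(y | x) = P(Y ≤ y | X = x)`. -/
def condCdf (κ : Kernel B (Fin p → ℝ)) (y : Fin p → ℝ) (x : B) : ℝ :=
  (κ x).real {z | ∀ j, z j ≤ y j}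

/-- The function `x ↦ φ(x) 1{f(x) ≤ d}`. -/
def trunc (φ f : B → ℝ) (d : ℝ) : B → ℝ :=
  Set.indicator {x | f x ≤ d} φ

/-- The class `G̃ = {φ 1(f ≤ d) : f ∈ F, φ ∈ F_M ∪ F_I, d ∈ V}`. -/
def testClass (μ : Measure B) (κ : Kernel B (Fin p → ℝ)) (M : ℕ) (F : Set C(B, ℝ)) (V : Set ℝ) :
    Set (B → ℝ) :=
  {g | ∃ f ∈ F, ∃ φ ∈ momentClass μ κ M ∪ indicatorClass κ, ∃ d ∈ V, g = trunc φ f d}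

/-! ## The space of operators on a class of functions -/

/-- The value of the operator `H` at an element of the class `𝒢`. -/
def onClass {𝒢 : Set (B → ℝ)} (H : Submodule.span ℝ 𝒢 →ₗ[ℝ] ℝ) (g : 𝒢) : ℝ :=
  H ⟨g, Submodule.subset_span g.2⟩

/-- Linear operators on `𝒢` (that is, linear functionals on its linear span) which are bounded on
`𝒢` and uniformly continuous on `𝒢` for the `L²(μ)` norm. -/
def opSpace (μ : Measure B) (𝒢 : Set (B → ℝ)) :
    Submodule ℝ (Submodule.span ℝ 𝒢 →ₗ[ℝ] ℝ) where
  carrier := {H | (∃ C : ℝ, ∀ g : 𝒢, |onClass H g| ≤ C) ∧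
    ∀ ε : ℝ, 0 < ε → ∃ η : ℝ, 0 < η ∧ ∀ g g' : 𝒢,
      eLpNorm ((g : B → ℝ) - (g' : B → ℝ)) 2 μ < ENNReal.ofReal η → |onClass H g - onClass H g'| < ε}
  zero_mem' := ⟨⟨0, fun g => by simp [onClass]⟩,
    fun ε hε => ⟨1, one_pos, fun g g' _ => by simpa [onClass] using hε⟩⟩
  add_mem' := by
    rintro H K ⟨⟨C, hC⟩, hH⟩ ⟨⟨C', hC'⟩, hK⟩
    refine ⟨⟨C + C', fun g => ?_⟩, fun ε hε => ?_⟩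
    · exact (abs_add_le _ _).trans (add_le_add (hC g) (hC' g))
    · obtain ⟨η, hη, h1⟩ := hH (ε / 2) (half_pos hε)
      obtain ⟨η', hη', h2⟩ := hK (ε / 2) (half_pos hε)
      refine ⟨min η η', lt_min hη hη', fun g g' hg => ?_⟩
      have e1 := h1 g g' (hg.trans_le (ENNReal.ofReal_le_ofReal (min_le_left _ _)))
      have e2 := h2 g g' (hg.trans_le (ENNReal.ofReal_le_ofReal (min_le_right _ _)))
      have e3 : onClass (H + K) g - onClass (H + K) g' =
          (onClass H g - onClass H g') + (onClass K g - onClass K g') := by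
        simp only [onClass, LinearMap.add_apply]; ring
      rw [e3]
      exact (abs_add_le _ _).trans_lt (by linarith)
  smul_mem' := by
    rintro c H ⟨⟨C, hC⟩, hH⟩
    refine ⟨⟨|c| * C, fun g => ?_⟩, fun ε hε => ?_⟩
    · simpa [onClass, abs_mul] using mul_le_mul_of_nonneg_left (hC g) (abs_nonneg c)
    · have hc : 0 < |c| + 1 := by positivity
      obtain ⟨η, hη, h1⟩ := hH (ε / (|c| + 1)) (div_pos hε hc)
      refine ⟨η, hη, fun g g' hg => ?_⟩
      have e1 := h1 g g' hg
      have e3 : onClass (c • H) g - onClass (c • H) g' = c * (onClass H g - onClass H g') := by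
        simp only [onClass, LinearMap.smul_apply, smul_eq_mul]; ring
      rw [e3, abs_mul]
      calc |c| * |onClass H g - onClass H g'|
          ≤ (|c| + 1) * |onClass H g - onClass H g'| := by
            gcongr; linarith
        _ < (|c| + 1) * (ε / (|c| + 1)) := by gcongr
        _ = ε := by field_simp

/-- The norm `‖H‖ = sup_{g ∈ 𝒢} |H g|`. -/
def opNorm {𝒢 : Set (B → ℝ)} (H : Submodule.span ℝ 𝒢 →ₗ[ℝ] ℝ) : ℝ≥0∞ :=
  ⨆ g : 𝒢, ‖onClass H g‖ₑ

open Classical in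
/-- `H g` for `g` in the linear span of `𝒢` (and `0` for other functions, where `H` is not
defined). -/
def opEval {𝒢 : Set (B → ℝ)} (H : Submodule.span ℝ 𝒢 →ₗ[ℝ] ℝ) (g : B → ℝ) : ℝ :=
  if h : g ∈ Submodule.span ℝ 𝒢 then H ⟨g, h⟩ else 0

/-! ## The measure `μ` as an operator -/

lemma measurable_zMonomial (a : Fin (n + 1) → ℕ) (b : Fin p → ℕ) :
    Measurable (zMonomial a b : B × (Fin p → ℝ) → ℝ) := by
  unfold zMonomial
  fun_prop

lemma measurable_zIndicator (s : Fin (n + 1) → ℝ) (t : Fin p → ℝ) :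
    Measurable (zIndicator s t : B × (Fin p → ℝ) → ℝ) := by
  refine Measurable.indicator measurable_one ?_
  simp only [Set.ofPred_and, Set.ofPred_forall]
  refine MeasurableSet.inter (MeasurableSet.iInter fun i => ?_) (MeasurableSet.iInter fun j => ?_)
  · exact measurableSet_le (by fun_prop) measurable_const
  · exact measurableSet_le (by fun_prop) measurable_const

variable (μ : Measure B) [IsProbabilityMeasure μ] (κ : Kernel B (Fin p → ℝ)) [IsMarkovKernel κ]
  (M : ℕ) (F : Set C(B, ℝ)) (V : Set ℝ)

lemma stronglyMeasurable_condMean {h : B × (Fin p → ℝ) → ℝ} (hh : Measurable h) :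
    StronglyMeasurable (condMean κ h) := by
  unfold condMean
  exact StronglyMeasurable.integral_kernel_prod_right' (κ := κ) hh.stronglyMeasurable

lemma abs_indicatorClass_le {φ : B → ℝ} (hφ : φ ∈ indicatorClass κ) (x : B) : |φ x| ≤ 1 := by
  obtain ⟨s, t, rfl⟩ := hφ
  have := norm_integral_le_of_norm_le_const (μ := κ x) (C := 1)
    (f := fun y => zIndicator s t (x, y)) (Eventually.of_forall fun y => by
      unfold zIndicator
      rw [Set.indicator_apply]
      split_ifs <;> simp)
  simpa [condMean] using this

lemma stronglyMeasurable_class {φ : B → ℝ} (hφ : φ ∈ momentClass μ κ M ∪ indicatorClass κ) :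
    StronglyMeasurable φ := by
  rcases hφ with ⟨a, b, -, -, rfl⟩ | ⟨s, t, rfl⟩
  · exact stronglyMeasurable_condMean κ (measurable_zMonomial a b)
  · exact stronglyMeasurable_condMean κ (measurable_zIndicator s t)

lemma integrable_class {φ : B → ℝ} (hφ : φ ∈ momentClass μ κ M ∪ indicatorClass κ) :
    Integrable φ μ := by
  have hm := stronglyMeasurable_class μ κ M hφ
  rcases hφ with ⟨a, b, -, hi, rfl⟩ | hφ
  · exact MeasureTheory.Integrable.integral_compProd hi
  · exact Integrable.of_bound hm.aestronglyMeasurable 1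
      (Eventually.of_forall fun x => abs_indicatorClass_le κ hφ x)

lemma finite_momentClass : (momentClass μ κ M).Finite := by
  have h1 : ((Set.Iic (fun _ : Fin (n + 1) => M)) ×ˢ (Set.Iic (fun _ : Fin p => M))).Finite :=
    (Set.finite_Iic _).prod (Set.finite_Iic _)
  refine (h1.image fun ab => condMean κ (zMonomial ab.1 ab.2)).subset ?_
  rintro φ ⟨a, b, hab, -, rfl⟩
  refine ⟨(a, b), ⟨fun i => ?_, fun j => ?_⟩, rfl⟩
  · have := Finset.single_le_sum (f := a) (fun _ _ => Nat.zero_le _) (Finset.mem_univ i)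
    show a i ≤ M
    omega
  · have := Finset.single_le_sum (f := b) (fun _ _ => Nat.zero_le _) (Finset.mem_univ j)
    show b j ≤ M
    omega

lemma measurableSet_sublevel (f : C(B, ℝ)) (d : ℝ) : MeasurableSet {x : B | f x ≤ d} :=
  measurableSet_le f.continuous.measurable measurable_const

lemma integrable_testClass {g : B → ℝ} (hg : g ∈ testClass μ κ M F V) : Integrable g μ := by
  obtain ⟨f, -, φ, hφ, d, -, rfl⟩ := hg
  exact (integrable_class μ κ M hφ).indicator (measurableSet_sublevel f d)

lemma integrable_span {g : B → ℝ} (hg : g ∈ Submodule.span ℝ (testClass μ κ M F V)) :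
    Integrable g μ := by
  induction hg using Submodule.span_induction with
  | mem g hg => exact integrable_testClass μ κ M F V hg
  | zero => exact integrable_zero _ _ _
  | add g h _ _ hg hh => exact hg.add hh
  | smul c g _ hg => exact hg.smul c

/-- The linear functional `g ↦ ∫ g dμ` on the span of `G̃`. -/
def integralOp : Submodule.span ℝ (testClass μ κ M F V) →ₗ[ℝ] ℝ where
  toFun g := ∫ x, (g : B → ℝ) x ∂μ
  map_add' g h := integral_add (integrable_span μ κ M F V g.2) (integrable_span μ κ M F V h.2)
  map_smul' c _ := integral_const_mul c _

lemma integralOp_mem : integralOp μ κ M F V ∈ opSpace μ (testClass μ κ M F V) := by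
  refine ⟨?_, fun ε hε => ⟨ε, hε, fun g g' hg => ?_⟩⟩
  · obtain ⟨C, hC⟩ := ((finite_momentClass μ κ M).image fun φ => ∫ x, |φ x| ∂μ).bddAbove
    refine ⟨max C 1, ?_⟩
    rintro ⟨_, f, -, φ, hφ, d, -, rfl⟩
    have hi := integrable_class μ κ M hφ
    have h1 : |∫ x, trunc φ f d x ∂μ| ≤ ∫ x, |φ x| ∂μ := by
      refine (abs_integral_le_integral_abs).trans (integral_mono_of_nonneg
        (Eventually.of_forall fun x => abs_nonneg _) hi.abs (Eventually.of_forall fun x => ?_))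
      simp only [trunc, Set.indicator_apply]
      split_ifs <;> simp
    refine h1.trans ?_
    rcases hφ with hφ | hφ
    · exact le_max_of_le_left (hC ⟨φ, hφ, rfl⟩)
    · refine le_max_of_le_right ?_
      refine (integral_mono hi.abs (integrable_const (1 : ℝ))
        (abs_indicatorClass_le κ hφ)).trans (by simp)
  · have hi := integrable_testClass μ κ M F V g.2
    have hi' := integrable_testClass μ κ M F V g'.2
    have e : onClass (integralOp μ κ M F V) g - onClass (integralOp μ κ M F V) g'
        = ∫ x, ((g : B → ℝ) x - (g' : B → ℝ) x) ∂μ := (integral_sub hi hi').symm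
    rw [e]
    have h2 : eLpNorm ((g : B → ℝ) - (g' : B → ℝ)) 1 μ < ENNReal.ofReal ε :=
      (eLpNorm_le_eLpNorm_of_exponent_le (by norm_num) (hi.sub hi').1).trans_lt hg
    rw [eLpNorm_one_eq_lintegral_enorm] at h2
    have h3 := (enorm_integral_le_lintegral_enorm
      (fun x => (g : B → ℝ) x - (g' : B → ℝ) x) (μ := μ)).trans_lt h2
    rw [Real.enorm_eq_ofReal_abs] at h3
    exact (ENNReal.ofReal_lt_ofReal_iff hε).1 h3

/-! ## The classification operator -/

/-- The operator space `H̃` on `G̃`. -/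
abbrev OpTilde (μ : Measure B) (κ : Kernel B (Fin p → ℝ)) (M : ℕ) (F : Set C(B, ℝ))
    (V : Set ℝ) : Type :=
  opSpace μ (testClass μ κ M F V)

/-- `μ` as an element of `H̃`. -/
def measureOp : OpTilde μ κ M F V := ⟨integralOp μ κ M F V, integralOp_mem μ κ M F V⟩

/-- The space `D̃ = C(B) × H̃ × ℝ`. -/
abbrev DTilde (μ : Measure B) (κ : Kernel B (Fin p → ℝ)) (M : ℕ) (F : Set C(B, ℝ))
    (V : Set ℝ) : Type :=
  C(B, ℝ) × OpTilde μ κ M F V × ℝ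

/-- The part of `D̃` on which the classification operator is considered and defined: `f` in the
given set of functions, `d ∈ V`, and non-vanishing denominator `ν(1{f ≤ d})`. -/
def opDomain (μ : Measure B) (κ : Kernel B (Fin p → ℝ)) (M : ℕ) (F : Set C(B, ℝ)) (V : Set ℝ) :
    Set (DTilde μ κ M F V) :=
  {q | q.1 ∈ F ∧ q.2.2 ∈ V ∧ opEval q.2.1.1 (trunc 1 q.1 q.2.2) ≠ 0}

/-- The (extended) norm of `D̃`: sup-norm, operator norm on `G̃`, absolute value. -/
def dNorm {μ : Measure B} {κ : Kernel B (Fin p → ℝ)} {M : ℕ} {F : Set C(B, ℝ)} {V : Set ℝ}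
    (q : DTilde μ κ M F V) : ℝ≥0∞ :=
  (⨆ x : B, ‖q.1 x‖ₑ) + opNorm q.2.1.1 + ‖q.2.2‖ₑ

/-- The uniformly continuous functions on `B`. -/
def uniformSpaceF (B : Set (Cov n)) : Submodule ℝ C(B, ℝ) where
  carrier := {G | UniformContinuous G}
  zero_mem' := uniformContinuous_const
  add_mem' := fun hG hG' => UniformContinuous.add hG hG'
  smul_mem' := fun c _ hG => UniformContinuous.const_smul hG c

/-- The tangent space `D̃₀`: uniformly continuous functions, times `H̃`, times `ℝ`. -/
def tangentSpace (μ : Measure B) (κ : Kernel B (Fin p → ℝ)) (M : ℕ) (F : Set C(B, ℝ))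
    (V : Set ℝ) : Submodule ℝ (DTilde μ κ M F V) :=
  (uniformSpaceF B).prod ⊤

/-- The classification operator `(f, ν, d) ↦ ν(φ 1{f ≤ d}) / ν(1{f ≤ d})`. -/
def classOp {μ : Measure B} {κ : Kernel B (Fin p → ℝ)} {M : ℕ} {F : Set C(B, ℝ)} {V : Set ℝ}
    (φ : B → ℝ) (q : DTilde μ κ M F V) : ℝ :=
  opEval q.2.1.1 (trunc φ q.1 q.2.2) / opEval q.2.1.1 (trunc 1 q.1 q.2.2)

/-- `F_{Δ,μ}(δ) = ∫ 1{Δ ≤ δ} dμ`. -/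
def distrFun (μ : Measure B) (f : B → ℝ) (d : ℝ) : ℝ := ∫ x, trunc 1 f d x ∂μ

/-- `φ̃ = [φ - Λ] / F_{Δ,μ}(δ)` with `Λ = ∫ φ 1{Δ ≤ δ} dμ / ∫ 1{Δ ≤ δ} dμ`. -/
def normalized (μ : Measure B) (f : B → ℝ) (d : ℝ) (φ : B → ℝ) (x : B) : ℝ :=
  (φ x - (∫ z, trunc φ f d z ∂μ) / distrFun μ f d) / distrFun μ f d

/-- The integrand `φ̃ (K - G) μ' / ‖∂Δ‖` of the surface integral. -/
def surfaceIntegrand (Δ : Cov n → ℝ) (dens : B → ℝ) (μ : Measure B) (δ : ℝ) (φ : B → ℝ)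
    (G : B → ℝ) (K : ℝ) (x : B) : ℝ :=
  normalized μ (fun z => Δ z) δ φ x * ((K - G x) / ‖gradient Δ (x : Cov n)‖) * dens x

/-- The level set `M_Δ(δ)` as a subset of `B`. -/
def levelSetIn (B X : Set (Cov n)) (Δ : Cov n → ℝ) (δ : ℝ) : Set B :=
  Subtype.val ⁻¹' levelSet X Δ δ

/-- The derivative `∫_{M_Δ(δ)} φ̃ (K - G) μ' / ‖∂Δ‖ dVol + H(φ̃ 1{Δ ≤ δ})`; the volume of the
`n`-dimensional hypersurface is the `n`-dimensional Hausdorff measure, normalised to agree with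
Lebesgue measure on `ℝ^n`. -/
def classDeriv (X : Set (Cov n)) (Δ : Cov n → ℝ) (dens : B → ℝ) (δ : ℝ)
    {μ : Measure B} {κ : Kernel B (Fin p → ℝ)} {M : ℕ} {F : Set C(B, ℝ)} {V : Set ℝ}
    (φ : B → ℝ) (q : DTilde μ κ M F V) : ℝ :=
  (∫ x in levelSetIn B X Δ δ, surfaceIntegrand Δ dens μ δ φ q.1 q.2.2 x ∂μHE[n]) +
    opEval q.2.1.1 (trunc (normalized μ (fun z => Δ z) δ φ) (fun z => Δ z) δ)

/-- The `L¹(μ)` distance between functions. -/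
def l1Dist (μ : Measure B) (φ ψ : B → ℝ) : ℝ≥0∞ := eLpNorm (φ - ψ) 1 μ

end classes

end Classification

end

noncomputable section

namespace Classification

/-! ## Local graph charts of level sets -/

/-! The operator is a quotient, and its denominator is its numerator `ν(φ 1{f ≤ d})` at `φ = 1`.
Along a perturbation by `t (G, H, K)`, the difference quotient of the numerator splits into `t⁻¹ ∫ φ
(1{Δ + t G ≤ δ + t K} - 1{Δ ≤ δ}) dμ` and `H` evaluated at the perturbed truncation. The second term
converges because `H` is continuous in mean square and the level set is `μ`-null. The first is the
signed mass of a layer along the level set of thickness about `t (K - G) / ‖∂Δ‖`, which yields the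
surface integral.

The layer is analysed in charts. Near a regular point the level set is the graph of a function `ψ`
over the tangent space, with slope controlled by a small parameter `κ` (`nonempty_graphChart`). In
the coordinates `(w, ψ w + t s)`, whose Jacobian is `|t|`, the rescaled layer converges pointwise to
the one between `0` and `(K - G) / ∂ₑΔ`, where `e` is the normal direction at the centre, and
dominated convergence applies (`GraphChart.tendsto_tube_sub`). No area formula is used: projection
and graph map are Lipschitz with constants `1` and `1 / (1 - κ)`, so Lebesgue measure on the base
and surface measure on the graph agree up to a factor close to one
(`GraphChart.abs_integral_graphMeasure_sub_le`). A partition of unity makes the total error of all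
charts proportional to the area of the level set, not to the number of charts, so that `κ → 0` gives
the global statement `tendsto_tube_sub_surface`.

Uniformity in `φ` is reduced to sequences `φ k` in the class. Such a sequence need not converge, so
every limit is stated as a difference tending to zero; what is needed is that a subsequence has
vanishing oscillation at almost every point of the level set with positive density
(`IsTestSubclass.compact`). The moment class is finite and consists of continuous functions:
multiplying by a coordinate of `y` is an average of truncations, so continuity of the conditional
distribution function passes to moments (`HasContinuousPartialIntegrals.mul_coordinate`). For
indicators, a subsequence of the thresholds converges in the extended reals, and the limit can only
cause trouble on coordinate hyperplanes, whose intersections with the level set are negligible by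
AS.1 (`CondS1.slice_eq_zero`); equicontinuity takes care of the thresholds in `y`. The quotient rule
in `CondS1.hasUniformHadamardDeriv` then finishes both cases. -/

/-- Orthonormal coordinates `(w, s)` of `ℝ^{n+1}` in which `e` is the direction of `s`. -/
lemma exists_orthonormal_coordinates {n : ℕ} (e : Cov n) (he : ‖e‖ = 1) :
    ∃ L : (EuclideanSpace ℝ (Fin n) × ℝ) ≃L[ℝ] Cov n, MeasurePreserving L ∧
      (∀ q, ‖L q‖ ^ 2 = ‖q.1‖ ^ 2 + q.2 ^ 2) ∧ ∀ q, inner ℝ e (L q) = q.2 := by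
  obtain ⟨b, hb⟩ := Orthonormal.exists_orthonormalBasis_extension_of_card_eq (𝕜 := ℝ)
    (E := Cov n) (ι := Fin (n + 1)) (by simp) (v := fun _ => e) (s := {0})
    (by
      rw [orthonormal_iff_ite]
      rintro ⟨i, rfl⟩ ⟨j, rfl⟩
      simp [he])
  have hb0 : b 0 = e := hb 0 rfl
  let ℓ : (EuclideanSpace ℝ (Fin n) × ℝ) ≃ₗ[ℝ] Cov n :=
    { toFun := fun q => b.repr.symm (WithLp.toLp 2 (Fin.cons q.2 q.1.ofLp))
      invFun := fun x => (WithLp.toLp 2 (fun i => b.repr x i.succ), b.repr x 0)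
      map_add' := fun q q' => by
        rw [← map_add]
        congr 1
        ext i
        refine Fin.cases ?_ (fun j => ?_) i <;> simp
      map_smul' := fun c q => by
        simp only [RingHom.id_apply]
        rw [← map_smul]
        congr 1
        ext i
        refine Fin.cases ?_ (fun j => ?_) i <;> simp
      left_inv := fun q => by simp
      right_inv := fun x => by
        apply b.repr.injective
        ext i
        refine Fin.cases ?_ (fun j => ?_) i <;> simp }
  refine ⟨ℓ.toContinuousLinearEquiv, ?_, fun q => ?_, fun q => ?_⟩
  · have h1 := (volume_preserving_piFinSuccAbove (fun _ : Fin (n + 1) => ℝ) 0).symm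
    have h2 : MeasurePreserving (fun q : EuclideanSpace ℝ (Fin n) × ℝ => (q.2, q.1.ofLp))
        (volume.prod volume) (volume.prod volume) :=
      Measure.measurePreserving_swap.comp
        ((PiLp.volume_preserving_ofLp (Fin n)).prod (MeasurePreserving.id volume))
    have h3 := b.measurePreserving_repr_symm.comp ((PiLp.volume_preserving_toLp (Fin (n + 1))).comp
      (h1.comp h2))
    suffices h : (ℓ.toContinuousLinearEquiv : EuclideanSpace ℝ (Fin n) × ℝ → Cov n) =
        b.repr.symm ∘ WithLp.toLp 2 ∘ (MeasurableEquiv.piFinSuccAbove (fun _ => ℝ) 0).symm ∘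
          fun q => (q.2, q.1.ofLp) by
      rw [h]; exact h3
    funext q
    change b.repr.symm (WithLp.toLp 2 (Fin.cons q.2 q.1.ofLp)) =
      b.repr.symm (WithLp.toLp 2 ((MeasurableEquiv.piFinSuccAbove (fun _ : Fin (n + 1) => ℝ) 0).symm
        (q.2, q.1.ofLp)))
    simp [MeasurableEquiv.piFinSuccAbove]
    rfl
  · change ‖b.repr.symm _‖ ^ 2 = _
    rw [LinearIsometryEquiv.norm_map, EuclideanSpace.norm_sq_eq, EuclideanSpace.norm_sq_eq,
      Fin.sum_univ_succ]
    simp [add_comm]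
  · change inner ℝ e (b.repr.symm _) = _
    rw [← hb0, ← b.repr_apply_apply]
    simp

/-- A chart in which the level set of `Δ` through `x₀` is the graph of a Lipschitz function `ψ`
over a ball of the tangent space. -/
structure GraphChart {n : ℕ} (Δ : Cov n → ℝ) (x₀ : Cov n) (κ : ℝ) (W : Set (Cov n)) where
  /-- The coordinates: tangential component and component along the gradient at `x₀`. -/
  L : (EuclideanSpace ℝ (Fin n) × ℝ) ≃L[ℝ] Cov n
  measurePreserving : MeasurePreserving L
  norm_sq : ∀ q, ‖L q‖ ^ 2 = ‖q.1‖ ^ 2 + q.2 ^ 2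
  /-- The size of the chart. -/
  r : ℝ
  r_pos : 0 < r
  /-- The graph function. -/
  ψ : EuclideanSpace ℝ (Fin n) → ℝ
  ψ_continuous : Continuous ψ
  ψ_lt : ∀ w, ‖w‖ < r → |ψ w| < r
  level : ∀ w, ‖w‖ < r → Δ (x₀ + L (w, ψ w)) = Δ x₀
  subset : ∀ w s, ‖w‖ < r → |s| < r → x₀ + L (w, s) ∈ W
  slope : ∀ w s, ‖w‖ < r → |s| < r →
    ‖gradient Δ x₀‖ / 2 * |s - ψ w| ≤ |Δ (x₀ + L (w, s)) - Δ x₀|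
  lipschitz : LipschitzWith (Real.toNNReal (1 / (1 - κ))) fun w => x₀ + L (w, ψ w)
  differentiable : ∀ w s, ‖w‖ < r → |s| < r → DifferentiableAt ℝ Δ (x₀ + L (w, s))
  inner_ge : ∀ w s, ‖w‖ < r → |s| < r → ‖gradient Δ x₀‖ / 2 ≤
    inner ℝ (gradient Δ (x₀ + L (w, s))) (L (0, 1))
  inner_ge' : ∀ w s, ‖w‖ < r → |s| < r → (1 - κ) * ‖gradient Δ (x₀ + L (w, s))‖ ≤
    inner ℝ (gradient Δ (x₀ + L (w, s))) (L (0, 1))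

lemma continuousAt_gradient {n : ℕ} {Δ : Cov n → ℝ} {x : Cov n} (h : ContDiffAt ℝ 1 Δ x) :
    ContinuousAt (gradient Δ) x :=
  (LinearIsometryEquiv.continuous _).continuousAt.comp (h.continuousAt_fderiv one_ne_zero)

lemma inner_gradient {n : ℕ} (Δ : Cov n → ℝ) (x v : Cov n) :
    inner ℝ (gradient Δ x) v = fderiv ℝ Δ x v := by
  simp [gradient]

/-- A quantitative implicit function theorem. Strict differentiability makes `Δ` deviate from `A s`
by a `κ A`-Lipschitz error, `A` being the length of the gradient at `x₀`. The intermediate value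
theorem then produces the graph function, and the same estimate bounds its slope by `κ / (1 - κ)`.
-/
lemma nonempty_graphChart {n : ℕ} {Δ : Cov n → ℝ} {x₀ : Cov n} (hΔ : ContDiffAt ℝ 1 Δ x₀)
    (hg : gradient Δ x₀ ≠ 0) {κ : ℝ} (hκ : 0 < κ) (hκ' : κ ≤ 1 / 4) {W : Set (Cov n)}
    (hW : W ∈ 𝓝 x₀) : Nonempty (GraphChart Δ x₀ κ W) := by
  set A := ‖gradient Δ x₀‖ with hA
  have hA0 : 0 < A := norm_pos_iff.2 hg
  set e := A⁻¹ • gradient Δ x₀ with he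
  have he1 : ‖e‖ = 1 := by
    rw [he, norm_smul, norm_inv, Real.norm_of_nonneg hA0.le, ← hA, inv_mul_cancel₀ hA0.ne']
  have hgA : gradient Δ x₀ = A • e := by rw [he, smul_smul, mul_inv_cancel₀ hA0.ne', one_smul]
  obtain ⟨L, hL, hLn, hLi⟩ := exists_orthonormal_coordinates e he1
  have hLe : L (0, 1) = e := by
    have h1 : ‖L (0, 1)‖ = 1 := by
      have := hLn (0, 1)
      simp at this
      rcases this with h | h
      · exact h
      · linarith [norm_nonneg (L (0, 1))]
    exact ((inner_eq_one_iff_of_norm_eq_one he1 h1).1 (hLi (0, 1))).symm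
  have hLle : ∀ w s, ‖L (w, s)‖ ≤ ‖w‖ + |s| := fun w s => by
    refine abs_le_of_sq_le_sq' ?_ (by positivity) |>.2
    rw [hLn]
    nlinarith [norm_nonneg w, abs_nonneg s, sq_abs s]
  have hfd : ∀ v, fderiv ℝ Δ x₀ v = A * inner ℝ e v := fun v => by
    rw [← inner_gradient, hgA, real_inner_smul_left]
  have hs := (hΔ.hasStrictFDerivAt one_ne_zero).isLittleO.def (mul_pos hκ hA0)
  have hd : ∀ᶠ x in 𝓝 x₀, DifferentiableAt ℝ Δ x :=
    (hΔ.eventually (by simp)).mono fun x hx => hx.differentiableAt one_ne_zero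
  -- The tolerance `κ / 2` gives `inner_ge'` at the end: `(1 - κ)(1 + κ/2) ≤ 1 - κ/2`.
  have hgr : ∀ᶠ x in 𝓝 x₀, ‖gradient Δ x - gradient Δ x₀‖ < κ / 2 * A := by
    have := Metric.continuousAt_iff'.1 (continuousAt_gradient hΔ) (κ / 2 * A) (by positivity)
    simpa [dist_eq_norm] using this
  obtain ⟨ρ₁, hρ₁, h₁⟩ := Metric.eventually_nhds_iff.1 (hd.and (hgr.and hW))
  rw [nhds_prod_eq] at hs
  obtain ⟨ρ₂, hρ₂, h₂⟩ := Metric.eventually_nhds_iff.1 (by simpa [nhds_prod_eq] using hs :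
    ∀ᶠ p : Cov n × Cov n in 𝓝 (x₀, x₀), ‖Δ p.1 - Δ p.2 - fderiv ℝ Δ x₀ (p.1 - p.2)‖ ≤
      κ * A * ‖p.1 - p.2‖)
  -- Halved because `‖L (w, s)‖ ≤ ‖w‖ + |s| < 2 r`.
  set r := min ρ₁ ρ₂ / 2 with hr
  have hr0 : 0 < r := by positivity
  have hdist : ∀ w s, ‖w‖ < r → |s| < r → dist (x₀ + L (w, s)) x₀ < min ρ₁ ρ₂ := fun w s hw hs => by
    rw [dist_eq_norm, add_sub_cancel_left]
    linarith [hLle w s]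
  have hρ : ∀ w s, ‖w‖ < r → |s| < r → DifferentiableAt ℝ Δ (x₀ + L (w, s)) ∧
      ‖gradient Δ (x₀ + L (w, s)) - gradient Δ x₀‖ < κ / 2 * A ∧ x₀ + L (w, s) ∈ W :=
    fun w s hw hs => h₁ ((hdist w s hw hs).trans_le (min_le_left _ _))
  have key : ∀ w s w' s', ‖w‖ < r → |s| < r → ‖w'‖ < r → |s'| < r →
      |Δ (x₀ + L (w, s)) - Δ (x₀ + L (w', s')) - A * (s - s')| ≤
        κ * A * (‖w - w'‖ + |s - s'|) := by
    intro w s w' s' hw hs hw' hs'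
    have := @h₂ (x₀ + L (w, s), x₀ + L (w', s')) (by
      rw [Prod.dist_eq]
      exact max_lt ((hdist w s hw hs).trans_le (min_le_right _ _))
        ((hdist w' s' hw' hs').trans_le (min_le_right _ _)))
    simp only [add_sub_add_left_eq_sub, ← map_sub, Prod.mk_sub_mk] at this
    rw [hfd, hLi] at this
    exact this.trans (mul_le_mul_of_nonneg_left (hLle _ _) (by positivity))
  have hex : ∀ w, ‖w‖ < r → ∃ s, |s| < r ∧ Δ (x₀ + L (w, s)) = Δ x₀ := by
    intro w hw
    have hc : ContinuousOn (fun s : ℝ => Δ (x₀ + L (w, s))) (Set.Icc (-(r / 2)) (r / 2)) := by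
      intro s hs
      have hs' : |s| < r := by rw [abs_lt]; constructor <;> linarith [hs.1, hs.2]
      refine ContinuousAt.continuousWithinAt ?_
      exact ContinuousAt.comp (f := fun s : ℝ => x₀ + L (w, s)) (hρ w s hw hs').1.continuousAt
        (by fun_prop)
    have habs : |r / 2| < r := by rw [abs_of_pos (by positivity)]; linarith
    have habs' : |-(r / 2)| < r := by rwa [abs_neg]
    have k1 := abs_le.1 (key w (r / 2) 0 0 hw habs (by simpa using hr0) (by simpa using hr0))
    have k2 := abs_le.1 (key w (-(r / 2)) 0 0 hw habs' (by simpa using hr0) (by simpa using hr0))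
    have e0 : x₀ + L ((0 : EuclideanSpace ℝ (Fin n)), (0 : ℝ)) = x₀ := by
      rw [show ((0 : EuclideanSpace ℝ (Fin n)), (0 : ℝ)) = 0 from rfl, map_zero, add_zero]
    rw [e0, sub_zero, sub_zero] at k1 k2
    rw [abs_of_pos (by positivity : 0 < r / 2)] at k1
    rw [abs_neg, abs_of_pos (by positivity : 0 < r / 2)] at k2
    -- This is where `κ ≤ 1 / 4` enters: the linear term at height `± r / 2` beats the error, so `Δ
    -- - Δ x₀` changes sign.
    have hb : κ * A * (‖w‖ + r / 2) ≤ A * (r / 2) := by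
      calc κ * A * (‖w‖ + r / 2) ≤ 1 / 4 * A * (r + r / 2) := by gcongr
        _ ≤ A * (r / 2) := by nlinarith
    obtain ⟨s, hs, hs'⟩ := intermediate_value_Icc (by linarith) hc
      (show Δ x₀ ∈ _ from ⟨by linarith [k2.2], by linarith [k1.1]⟩)
    exact ⟨s, by rw [abs_lt]; constructor <;> linarith [hs.1, hs.2], hs'⟩
  choose! ψ₀ hψ₀ hψ₀' using hex
  have hκ1 : 0 < 1 - κ := by linarith
  have hlip : LipschitzOnWith (Real.toNNReal (κ / (1 - κ))) ψ₀ (Metric.ball 0 r) := by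
    refine LipschitzOnWith.of_dist_le_mul fun w hw w' hw' => ?_
    rw [mem_ball_zero_iff] at hw hw'
    have k := key w (ψ₀ w) w' (ψ₀ w') hw (hψ₀ w hw) hw' (hψ₀ w' hw')
    rw [hψ₀' w hw, hψ₀' w' hw', sub_self, zero_sub, abs_neg, abs_mul, abs_of_pos hA0,
      mul_comm κ A, mul_assoc] at k
    have k' := le_of_mul_le_mul_left k hA0
    rw [Real.coe_toNNReal _ (by positivity), Real.dist_eq, dist_eq_norm, div_mul_eq_mul_div,
      le_div_iff₀ hκ1]
    linarith
  -- Extending `ψ₀` from the ball to the whole tangent space makes the graph map globally continuous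
  -- and Lipschitz.
  obtain ⟨ψ, hψl, hψe⟩ := hlip.extend_real
  have hψe' : ∀ w, ‖w‖ < r → ψ w = ψ₀ w := fun w hw => (hψe (by simpa using hw)).symm
  refine ⟨⟨L, hL, hLn, r, hr0, ψ, hψl.continuous, fun w hw => hψe' w hw ▸ hψ₀ w hw,
    fun w hw => hψe' w hw ▸ hψ₀' w hw, fun w s hw hs => (hρ w s hw hs).2.2, ?_, ?_,
    fun w s hw hs => (hρ w s hw hs).1, ?_, ?_⟩⟩
  · intro w s hw hs
    rw [hψe' w hw, ← hψ₀' w hw]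
    have k := key w s w (ψ₀ w) hw hs hw (hψ₀ w hw)
    rw [sub_self, norm_zero, zero_add] at k
    have k2 := abs_sub_abs_le_abs_sub (A * (s - ψ₀ w)) (Δ (x₀ + L (w, s)) - Δ (x₀ + L (w, ψ₀ w)))
    rw [abs_sub_comm (A * (s - ψ₀ w)), abs_mul, abs_of_pos hA0] at k2
    have k3 : κ * (A * |s - ψ₀ w|) ≤ 1 / 4 * (A * |s - ψ₀ w|) := by gcongr
    have k4 : 0 ≤ A * |s - ψ₀ w| := by positivity
    linarith
  · refine LipschitzWith.of_dist_le_mul fun w w' => ?_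
    rw [Real.coe_toNNReal _ (by positivity), dist_eq_norm, add_sub_add_left_eq_sub, ← map_sub,
      Prod.mk_sub_mk]
    refine (hLle _ _).trans ?_
    have k := hψl.dist_le_mul w w'
    rw [Real.coe_toNNReal _ (by positivity), Real.dist_eq, dist_eq_norm] at k
    rw [dist_eq_norm]
    have : 1 / (1 - κ) = 1 + κ / (1 - κ) := by field_simp; ring
    rw [this, add_mul, one_mul]
    linarith
  · intro w s hw hs
    have h := (hρ w s hw hs).2.1
    have h1 : inner ℝ (gradient Δ (x₀ + L (w, s))) e =
        A + inner ℝ (gradient Δ (x₀ + L (w, s)) - gradient Δ x₀) e := by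
      rw [inner_sub_left, hgA, real_inner_smul_left, real_inner_self_eq_norm_sq, he1]; ring
    have h2 := abs_le.1 (abs_real_inner_le_norm (gradient Δ (x₀ + L (w, s)) - gradient Δ x₀) e)
    rw [he1, mul_one] at h2
    rw [hLe, h1]
    nlinarith [h2.1]
  · intro w s hw hs
    have h := (hρ w s hw hs).2.1
    have h1 : inner ℝ (gradient Δ (x₀ + L (w, s))) e =
        A + inner ℝ (gradient Δ (x₀ + L (w, s)) - gradient Δ x₀) e := by
      rw [inner_sub_left, hgA, real_inner_smul_left, real_inner_self_eq_norm_sq, he1]; ring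
    have h2 := abs_le.1 (abs_real_inner_le_norm (gradient Δ (x₀ + L (w, s)) - gradient Δ x₀) e)
    rw [he1, mul_one] at h2
    rw [hLe, h1]
    have h3 : ‖gradient Δ (x₀ + L (w, s))‖ ≤ A + κ / 2 * A := by
      have := norm_add_le (gradient Δ x₀) (gradient Δ (x₀ + L (w, s)) - gradient Δ x₀)
      rw [add_sub_cancel] at this
      linarith
    have h4 : (1 - κ) * ‖gradient Δ (x₀ + L (w, s))‖ ≤ (1 - κ) * (A + κ / 2 * A) := by gcongr
    nlinarith [h2.1, mul_pos (mul_pos hκ hκ) hA0]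

lemma euclideanHausdorffMeasure_image_le {X Y : Type*} [EMetricSpace X] [MeasurableSpace X]
    [BorelSpace X] [EMetricSpace Y] [MeasurableSpace Y] [BorelSpace Y] {K : NNReal} {f : X → Y}
    (hf : LipschitzWith K f) (d : ℕ) (s : Set X) :
    (μHE[d] (f '' s) : ℝ≥0∞) ≤ (K : ℝ≥0∞) ^ d * μHE[d] s := by
  simp only [Measure.euclideanHausdorffMeasure_def, Measure.smul_apply, ENNReal.smul_def,
    smul_eq_mul]
  have := hf.hausdorffMeasure_image_le (d := d) (by positivity) s
  rw [ENNReal.rpow_natCast] at this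
  calc _ ≤ _ * ((K : ℝ≥0∞) ^ d * μH[d] s) := by gcongr
    _ = _ := by ring

namespace GraphChart

variable {n : ℕ} {Δ : Cov n → ℝ} {x₀ : Cov n} {κ : ℝ} {W : Set (Cov n)}
  (c : GraphChart Δ x₀ κ W)

/-- The domain of the chart. -/
def dom : Set (Cov n) :=
  {x | ‖(c.L.symm (x - x₀)).1‖ < c.r ∧ |(c.L.symm (x - x₀)).2| < c.r}

/-- The graph parametrisation of the level set. -/
def γ (w : EuclideanSpace ℝ (Fin n)) : Cov n := x₀ + c.L (w, c.ψ w)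

/-- The projection to the tangent space. -/
def proj (x : Cov n) : EuclideanSpace ℝ (Fin n) := (c.L.symm (x - x₀)).1

/-- The part of the level set inside the chart. -/
def slice : Set (Cov n) := c.dom ∩ {x | Δ x = Δ x₀}

/-- The Lebesgue measure on the base of the chart, transported to the level set. -/
def graphMeasure : Measure (Cov n) :=
  (volume.restrict (Metric.ball (0 : EuclideanSpace ℝ (Fin n)) c.r)).map c.γ

lemma isOpen_dom : IsOpen c.dom := by
  have h : Continuous fun x => c.L.symm (x - x₀) := by fun_prop
  exact (isOpen_lt h.fst.norm continuous_const).inter (isOpen_lt h.snd.abs continuous_const)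

lemma self_mem_dom : x₀ ∈ c.dom := by
  simp [dom, c.r_pos]

lemma add_mem_dom (w : EuclideanSpace ℝ (Fin n)) (s : ℝ) :
    x₀ + c.L (w, s) ∈ c.dom ↔ ‖w‖ < c.r ∧ |s| < c.r := by
  simp [dom]

lemma eq_add (x : Cov n) : x = x₀ + c.L (c.proj x, (c.L.symm (x - x₀)).2) := by
  simp only [proj, Prod.mk.eta, ContinuousLinearEquiv.apply_symm_apply, add_sub_cancel]

lemma dom_subset : c.dom ⊆ W := fun x hx => by
  rw [c.eq_add x]
  exact c.subset _ _ hx.1 hx.2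

lemma continuous_γ : Continuous c.γ := by
  have := c.ψ_continuous
  unfold γ
  fun_prop

lemma γ_mem_slice {w : EuclideanSpace ℝ (Fin n)} (hw : ‖w‖ < c.r) : c.γ w ∈ c.slice :=
  ⟨(c.add_mem_dom _ _).2 ⟨hw, c.ψ_lt w hw⟩, c.level w hw⟩

lemma proj_γ (w : EuclideanSpace ℝ (Fin n)) : c.proj (c.γ w) = w := by
  simp [proj, γ]

/-- The slope bound leaves only one height over each base point at which `Δ` takes the value `Δ x₀`.
-/
lemma γ_proj (hg : gradient Δ x₀ ≠ 0) {x : Cov n} (hx : x ∈ c.slice) : c.γ (c.proj x) = x := by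
  have h := c.slope _ _ hx.1.1 hx.1.2
  change _ * |_ - c.ψ (c.proj x)| ≤ |Δ (x₀ + c.L (c.proj x, _)) - _| at h
  rw [← c.eq_add x, hx.2, sub_self, abs_zero] at h
  have h2 : |(c.L.symm (x - x₀)).2 - c.ψ (c.proj x)| ≤ 0 := by
    by_contra! h3
    have : 0 < ‖gradient Δ x₀‖ := norm_pos_iff.2 hg
    have := mul_pos (half_pos this) h3
    linarith
  have h3 := sub_eq_zero.1 (abs_nonpos_iff.1 h2)
  conv_rhs => rw [c.eq_add x, h3]
  rfl

lemma lipschitz_proj : LipschitzWith 1 c.proj := by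
  refine LipschitzWith.of_dist_le_mul fun x y => ?_
  rw [NNReal.coe_one, one_mul, dist_eq_norm, dist_eq_norm]
  have e : c.proj x - c.proj y = (c.L.symm (x - y)).1 := by
    unfold proj
    rw [← Prod.fst_sub, ← map_sub, sub_sub_sub_cancel_right]
  have h := c.norm_sq (c.L.symm (x - y))
  rw [ContinuousLinearEquiv.apply_symm_apply] at h
  rw [e]
  refine abs_le_of_sq_le_sq' ?_ (norm_nonneg _) |>.2
  nlinarith [sq_nonneg (c.L.symm (x - y)).2]

lemma measurableSet_slice (hΔ : Measurable Δ) : MeasurableSet c.slice :=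
  c.isOpen_dom.measurableSet.inter (hΔ (measurableSet_singleton _))

lemma graphMeasure_apply {A : Set (Cov n)} (hA : MeasurableSet A) :
    c.graphMeasure A = volume (c.γ ⁻¹' A ∩ Metric.ball 0 c.r) := by
  rw [graphMeasure, Measure.map_apply c.continuous_γ.measurable hA,
    Measure.restrict_apply (c.continuous_γ.measurable hA)]

/-- The projection inverts the graph map and does not increase distances, hence does not increase
Hausdorff measure. -/
lemma graphMeasure_le :
    c.graphMeasure ≤ (μHE[n]).restrict c.slice := by
  refine Measure.le_iff.2 fun A hA => ?_
  rw [c.graphMeasure_apply hA, Measure.restrict_apply hA,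
    ← EuclideanSpace.euclideanHausdorffMeasure_eq_volume]
  have h := euclideanHausdorffMeasure_image_le c.lipschitz_proj n (A ∩ c.slice)
  rw [ENNReal.coe_one, one_pow, one_mul] at h
  refine (measure_mono ?_).trans h
  rintro w ⟨hw, hw'⟩
  exact ⟨c.γ w, ⟨hw, c.γ_mem_slice (by simpa using hw')⟩, c.proj_γ w⟩

/-- The slice is covered by the image of the base under the graph map, which stretches distances by
at most `1 / (1 - κ)`. With `graphMeasure_le` this replaces the area formula. -/
lemma restrict_slice_le (hκ : κ < 1) (hg : gradient Δ x₀ ≠ 0) :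
    (μHE[n] : Measure (Cov n)).restrict c.slice ≤
      ENNReal.ofReal ((1 / (1 - κ)) ^ n) • c.graphMeasure := by
  refine Measure.le_iff.2 fun A hA => ?_
  rw [Measure.smul_apply, c.graphMeasure_apply hA, Measure.restrict_apply hA, smul_eq_mul,
    ← EuclideanSpace.euclideanHausdorffMeasure_eq_volume]
  have h := euclideanHausdorffMeasure_image_le c.lipschitz n (c.γ ⁻¹' A ∩ Metric.ball 0 c.r)
  refine (measure_mono ?_).trans (h.trans ?_)
  · rintro x ⟨hx, hx'⟩
    refine ⟨c.proj x, ⟨?_, mem_ball_zero_iff.2 hx'.1.1⟩, c.γ_proj hg hx'⟩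
    rw [Set.mem_preimage, c.γ_proj hg hx']
    exact hx
  · gcongr
    rw [ENNReal.ofNNReal_toNNReal, ← ENNReal.ofReal_pow]
    exact div_nonneg zero_le_one (by linarith)

instance : IsFiniteMeasure c.graphMeasure := by
  unfold graphMeasure
  have : IsFiniteMeasure (volume.restrict (Metric.ball (0 : EuclideanSpace ℝ (Fin n)) c.r)) :=
    ⟨by simpa using Metric.isBounded_ball.measure_lt_top⟩
  infer_instance

lemma measure_slice_lt_top (hκ : κ < 1) (hg : gradient Δ x₀ ≠ 0) :
    μHE[n] c.slice < ∞ := by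
  have h := c.restrict_slice_le hκ hg Set.univ
  rw [Measure.restrict_apply MeasurableSet.univ, Set.univ_inter] at h
  exact h.trans_lt (ENNReal.mul_lt_top ENNReal.ofReal_lt_top (measure_lt_top _ _))

end GraphChart

/-! ### Layers between sublevel sets and their blow-up -/

/-- The oscillation at `x` of the members of the sequence `u` tends to zero. -/
def OscillationVanishesAt {α : Type*} [TopologicalSpace α] (u : ℕ → α → ℝ) (x : α) : Prop :=
  Tendsto (fun q : ℕ × α => u q.1 q.2 - u q.1 x) (atTop ×ˢ 𝓝 x) (𝓝 0)

/-- The increment of the indicator of a sublevel set. -/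
def stepDiff (a b v : ℝ) : ℝ := (if v ≤ b then 1 else 0) - (if v ≤ a then 1 else 0)

lemma abs_stepDiff_le (a b v : ℝ) : |stepDiff a b v| ≤ 1 := by
  unfold stepDiff
  split_ifs <;> simp

lemma abs_sub_le_of_stepDiff_ne {a b v : ℝ} (h : stepDiff a b v ≠ 0) : |v - a| ≤ |b - a| := by
  unfold stepDiff at h
  split_ifs at h with h1 h2 h2
  · simp at h
  · rw [abs_of_nonneg, abs_of_nonneg] <;> linarith
  · rw [abs_of_nonpos, abs_of_nonpos] <;> linarith
  · simp at h

/-- After division by `t` the layer condition compares `v k` with `d k` and with `0`. Since the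
limits are distinct, the comparisons stabilise. The sign `|t| / t` undoes the reversal of
inequalities for negative `t`, and ties are excluded, so `≤` and `<` agree. -/
lemma eventually_stepDiff_eq {t v d : ℕ → ℝ} {v₀ d₀ δ : ℝ} (ht0 : ∀ k, t k ≠ 0)
    (hv : Tendsto v atTop (𝓝 v₀)) (hd : Tendsto d atTop (𝓝 d₀)) (h0 : v₀ ≠ 0) (hvd : v₀ ≠ d₀) :
    ∀ᶠ k in atTop, |t k| / t k * stepDiff δ (δ + t k * d k) (δ + t k * v k) =
      (if v₀ < d₀ then 1 else 0) - (if v₀ < 0 then 1 else 0) := by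
  have e1 : ∀ᶠ k in atTop, (v k < d k ↔ v₀ < d₀) ∧ v k ≠ d k := by
    rcases lt_or_gt_of_ne hvd with h | h
    · filter_upwards [hv.eventually_lt hd h] with k hk
      exact ⟨by simp [hk, h], hk.ne⟩
    · filter_upwards [hd.eventually_lt hv h] with k hk
      exact ⟨iff_of_false hk.le.not_gt h.le.not_gt, hk.ne'⟩
  have e2 : ∀ᶠ k in atTop, (v k < 0 ↔ v₀ < 0) ∧ v k ≠ 0 := by
    rcases lt_or_gt_of_ne h0 with h | h
    · filter_upwards [hv.eventually_lt_const h] with k hk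
      exact ⟨by simp [hk, h], hk.ne⟩
    · filter_upwards [hv.eventually_const_lt h] with k hk
      exact ⟨iff_of_false hk.le.not_gt h.le.not_gt, hk.ne'⟩
  filter_upwards [e1, e2] with k ⟨h1, h1'⟩ ⟨h2, h2'⟩
  simp only [← h1, ← h2, stepDiff, add_le_add_iff_left, add_le_iff_nonpos_right]
  rcases lt_or_gt_of_ne (ht0 k) with ht | ht
  · rw [abs_of_neg ht, neg_div, div_self ht.ne]
    have a1 : (t k * v k ≤ t k * d k) ↔ ¬ v k < d k := by
      rw [mul_le_mul_left_of_neg ht, not_lt]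
    have a2 : (t k * v k ≤ 0) ↔ ¬ v k < 0 := by
      rw [not_lt]; constructor
      · intro h; by_contra! h'; nlinarith
      · intro h; nlinarith
    rw [if_congr a1 rfl rfl, if_congr a2 rfl rfl]
    split_ifs <;> norm_num
  · rw [abs_of_pos ht, div_self ht.ne', one_mul]
    have a1 : (t k * v k ≤ t k * d k) ↔ v k < d k := by
      rw [mul_le_mul_iff_right₀ ht]
      exact ⟨fun h => lt_of_le_of_ne h h1', le_of_lt⟩
    have a2 : (t k * v k ≤ 0) ↔ v k < 0 := by
      constructor
      · intro h
        refine lt_of_le_of_ne ?_ h2'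
        by_contra! h'; nlinarith
      · intro h; nlinarith
    rw [if_congr a1 rfl rfl, if_congr a2 rfl rfl]

lemma integral_step_line {a d : ℝ} (ha : 0 < a) :
    ∫ r : ℝ, ((if a * r < d then 1 else 0) - (if r < 0 then 1 else 0) : ℝ) = d / a := by
  have e : ∀ r : ℝ, (a * r < d ↔ r < d / a) := fun r => by
    rw [lt_div_iff₀ ha, mul_comm]
  simp only [e]
  generalize d / a = b
  rcases le_total 0 b with hb | hb
  · have : (fun r : ℝ => ((if r < b then 1 else 0) - (if r < 0 then 1 else 0) : ℝ)) =
        Set.indicator (Set.Ico 0 b) 1 := by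
      funext r
      simp only [Set.indicator_apply, Set.mem_Ico, Pi.one_apply]
      grind
    rw [this, integral_indicator_one measurableSet_Ico]
    simp [hb]
  · have : (fun r : ℝ => ((if r < b then 1 else 0) - (if r < 0 then 1 else 0) : ℝ)) =
        fun r => - Set.indicator (Set.Ico b 0) 1 r := by
      funext r
      simp only [Set.indicator_apply, Set.mem_Ico, Pi.one_apply]
      grind
    rw [this, integral_neg, integral_indicator_one measurableSet_Ico]
    simp [hb]

/-- A measurable graph is null by Fubini. This discards the points where the limiting step function
jumps. -/
lemma ae_snd_ne {α : Type*} [MeasurableSpace α] {ν : Measure α} [SFinite ν] {f : α → ℝ}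
    (hf : Measurable f) : ∀ᵐ q ∂(ν.prod (volume : Measure ℝ)), q.2 ≠ f q.1 := by
  have hm : MeasurableSet {q : α × ℝ | q.2 = f q.1} :=
    measurableSet_eq_fun measurable_snd (hf.comp measurable_fst)
  have : (ν.prod (volume : Measure ℝ)) {q : α × ℝ | q.2 = f q.1} = 0 := by
    rw [Measure.measure_prod_null hm]
    refine Eventually.of_forall fun w => ?_
    have : Prod.mk w ⁻¹' {q : α × ℝ | q.2 = f q.1} = {f w} := by ext; simp
    simp [this]
  rw [ae_iff]
  simpa using this

lemma measurable_gradient {n : ℕ} (Δ : Cov n → ℝ) : Measurable (gradient Δ) :=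
  (LinearIsometryEquiv.continuous _).measurable.comp (measurable_fderiv ℝ Δ)

namespace GraphChart

variable {n : ℕ} {Δ : Cov n → ℝ} {x₀ : Cov n} {κ : ℝ} {W : Set (Cov n)}
  (c : GraphChart Δ x₀ κ W)

/-- The map is a shear followed by the volume-preserving chart: on each vertical line it is a
translation of a dilation by `t`. Hence the Jacobian is `|t|`, and `ψ` need not be differentiable.
-/
lemma integral_eq_tube {t : ℝ} (ht : t ≠ 0) {f : Cov n → ℝ} (hf : Measurable f) :
    ∫ x, f x = |t| * ∫ q : EuclideanSpace ℝ (Fin n) × ℝ,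
      f (x₀ + c.L (q.1, c.ψ q.1 + t * q.2)) := by
  have hψ := c.ψ_continuous.measurable
  have h1 : ∫ x, f x = ∫ q, f (x₀ + c.L q) := by
    rw [← integral_add_left_eq_self f x₀]
    exact (c.measurePreserving.integral_comp c.L.toHomeomorph.measurableEmbedding
      (fun x => f (x₀ + x))).symm
  have h2 : MeasurePreserving
      (fun q : EuclideanSpace ℝ (Fin n) × ℝ => (q.1, c.ψ q.1 + t * q.2))
      ((volume : Measure (EuclideanSpace ℝ (Fin n))).prod
        (ENNReal.ofReal |t| • (volume : Measure ℝ))) (volume.prod volume) := by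
    refine (MeasurePreserving.id volume).skew_product (g := fun w s => c.ψ w + t * s)
      (by fun_prop) (Eventually.of_forall fun w => ?_)
    have : (fun s => c.ψ w + t * s) = (fun s => c.ψ w + s) ∘ (fun s => t * s) := rfl
    rw [this, ← Measure.map_map (by fun_prop) (by fun_prop), Measure.map_smul,
      Real.smul_map_volume_mul_left ht, map_add_left_eq_self]
  have hf2 : Measurable fun q => f (x₀ + c.L q) :=
    hf.comp (by have := c.L.continuous; fun_prop)
  have h3 : ∫ q, f (x₀ + c.L q) = ∫ q, f (x₀ + c.L (q.1, c.ψ q.1 + t * q.2))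
      ∂((volume : Measure (EuclideanSpace ℝ (Fin n))).prod
        (ENNReal.ofReal |t| • (volume : Measure ℝ))) := by
    rw [Measure.volume_eq_prod, ← h2.map_eq]
    exact integral_map h2.measurable.aemeasurable hf2.aestronglyMeasurable
  rw [h1, h3, Measure.prod_smul_right, integral_smul_measure,
    ENNReal.toReal_ofReal (abs_nonneg t), smul_eq_mul, Measure.volume_eq_prod]

lemma γ_add (w : EuclideanSpace ℝ (Fin n)) (s : ℝ) :
    x₀ + c.L (w, c.ψ w + s) = c.γ w + s • c.L (0, 1) := by
  rw [γ, ← map_smul, add_assoc, ← map_add]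
  simp

lemma integral_graphMeasure {f : Cov n → ℝ} (hf : Measurable f) :
    ∫ x, f x ∂c.graphMeasure = ∫ w in Metric.ball 0 c.r, f (c.γ w) :=
  integral_map c.continuous_γ.measurable.aemeasurable hf.aestronglyMeasurable

/-- In blown-up coordinates the layer has bounded height and its indicator converges almost
everywhere. As `u k` need not converge, the layer integrand is compared with a `k`-dependent one in
which `u k` is frozen at the foot point on the graph. -/
lemma tendsto_tube_sub (hΔ : Measurable Δ) (hg : gradient Δ x₀ ≠ 0) {C : ℝ} {t : ℕ → ℝ}
    {u d : ℕ → Cov n → ℝ} {d₀ : Cov n → ℝ} (ht : Tendsto t atTop (𝓝 0)) (ht0 : ∀ k, t k ≠ 0)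
    (hu : ∀ k, Measurable (u k)) (hd : ∀ k, Measurable (d k)) (hd₀ : Measurable d₀)
    (huC : ∀ k x, |u k x| ≤ C) (hdC : ∀ k x, |d k x| ≤ C) (hd₀C : ∀ x, |d₀ x| ≤ C)
    (hu0 : ∀ k, ∀ x ∉ c.dom, u k x = 0)
    (hlim : ∀ᵐ x ∂(μHE[n]).restrict c.slice, OscillationVanishesAt u x ∧
      Tendsto (fun q : ℕ × Cov n => d q.1 q.2) (atTop ×ˢ 𝓝 x) (𝓝 (d₀ x))) :
    Tendsto (fun k => (t k)⁻¹ * (∫ x, u k x * stepDiff (Δ x₀) (Δ x₀ + t k * d k x) (Δ x)) -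
      ∫ x, u k x * d₀ x / inner ℝ (gradient Δ x) (c.L (0, 1)) ∂c.graphMeasure) atTop (𝓝 0) := by
  set A := ‖gradient Δ x₀‖ with hA
  have hA0 : 0 < A := norm_pos_iff.2 hg
  have hC0 : 0 ≤ C := (abs_nonneg _).trans (hd₀C x₀)
  -- The slope bound `A / 2 * |t s| ≤ |t| * C` confines the rescaled layer to `|s| ≤ R`; this gives
  -- the dominating function.
  set R := 2 * C / A with hR
  set D : Set (EuclideanSpace ℝ (Fin n)) := Metric.ball 0 c.r with hD
  have hgm : Measurable fun x => inner ℝ (gradient Δ x) (c.L (0, 1)) :=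
    (measurable_gradient Δ).inner measurable_const
  set a : EuclideanSpace ℝ (Fin n) → ℝ :=
    fun w => inner ℝ (gradient Δ (c.γ w)) (c.L (0, 1)) with ha
  have ham : Measurable a := hgm.comp c.continuous_γ.measurable
  have ha0 : ∀ w ∈ D, A / 2 ≤ a w := fun w hw =>
    c.inner_ge w _ (by simpa [hD] using hw) (c.ψ_lt w (by simpa [hD] using hw))
  let Φ : ℕ → EuclideanSpace ℝ (Fin n) × ℝ → Cov n :=
    fun k q => x₀ + c.L (q.1, c.ψ q.1 + t k * q.2)
  have hψ := c.ψ_continuous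
  have hΦm : ∀ k, Measurable (Φ k) := fun k => by
    have : Continuous (Φ k) := by
      have := c.L.continuous
      simp only [Φ]
      fun_prop
    exact this.measurable
  have hstep : ∀ k, Measurable fun x => stepDiff (Δ x₀) (Δ x₀ + t k * d k x) (Δ x) := fun k => by
    have := hd k
    unfold stepDiff
    refine Measurable.sub (Measurable.ite ?_ measurable_const measurable_const)
      (Measurable.ite ?_ measurable_const measurable_const)
    · exact measurableSet_le hΔ (by fun_prop)
    · exact measurableSet_le hΔ measurable_const
  let f : ℕ → Cov n → ℝ := fun k x => u k x * stepDiff (Δ x₀) (Δ x₀ + t k * d k x) (Δ x)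
  have hfm : ∀ k, Measurable (f k) := fun k => (hu k).mul (hstep k)
  let F' : ℕ → EuclideanSpace ℝ (Fin n) × ℝ → ℝ := fun k q => |t k| / t k * f k (Φ k q)
  let G : ℕ → EuclideanSpace ℝ (Fin n) × ℝ → ℝ := fun k q => D.indicator (fun w => u k (c.γ w)) q.1 *
    ((if a q.1 * q.2 < d₀ (c.γ q.1) then 1 else 0) - (if q.2 < 0 then 1 else 0))
  have hFm : ∀ k, Measurable (F' k) := fun k => ((hfm k).comp (hΦm k)).const_mul _
  have hGm : ∀ k, Measurable (G k) := fun k => by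
    have hγ := c.continuous_γ.measurable
    refine Measurable.mul ?_ (Measurable.sub (Measurable.ite ?_ measurable_const measurable_const)
      (Measurable.ite ?_ measurable_const measurable_const))
    · exact (((hu k).comp hγ).indicator Metric.isOpen_ball.measurableSet).comp measurable_fst
    · exact measurableSet_lt (by fun_prop) (by fun_prop)
    · exact measurableSet_lt (by fun_prop) (by fun_prop)
  set S : Set (EuclideanSpace ℝ (Fin n) × ℝ) := D ×ˢ Set.Icc (-R) R with hS
  have hSm : MeasurableSet S := Metric.isOpen_ball.measurableSet.prod measurableSet_Icc
  have hSfin : volume S < ∞ := by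
    rw [hS, Measure.volume_eq_prod, Measure.prod_prod]
    exact ENNReal.mul_lt_top Metric.isBounded_ball.measure_lt_top (by simp)
  have hbi : Integrable (S.indicator fun _ => C) (volume : Measure (EuclideanSpace ℝ (Fin n) × ℝ)) :=
    (integrable_indicator_iff hSm).2 (integrableOn_const hSfin.ne)
  have hmulb : ∀ y z : ℝ, |y| ≤ C → |z| ≤ 1 → |y * z| ≤ C := fun y z hy hz => by
    rw [abs_mul]
    calc |y| * |z| ≤ C * 1 := by gcongr
      _ = C := mul_one C
  have hFb : ∀ k q, ‖F' k q‖ ≤ S.indicator (fun _ => C) q := by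
    intro k q
    have ht1 : |(|t k| / t k)| = 1 := by
      rw [abs_div, abs_abs, div_self (abs_ne_zero.2 (ht0 k))]
    by_cases hq : F' k q = 0
    · rw [hq, norm_zero]
      exact Set.indicator_nonneg (fun _ _ => hC0) _
    have hu1 : u k (Φ k q) ≠ 0 := fun h => hq (by simp [F', f, h])
    have hs1 : stepDiff (Δ x₀) (Δ x₀ + t k * d k (Φ k q)) (Δ (Φ k q)) ≠ 0 :=
      fun h => hq (by simp [F', f, h])
    have hdom : Φ k q ∈ c.dom := by
      by_contra h
      exact hu1 (hu0 k _ h)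
    obtain ⟨hw, hs⟩ := (c.add_mem_dom _ _).1 hdom
    have h1 := c.slope _ _ hw hs
    have h2 := abs_sub_le_of_stepDiff_ne hs1
    rw [add_sub_cancel_left, abs_mul] at h1 h2
    have h3 : A / 2 * (|t k| * |q.2|) ≤ |t k| * C :=
      h1.trans (h2.trans (mul_le_mul_of_nonneg_left (hdC k _) (abs_nonneg _)))
    have h4 : 0 < |t k| := abs_pos.2 (ht0 k)
    have h5 : |q.2| ≤ R := by
      rw [hR, le_div_iff₀ hA0]
      have : |t k| * (|q.2| * A) ≤ |t k| * (2 * C) := by linarith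
      exact le_of_mul_le_mul_left this h4
    have hqS : q ∈ S := ⟨by simpa [hD] using hw, abs_le.1 h5⟩
    rw [Set.indicator_of_mem hqS, Real.norm_eq_abs]
    simp only [F', f]
    rw [abs_mul, ht1, one_mul]
    exact hmulb _ _ (huC _ _) (abs_stepDiff_le _ _ _)
  have hGb : ∀ k q, ‖G k q‖ ≤ S.indicator (fun _ => C) q := by
    intro k q
    by_cases hq : G k q = 0
    · rw [hq, norm_zero]
      exact Set.indicator_nonneg (fun _ _ => hC0) _
    have hw : q.1 ∈ D := by
      by_contra h
      exact hq (by simp [G, h])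
    have h0 := ha0 _ hw
    have hs1 : ((if a q.1 * q.2 < d₀ (c.γ q.1) then 1 else 0) - (if q.2 < 0 then 1 else 0) : ℝ) ≠ 0 :=
      fun h => hq (by simp only [G, h, mul_zero])
    have h5 : |q.2| ≤ R := by
      have hb := abs_le.1 (hd₀C (c.γ q.1))
      have h6 : a q.1 * |q.2| ≤ C := by
        split_ifs at hs1 with h1 h2 h2
        · simp at hs1
        · rw [abs_of_nonneg (not_lt.1 h2)]; linarith
        · rw [abs_of_neg h2]; linarith
        · simp at hs1
      rw [hR, le_div_iff₀ hA0]
      have : A / 2 * |q.2| ≤ a q.1 * |q.2| := by gcongr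
      linarith
    have hqS : q ∈ S := ⟨hw, abs_le.1 h5⟩
    rw [Set.indicator_of_mem hqS, Real.norm_eq_abs]
    simp only [G, Set.indicator_of_mem hw]
    refine hmulb _ _ (huC _ _) ?_
    split_ifs <;> simp
  have hFi : ∀ k, Integrable (F' k) volume := fun k =>
    hbi.mono' (hFm k).aestronglyMeasurable (Eventually.of_forall (hFb k))
  have hGi : ∀ k, Integrable (G k) volume := fun k =>
    hbi.mono' (hGm k).aestronglyMeasurable (Eventually.of_forall (hGb k))
  have hIF : ∀ k, (t k)⁻¹ * (∫ x, f k x) = ∫ q, F' k q := fun k => by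
    rw [c.integral_eq_tube (ht0 k) (hfm k), ← mul_assoc, integral_const_mul, div_eq_inv_mul]
  have hIG : ∀ k, ∫ x, u k x * d₀ x / inner ℝ (gradient Δ x) (c.L (0, 1)) ∂c.graphMeasure =
      ∫ q, G k q := fun k => by
    have hi := hGi k
    rw [Measure.volume_eq_prod] at hi ⊢
    have hm : Measurable fun x => u k x * d₀ x / inner ℝ (gradient Δ x) (c.L (0, 1)) :=
      ((hu k).mul hd₀).div hgm
    rw [integral_prod _ hi, c.integral_graphMeasure hm, ← integral_indicator Metric.isOpen_ball.measurableSet]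
    congr 1
    funext w
    simp only [G]
    rw [integral_const_mul]
    by_cases hw : w ∈ D
    · rw [Set.indicator_of_mem hw, Set.indicator_of_mem hw,
        integral_step_line (lt_of_lt_of_le (by positivity) (ha0 w hw)), mul_div_assoc]
    · rw [Set.indicator_of_notMem hw, Set.indicator_of_notMem hw, zero_mul]
  have hae : ∀ᵐ q ∂(volume : Measure (EuclideanSpace ℝ (Fin n) × ℝ)),
      Tendsto (fun k => F' k q - G k q) atTop (𝓝 0) := by
    have h1 : ∀ᵐ w ∂(volume : Measure (EuclideanSpace ℝ (Fin n))), w ∈ D →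
        (OscillationVanishesAt u (c.γ w) ∧
        Tendsto (fun q : ℕ × Cov n => d q.1 q.2) (atTop ×ˢ 𝓝 (c.γ w)) (𝓝 (d₀ (c.γ w)))) := by
      rw [← ae_restrict_iff' Metric.isOpen_ball.measurableSet]
      exact ae_of_ae_map c.continuous_γ.measurable.aemeasurable
        ((Measure.absolutelyContinuous_of_le c.graphMeasure_le) hlim)
    have h2 : ∀ᵐ q ∂((volume : Measure (EuclideanSpace ℝ (Fin n))).prod (volume : Measure ℝ)),
        q.2 ≠ 0 := ae_snd_ne measurable_const
    have h3 : ∀ᵐ q ∂((volume : Measure (EuclideanSpace ℝ (Fin n))).prod (volume : Measure ℝ)),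
        q.2 ≠ d₀ (c.γ q.1) / a q.1 :=
      ae_snd_ne ((hd₀.comp c.continuous_γ.measurable).div ham)
    have h1' := Measure.quasiMeasurePreserving_fst (μ := (volume : Measure (EuclideanSpace ℝ (Fin n))))
      (ν := (volume : Measure ℝ)) |>.ae h1
    rw [Measure.volume_eq_prod]
    filter_upwards [h1', h2, h3] with q hq1 hq2 hq3
    by_cases hw : q.1 ∈ D
    swap
    · have e : ∀ k, F' k q - G k q = 0 := fun k => by
        have hS' : q ∉ S := fun h => hw h.1
        have a1 := hFb k q
        have a2 := hGb k q
        rw [Set.indicator_of_notMem hS'] at a1 a2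
        rw [norm_le_zero_iff.1 a1, norm_le_zero_iff.1 a2, sub_zero]
      simp only [e]
      exact tendsto_const_nhds
    obtain ⟨ho, hdl⟩ := hq1 hw
    have hwr : ‖q.1‖ < c.r := by simpa [hD] using hw
    have hΦe : ∀ k, Φ k q = c.γ q.1 + (t k * q.2) • c.L (0, 1) := fun k => c.γ_add _ _
    have htq : Tendsto (fun k => t k * q.2) atTop (𝓝 0) := by simpa using ht.mul_const q.2
    have hΦl : Tendsto (fun k => Φ k q) atTop (𝓝 (c.γ q.1)) := by
      have := (htq.smul_const (c.L (0, 1))).const_add (c.γ q.1)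
      simp only [zero_smul, add_zero] at this
      simpa only [hΦe] using this
    have hpair := tendsto_id.prodMk hΦl
    have ul : Tendsto (fun k => u k (Φ k q) - u k (c.γ q.1)) atTop (𝓝 0) := ho.comp hpair
    have dl : Tendsto (fun k => d k (Φ k q)) atTop (𝓝 (d₀ (c.γ q.1))) := hdl.comp hpair
    have hderiv : HasDerivAt (fun s : ℝ => Δ (c.γ q.1 + s • c.L (0, 1))) (a q.1) 0 := by
      have h := (c.differentiable q.1 _ hwr (c.ψ_lt _ hwr)).hasFDerivAt
      have hl : HasDerivAt (fun s : ℝ => c.γ q.1 + s • c.L (0, 1)) (c.L (0, 1)) 0 := by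
        simpa using ((hasDerivAt_id (0 : ℝ)).smul_const (c.L (0, 1))).const_add (c.γ q.1)
      have h' : HasFDerivAt Δ (fderiv ℝ Δ (c.γ q.1)) (c.γ q.1 + (0 : ℝ) • c.L (0, 1)) := by
        rw [zero_smul, add_zero]; exact h
      have := h'.comp_hasDerivAt (0 : ℝ) hl
      rwa [← inner_gradient] at this
    -- On a vertical line `Δ` grows from its value on the graph with slope `a q.1`, so its rescaled
    -- increment at height `t k * q.2` tends to `a q.1 * q.2`.
    have hvl : Tendsto (fun k => (Δ (Φ k q) - Δ x₀) / t k) atTop (𝓝 (a q.1 * q.2)) := by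
      have h := hderiv.tendsto_slope_zero
      have h' := (h.comp (tendsto_nhdsWithin_iff.2 ⟨htq, Eventually.of_forall fun k =>
        mul_ne_zero (ht0 k) hq2⟩)).mul_const q.2
      refine h'.congr fun k => ?_
      have hlev : Δ (c.γ q.1) = Δ x₀ := c.level _ hwr
      simp only [Function.comp_apply, zero_add, zero_smul, add_zero, hlev, smul_eq_mul, ← hΦe]
      have := ht0 k
      field_simp
    have hapos : 0 < a q.1 := lt_of_lt_of_le (by positivity) (ha0 _ hw)
    have hev := eventually_stepDiff_eq (δ := Δ x₀) ht0 hvl dl (mul_ne_zero hapos.ne' hq2)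
      (fun h => hq3 (by rw [← h]; field_simp))
    have hfin : Tendsto (fun k => (u k (Φ k q) - u k (c.γ q.1)) *
        ((if a q.1 * q.2 < d₀ (c.γ q.1) then 1 else 0) - (if a q.1 * q.2 < 0 then 1 else 0)))
        atTop (𝓝 0) := by
      simpa using ul.mul_const _
    refine hfin.congr' ?_
    filter_upwards [hev] with k hk
    have e1 : Δ x₀ + t k * ((Δ (Φ k q) - Δ x₀) / t k) = Δ (Φ k q) := by
      have := ht0 k
      field_simp
      ring
    rw [e1] at hk
    have e2 : (a q.1 * q.2 < 0) ↔ q.2 < 0 := by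
      constructor
      · intro h; by_contra! h'; nlinarith
      · intro h; nlinarith
    simp only [F', f, G, Set.indicator_of_mem hw]
    rw [show |t k| / t k * (u k (Φ k q) * stepDiff (Δ x₀) (Δ x₀ + t k * d k (Φ k q)) (Δ (Φ k q))) =
      u k (Φ k q) * (|t k| / t k * stepDiff (Δ x₀) (Δ x₀ + t k * d k (Φ k q)) (Δ (Φ k q))) by ring,
      hk, sub_mul, if_congr e2 rfl rfl]
  have hmain : Tendsto (fun k => ∫ q, (F' k q - G k q)) atTop (𝓝 0) := by
    have := tendsto_integral_of_dominated_convergence (μ := (volume : Measure (EuclideanSpace ℝ (Fin n) × ℝ)))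
      (F := fun k q => F' k q - G k q) (f := fun _ => 0)
      (fun q => S.indicator (fun _ => C) q + S.indicator (fun _ => C) q)
      (fun k => ((hFm k).sub (hGm k)).aestronglyMeasurable) (hbi.add hbi)
      (fun k => Eventually.of_forall fun q =>
        (norm_sub_le _ _).trans (add_le_add (hFb k q) (hGb k q))) hae
    simpa using this
  refine hmain.congr fun k => ?_
  rw [integral_sub (hFi k) (hGi k), ← hIF, hIG]

end GraphChart

/-! ### Comparison of chart integrals with the surface integral -/

/-- The difference is at most the `(ν - Γ)`-integral of `|f|`, and `ν - Γ ≤ (K - 1) Γ`. Subtracting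
measures is avoided by using monotonicity on the nonnegative functions `|f| ± f`. -/
lemma abs_integral_sub_le_of_measure_le {α : Type*} [MeasurableSpace α] {Γ ν : Measure α}
    {K : ℝ} (hK : 1 ≤ K) (h1 : Γ ≤ ν) (h2 : ν ≤ ENNReal.ofReal K • Γ) {f : α → ℝ}
    (hf : Integrable f ν) : |∫ x, f x ∂Γ - ∫ x, f x ∂ν| ≤ (K - 1) * ∫ x, |f x| ∂ν := by
  have hf' : Integrable f Γ := hf.mono_measure h1
  have e1 := integral_mono_measure h1 (f := fun x => |f x| + f x)
    (Eventually.of_forall fun x => by simp only [Pi.zero_apply]; linarith [neg_abs_le (f x)])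
    (hf.abs.add hf)
  have e2 := integral_mono_measure h1 (f := fun x => |f x| - f x)
    (Eventually.of_forall fun x => by simp only [Pi.zero_apply]; linarith [le_abs_self (f x)])
    (hf.abs.sub hf)
  have e3 := integral_mono_measure h2 (f := fun x => |f x|)
    (Eventually.of_forall fun x => abs_nonneg _) (hf'.abs.smul_measure ENNReal.ofReal_ne_top)
  have e4 := integral_mono_measure h1 (f := fun x => |f x|)
    (Eventually.of_forall fun x => abs_nonneg _) hf.abs
  rw [integral_add hf'.abs hf', integral_add hf.abs hf] at e1
  rw [integral_sub hf'.abs hf', integral_sub hf.abs hf] at e2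
  rw [integral_smul_measure, ENNReal.toReal_ofReal (by linarith), smul_eq_mul] at e3
  have e5 : (K - 1) * ∫ x, |f x| ∂Γ ≤ (K - 1) * ∫ x, |f x| ∂ν :=
    mul_le_mul_of_nonneg_left e4 (by linarith)
  rw [abs_le]
  constructor <;> linarith

/-- The surface measure on the level set of `Δ` at level `δ`. -/
def levelMeasure {n : ℕ} (Δ : Cov n → ℝ) (δ : ℝ) : Measure (Cov n) :=
  (μHE[n]).restrict {x | Δ x = δ}

namespace GraphChart

variable {n : ℕ} {Δ : Cov n → ℝ} {x₀ : Cov n} {κ : ℝ} {W : Set (Cov n)}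
  (c : GraphChart Δ x₀ κ W)

lemma levelMeasure_restrict_dom : (levelMeasure Δ (Δ x₀)).restrict c.dom = (μHE[n]).restrict c.slice :=
  Measure.restrict_restrict c.isOpen_dom.measurableSet

lemma norm_L_unit : ‖c.L (0, 1)‖ = 1 := by
  have := c.norm_sq (0, 1)
  simp at this
  rcases this with h | h
  · exact h
  · linarith [norm_nonneg (c.L (0, 1))]

lemma gradient_bounds {x : Cov n} (hx : x ∈ c.dom) :
    ‖gradient Δ x₀‖ / 2 ≤ inner ℝ (gradient Δ x) (c.L (0, 1)) ∧
    (1 - κ) * ‖gradient Δ x‖ ≤ inner ℝ (gradient Δ x) (c.L (0, 1)) ∧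
    inner ℝ (gradient Δ x) (c.L (0, 1)) ≤ ‖gradient Δ x‖ := by
  refine ⟨?_, ?_, ?_⟩
  · have := c.inner_ge _ _ hx.1 hx.2
    rwa [Prod.mk.eta, ContinuousLinearEquiv.apply_symm_apply, add_sub_cancel] at this
  · have := c.inner_ge' _ _ hx.1 hx.2
    rwa [Prod.mk.eta, ContinuousLinearEquiv.apply_symm_apply, add_sub_cancel] at this
  · have := real_inner_le_norm (gradient Δ x) (c.L (0, 1))
    rwa [c.norm_L_unit, mul_one] at this

/-- Two replacements are paid for: the directional derivative by the length of the gradient, at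
relative cost `κ / (1 - κ)`, and the base measure by surface measure, at relative cost `(1 / (1 -
κ)) ^ n - 1`. The factor `2 / ‖gradient Δ x₀‖` bounds the reciprocal gradient on the chart. -/
lemma abs_integral_graphMeasure_sub_le (hκ0 : 0 ≤ κ) (hκ : κ < 1) (hΔ : Measurable Δ)
    (hg : gradient Δ x₀ ≠ 0) {C : ℝ} {u d : Cov n → ℝ} (hu : Measurable u) (hd : Measurable d)
    (huC : ∀ x, |u x| ≤ C) (hdC : ∀ x, |d x| ≤ C) (hu0 : ∀ x ∉ c.dom, u x = 0) :
    |∫ x, u x * d x / inner ℝ (gradient Δ x) (c.L (0, 1)) ∂c.graphMeasure -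
      ∫ x, u x * d x / ‖gradient Δ x‖ ∂(levelMeasure Δ (Δ x₀))| ≤
    2 / ‖gradient Δ x₀‖ * (κ / (1 - κ) + ((1 / (1 - κ)) ^ n - 1)) *
      (C * ∫ x, |u x| ∂(levelMeasure Δ (Δ x₀))) := by
  set A := ‖gradient Δ x₀‖ with hA
  have hA0 : 0 < A := norm_pos_iff.2 hg
  have hC : 0 ≤ C := (abs_nonneg _).trans (huC x₀)
  have hκ1 : 0 < 1 - κ := by linarith
  set ν := (μHE[n] : Measure (Cov n)).restrict c.slice with hν
  have hsw : ∀ f : Cov n → ℝ, (∀ x ∉ c.dom, f x = 0) →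
      ∫ x, f x ∂(levelMeasure Δ (Δ x₀)) = ∫ x, f x ∂ν := fun f hf => by
    rw [hν, ← c.levelMeasure_restrict_dom, setIntegral_eq_integral_of_forall_compl_eq_zero hf]
  rw [hsw _ fun x hx => by rw [hu0 x hx]; simp, hsw _ fun x hx => by rw [hu0 x hx]; simp]
  have hfin : IsFiniteMeasure ν := ⟨by
    rw [hν, Measure.restrict_apply_univ]; exact c.measure_slice_lt_top hκ hg⟩
  set Γ := c.graphMeasure with hΓ
  have hΓν : Γ ≤ ν := c.graphMeasure_le
  have hνdom : ∀ᵐ x ∂ν, x ∈ c.dom :=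
    (ae_restrict_mem (c.measurableSet_slice hΔ)).mono fun x hx => hx.1
  have hΓdom : ∀ᵐ x ∂Γ, x ∈ c.dom := (Measure.absolutelyContinuous_of_le hΓν) hνdom
  have hgm := measurable_gradient Δ
  have hui : Integrable u ν := Integrable.of_bound hu.aestronglyMeasurable C
    (Eventually.of_forall huC)
  have hbd : ∀ x ∈ c.dom, |u x * d x / ‖gradient Δ x‖| ≤ 2 / A * C * |u x| := fun x hx => by
    obtain ⟨b1, b2, b3⟩ := c.gradient_bounds hx
    have hpos : 0 < ‖gradient Δ x‖ := by linarith [half_pos hA0]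
    rw [abs_div, abs_norm, abs_mul, div_le_iff₀ hpos]
    calc |u x| * |d x| ≤ |u x| * C := by gcongr; exact hdC x
      _ = 2 / A * C * |u x| * (A / 2) := by field_simp
      _ ≤ 2 / A * C * |u x| * ‖gradient Δ x‖ := by gcongr; linarith
  have hbd' : ∀ x ∈ c.dom, |u x * d x / inner ℝ (gradient Δ x) (c.L (0, 1)) -
      u x * d x / ‖gradient Δ x‖| ≤ κ / (1 - κ) * (2 / A * C * |u x|) := fun x hx => by
    obtain ⟨b1, b2, b3⟩ := c.gradient_bounds hx
    have ha : 0 < inner ℝ (gradient Δ x) (c.L (0, 1)) := by linarith [half_pos hA0]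
    have hpos : 0 < ‖gradient Δ x‖ := by linarith
    have e : u x * d x / inner ℝ (gradient Δ x) (c.L (0, 1)) - u x * d x / ‖gradient Δ x‖ =
        (‖gradient Δ x‖ - inner ℝ (gradient Δ x) (c.L (0, 1))) /
          inner ℝ (gradient Δ x) (c.L (0, 1)) * (u x * d x / ‖gradient Δ x‖) := by
      field_simp
    rw [e, abs_mul]
    refine mul_le_mul ?_ (hbd x hx) (abs_nonneg _) (by positivity)
    rw [abs_of_nonneg (div_nonneg (by linarith) ha.le), div_le_div_iff₀ ha hκ1]
    nlinarith
  have hm1 : Measurable fun x => u x * d x / ‖gradient Δ x‖ := (hu.mul hd).div hgm.norm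
  have hm2 : Measurable fun x => u x * d x / inner ℝ (gradient Δ x) (c.L (0, 1)) :=
    (hu.mul hd).div (hgm.inner measurable_const)
  have hi1 : Integrable (fun x => u x * d x / ‖gradient Δ x‖) ν :=
    (hui.abs.const_mul (2 / A * C)).mono' hm1.aestronglyMeasurable (hνdom.mono hbd)
  have hi3 : Integrable (fun x => u x * d x / inner ℝ (gradient Δ x) (c.L (0, 1)) -
      u x * d x / ‖gradient Δ x‖) Γ :=
    ((hui.mono_measure hΓν).abs.const_mul (2 / A * C) |>.const_mul (κ / (1 - κ))).mono'
      (hm2.sub hm1).aestronglyMeasurable (hΓdom.mono hbd')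
  have hi1' := hi1.mono_measure hΓν
  have hi2 : Integrable (fun x => u x * d x / inner ℝ (gradient Δ x) (c.L (0, 1))) Γ := by
    refine (hi3.add hi1').congr (Eventually.of_forall fun x => ?_)
    simp
  have hK : 1 ≤ (1 / (1 - κ)) ^ n := one_le_pow₀ (by rw [le_div_iff₀ hκ1]; linarith)
  have p1 := abs_integral_sub_le_of_measure_le hK hΓν (c.restrict_slice_le hκ hg) hi1
  have p2 : |∫ x, u x * d x / inner ℝ (gradient Δ x) (c.L (0, 1)) ∂Γ -
      ∫ x, u x * d x / ‖gradient Δ x‖ ∂Γ| ≤ κ / (1 - κ) * (2 / A * C * ∫ x, |u x| ∂ν) := by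
    rw [← integral_sub hi2 hi1']
    have q1 := norm_integral_le_of_norm_le (μ := Γ)
      (f := fun x => u x * d x / inner ℝ (gradient Δ x) (c.L (0, 1)) - u x * d x / ‖gradient Δ x‖)
      ((hui.mono_measure hΓν).abs.const_mul (2 / A * C) |>.const_mul (κ / (1 - κ)))
      (hΓdom.mono hbd')
    rw [integral_const_mul, integral_const_mul, Real.norm_eq_abs] at q1
    have q2 := integral_mono_measure hΓν (f := fun x => |u x|)
      (Eventually.of_forall fun x => abs_nonneg _) hui.abs
    exact q1.trans (by gcongr)
  have p3 : ∫ x, |u x * d x / ‖gradient Δ x‖| ∂ν ≤ 2 / A * C * ∫ x, |u x| ∂ν := by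
    rw [← integral_const_mul]
    exact integral_mono_ae hi1.abs (hui.abs.const_mul _) (hνdom.mono hbd)
  have p4 : ((1 / (1 - κ)) ^ n - 1) * ∫ x, |u x * d x / ‖gradient Δ x‖| ∂ν ≤
      ((1 / (1 - κ)) ^ n - 1) * (2 / A * C * ∫ x, |u x| ∂ν) :=
    mul_le_mul_of_nonneg_left p3 (by linarith)
  have p5 := abs_sub_le (∫ x, u x * d x / inner ℝ (gradient Δ x) (c.L (0, 1)) ∂Γ)
    (∫ x, u x * d x / ‖gradient Δ x‖ ∂Γ) (∫ x, u x * d x / ‖gradient Δ x‖ ∂ν)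
  refine p5.trans ?_
  have : 2 / A * (κ / (1 - κ) + ((1 / (1 - κ)) ^ n - 1)) * (C * ∫ x, |u x| ∂ν) =
    κ / (1 - κ) * (2 / A * C * ∫ x, |u x| ∂ν) +
      ((1 / (1 - κ)) ^ n - 1) * (2 / A * C * ∫ x, |u x| ∂ν) := by ring
  rw [this]
  exact add_le_add p2 (p1.trans p4)

end GraphChart

lemma exists_chart_parameter (n : ℕ) {A ε : ℝ} (hε : 0 < ε) :
    ∃ κ : ℝ, 0 < κ ∧ κ ≤ 1 / 4 ∧ 2 / A * (κ / (1 - κ) + ((1 / (1 - κ)) ^ n - 1)) ≤ ε := by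
  have hc : ContinuousAt (fun κ : ℝ => 2 / A * (κ / (1 - κ) + ((1 / (1 - κ)) ^ n - 1))) 0 := by
    have h1 : ContinuousAt (fun κ : ℝ => 1 - κ) 0 := by fun_prop
    have h2 : (1 : ℝ) - 0 ≠ 0 := by norm_num
    exact continuousAt_const.mul ((continuousAt_id.div h1 h2).add
      (((continuousAt_const.div h1 h2).pow n).sub continuousAt_const))
  have h0 : (fun κ : ℝ => 2 / A * (κ / (1 - κ) + ((1 / (1 - κ)) ^ n - 1))) 0 < ε := by simpa using hε
  have h1 := (hc.eventually_lt_const h0).filter_mono (nhdsWithin_le_nhds (s := Set.Ioi 0))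
  have h2 : ∀ᶠ κ : ℝ in 𝓝[>] 0, κ < 1 / 4 := (gt_mem_nhds (by norm_num)).filter_mono nhdsWithin_le_nhds
  obtain ⟨κ, ⟨h3, h4⟩, h5⟩ := ((h1.and h2).and self_mem_nhdsWithin).exists
  exact ⟨κ, h5, h4.le, h3.le⟩

/-- The increment of sublevel set integrals, localised near a regular point, is the surface
integral up to a small relative error. -/
lemma exists_nhds_tube_approx {n : ℕ} {Δ : Cov n → ℝ} (hΔ : Measurable Δ) {x₀ : Cov n}
    (hC1 : ContDiffAt ℝ 1 Δ x₀) (hg : gradient Δ x₀ ≠ 0) {W : Set (Cov n)} (hW : W ∈ 𝓝 x₀)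
    {ε : ℝ} (hε : 0 < ε) :
    ∃ N : Set (Cov n), IsOpen N ∧ x₀ ∈ N ∧ N ⊆ W ∧ levelMeasure Δ (Δ x₀) N < ∞ ∧
    ∀ (C : ℝ) (t : ℕ → ℝ) (u d : ℕ → Cov n → ℝ) (d₀ : Cov n → ℝ),
      Tendsto t atTop (𝓝 0) → (∀ k, t k ≠ 0) →
      (∀ k, Measurable (u k)) → (∀ k, Measurable (d k)) → Measurable d₀ →
      (∀ k x, |u k x| ≤ C) → (∀ k x, |d k x| ≤ C) → (∀ x, |d₀ x| ≤ C) →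
      (∀ k, ∀ x ∉ N, u k x = 0) →
      (∀ᵐ x ∂(levelMeasure Δ (Δ x₀)), x ∈ N → OscillationVanishesAt u x) →
      (∀ x ∈ N, Tendsto (fun q : ℕ × Cov n => d q.1 q.2) (atTop ×ˢ 𝓝 x) (𝓝 (d₀ x))) →
      ∀ ε' : ℝ, 0 < ε' → ∀ᶠ k in atTop,
      |(t k)⁻¹ * (∫ x, u k x * stepDiff (Δ x₀) (Δ x₀ + t k * d k x) (Δ x)) -
        ∫ x, u k x * d₀ x / ‖gradient Δ x‖ ∂(levelMeasure Δ (Δ x₀))| ≤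
        ε' + ε * (C * ∫ x, |u k x| ∂(levelMeasure Δ (Δ x₀))) := by
  -- The flatness `κ` is fixed before the chart, so that the geometric error is a multiple `ε` of
  -- the surface mass of `u k`; only the remaining error `ε'` depends on `k`.
  obtain ⟨κ, hκ0, hκ4, hκ⟩ := exists_chart_parameter n (A := ‖gradient Δ x₀‖) hε
  obtain ⟨c⟩ := nonempty_graphChart hC1 hg hκ0 hκ4 hW
  have hκ1 : κ < 1 := by linarith
  refine ⟨c.dom, c.isOpen_dom, c.self_mem_dom, c.dom_subset, ?_, ?_⟩
  · have := c.measure_slice_lt_top hκ1 hg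
    rwa [← Measure.restrict_apply_univ, ← c.levelMeasure_restrict_dom,
      Measure.restrict_apply_univ] at this
  intro C t u d d₀ ht ht0 hu hd hd₀ huC hdC hd₀C hu0 hosc hlim ε' hε'
  have hC : 0 ≤ C := (abs_nonneg _).trans (hd₀C x₀)
  have hlim' : ∀ᵐ x ∂(μHE[n]).restrict c.slice, OscillationVanishesAt u x ∧
      Tendsto (fun q : ℕ × Cov n => d q.1 q.2) (atTop ×ˢ 𝓝 x) (𝓝 (d₀ x)) := by
    rw [← c.levelMeasure_restrict_dom, ae_restrict_iff' c.isOpen_dom.measurableSet]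
    exact hosc.mono fun x hx hxd => ⟨hx hxd, hlim x hxd⟩
  have h1 := c.tendsto_tube_sub hΔ hg ht ht0 hu hd hd₀ huC hdC hd₀C hu0 hlim'
  filter_upwards [(Metric.tendsto_nhds.1 h1) ε' hε'] with k hk
  rw [Real.dist_eq, sub_zero] at hk
  have h2 := c.abs_integral_graphMeasure_sub_le hκ0.le hκ1 hΔ hg (hu k) hd₀ (huC k) hd₀C (hu0 k)
  have h3 : 0 ≤ C * ∫ x, |u k x| ∂(levelMeasure Δ (Δ x₀)) :=
    mul_nonneg hC (integral_nonneg fun _ => abs_nonneg _)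
  refine (abs_sub_le _ _ _).trans (add_le_add hk.le (h2.trans ?_))
  exact mul_le_mul_of_nonneg_right hκ h3

/-- Split `χ y u y - χ x u x` as `χ y (u y - u x) + (χ y - χ x) u x`; the uniform bound on `u`
controls the second term. -/
lemma OscillationVanishesAt.mul_left {α : Type*} [TopologicalSpace α] {u : ℕ → α → ℝ} {x : α}
    (h : OscillationVanishesAt u x) {C : ℝ} (hC : ∀ k y, |u k y| ≤ C) {χ : α → ℝ}
    (hχ : ContinuousAt χ x) : OscillationVanishesAt (fun k y => χ y * u k y) x := by
  have h1 : Tendsto (fun q : ℕ × α => χ q.2) (atTop ×ˢ 𝓝 x) (𝓝 (χ x)) :=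
    hχ.tendsto.comp tendsto_snd
  have h2 := h1.mul h
  have h3 : Tendsto (fun q : ℕ × α => (χ q.2 - χ x) * u q.1 x) (atTop ×ˢ 𝓝 x) (𝓝 0) := by
    have h4 : Tendsto (fun q : ℕ × α => C * |χ q.2 - χ x|) (atTop ×ˢ 𝓝 x) (𝓝 0) := by
      simpa using ((h1.sub_const (χ x)).abs).const_mul C
    refine squeeze_zero_norm (fun q => ?_) h4
    rw [norm_mul, mul_comm]
    exact mul_le_mul_of_nonneg_right (hC _ _) (norm_nonneg _)
  have := h2.add h3
  rw [mul_zero, add_zero] at this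
  refine this.congr fun q => ?_
  ring

/-! ### From charts to a compact piece of the level set -/

section
variable {n : ℕ} {Δ : Cov n → ℝ} {δ : ℝ} {K : Set (Cov n)}

lemma isCompact_levelSet (hK : IsCompact K) (hcont : ContinuousOn Δ K) :
    IsCompact (K ∩ {x | Δ x = δ}) := by
  obtain ⟨u, hu, hu'⟩ := continuousOn_iff_isClosed.1 hcont _ (isClosed_singleton (x := δ))
  have : K ∩ {x | Δ x = δ} = K ∩ u := by
    rw [Set.inter_comm K u, ← hu', Set.inter_comm]; rfl
  rw [this]
  exact hK.inter_right hu

/-- On the compact set `K \ N` the function `|Δ - δ|` is positive and attains its minimum. -/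
lemma exists_tube_subset (hK : IsCompact K) (hcont : ContinuousOn Δ K) {N : Set (Cov n)}
    (hN : IsOpen N) (hsub : K ∩ {x | Δ x = δ} ⊆ N) :
    ∃ η : ℝ, 0 < η ∧ ∀ x ∈ K, |Δ x - δ| ≤ η → x ∈ N := by
  rcases (K \ N).eq_empty_or_nonempty with h | h
  · exact ⟨1, one_pos, fun x hx _ => by
      by_contra hxN
      exact (h ▸ (⟨hx, hxN⟩ : x ∈ K \ N) : x ∈ (∅ : Set (Cov n)))⟩
  · have hc : ContinuousOn (fun x => |Δ x - δ|) (K \ N) :=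
      ((hcont.mono Set.sdiff_subset).sub continuousOn_const).abs
    obtain ⟨x, hx, hmin⟩ := (hK.diff hN).exists_isMinOn h hc
    have hpos : 0 < |Δ x - δ| := by
      rw [abs_pos, sub_ne_zero]
      exact fun h => hx.2 (hsub ⟨hx.1, h⟩)
    refine ⟨|Δ x - δ| / 2, half_pos hpos, fun y hy hyη => ?_⟩
    by_contra hyN
    have : |Δ x - δ| ≤ |Δ y - δ| := hmin ⟨hy, hyN⟩
    linarith

variable (hΔ : Measurable Δ) (hK : IsCompact K) (hcont : ContinuousOn Δ K)
  (hreg : ∀ x ∈ K, Δ x = δ → ContDiffAt ℝ 1 Δ x ∧ gradient Δ x ≠ 0)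
include hΔ hK hcont hreg

lemma levelMeasure_lt_top : levelMeasure Δ δ K < ∞ := by
  have h0 : levelMeasure Δ δ K = levelMeasure Δ δ (K ∩ {x | Δ x = δ}) := by
    have hm : MeasurableSet {x | Δ x = δ} := hΔ (measurableSet_singleton _)
    rw [levelMeasure, Measure.restrict_apply' hm, Measure.restrict_apply' hm, Set.inter_assoc,
      Set.inter_self]
  rw [h0]
  refine (isCompact_levelSet hK hcont).measure_lt_top_of_nhdsWithin fun x hx => ?_
  obtain ⟨h1, h2⟩ := hreg x hx.1 hx.2
  obtain ⟨N, hNo, hxN, -, hlt, -⟩ := exists_nhds_tube_approx hΔ h1 h2 univ_mem one_pos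
  rw [hx.2] at hlt
  exact ⟨N, mem_nhdsWithin_of_mem_nhds (hNo.mem_nhds hxN), hlt⟩

omit hΔ in
lemma exists_gradient_lower_bound :
    ∃ m : ℝ, 0 < m ∧ ∀ x ∈ K, Δ x = δ → m ≤ ‖gradient Δ x‖ := by
  rcases (K ∩ {x | Δ x = δ}).eq_empty_or_nonempty with h | h
  · exact ⟨1, one_pos, fun x hx hx' =>
      absurd (h ▸ (⟨hx, hx'⟩ : x ∈ K ∩ {x | Δ x = δ}) : x ∈ (∅ : Set (Cov n))) (by simp)⟩
  · have hc : ContinuousOn (fun x => ‖gradient Δ x‖) (K ∩ {x | Δ x = δ}) := fun x hx =>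
      (continuousAt_gradient (hreg x hx.1 hx.2).1).norm.continuousWithinAt
    obtain ⟨x, hx, hmin⟩ := (isCompact_levelSet hK hcont).exists_isMinOn h hc
    exact ⟨_, norm_pos_iff.2 (hreg x hx.1 hx.2).2, fun y hy hy' => hmin ⟨hy, hy'⟩⟩

lemma integrable_div_gradient {f : Cov n → ℝ} (hf : Measurable f) {C : ℝ} (hfC : ∀ x, |f x| ≤ C)
    (hf0 : ∀ x ∉ K, f x = 0) :
    Integrable (fun x => f x / ‖gradient Δ x‖) (levelMeasure Δ δ) := by
  obtain ⟨m, hm, hmK⟩ := exists_gradient_lower_bound hK hcont hreg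
  have hC : 0 ≤ C := (abs_nonneg _).trans (hfC 0)
  have hfin := levelMeasure_lt_top hΔ hK hcont hreg
  have hb : Integrable (K.indicator fun _ => C / m) (levelMeasure Δ δ) :=
    (integrable_indicator_iff hK.measurableSet).2 (integrableOn_const hfin.ne)
  refine hb.mono' (hf.div (measurable_gradient Δ).norm).aestronglyMeasurable ?_
  filter_upwards [ae_restrict_mem (hΔ (measurableSet_singleton δ))] with x hx
  by_cases hxK : x ∈ K
  · rw [Set.indicator_of_mem hxK, norm_div, norm_norm]
    have := hmK x hxK hx
    exact div_le_div₀ hC (hfC x) hm this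
  · simp [hf0 x hxK, hxK]

lemma integrable_levelMeasure {f : Cov n → ℝ} (hf : Measurable f) {C : ℝ} (hfC : ∀ x, |f x| ≤ C)
    (hf0 : ∀ x ∉ K, f x = 0) : Integrable f (levelMeasure Δ δ) := by
  have hfin := levelMeasure_lt_top hΔ hK hcont hreg
  have hb : Integrable (K.indicator fun _ => C) (levelMeasure Δ δ) :=
    (integrable_indicator_iff hK.measurableSet).2 (integrableOn_const hfin.ne)
  refine hb.mono' hf.aestronglyMeasurable (Eventually.of_forall fun x => ?_)
  by_cases hxK : x ∈ K
  · rw [Set.indicator_of_mem hxK]; exact hfC x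
  · simp [hf0 x hxK, hxK]

/-- The difference quotient of sublevel set integrals is asymptotically the surface integral. -/
theorem tendsto_tube_sub_surface {O : Set (Cov n)} (hO : IsOpen O) (hKO : K ⊆ O) {C : ℝ}
    {t : ℕ → ℝ} {u d : ℕ → Cov n → ℝ} {d₀ : Cov n → ℝ}
    (ht : Tendsto t atTop (𝓝 0)) (ht0 : ∀ k, t k ≠ 0)
    (hu : ∀ k, Measurable (u k)) (hd : ∀ k, Measurable (d k)) (hd₀ : Measurable d₀)
    (huC : ∀ k x, |u k x| ≤ C) (hdC : ∀ k x, |d k x| ≤ C) (hd₀C : ∀ x, |d₀ x| ≤ C)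
    (hu0 : ∀ k, ∀ x ∉ K, u k x = 0)
    (hosc : ∀ᵐ x ∂(levelMeasure Δ δ), x ∈ K → OscillationVanishesAt u x)
    (hlim : ∀ x ∈ O, Tendsto (fun q : ℕ × Cov n => d q.1 q.2) (atTop ×ˢ 𝓝 x) (𝓝 (d₀ x))) :
    Tendsto (fun k => (t k)⁻¹ * (∫ x, u k x * stepDiff δ (δ + t k * d k x) (Δ x)) -
      ∫ x, u k x * d₀ x / ‖gradient Δ x‖ ∂(levelMeasure Δ δ)) atTop (𝓝 0) := by
  have hC : 0 ≤ C := (abs_nonneg _).trans (hd₀C 0)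
  rw [Metric.tendsto_nhds]
  intro ε₀ hε₀
  set T := (levelMeasure Δ δ).real K with hT
  have hT0 : 0 ≤ T := measureReal_nonneg
  have hfin := levelMeasure_lt_top hΔ hK hcont hreg
  -- The geometric errors of all charts will sum to at most `ε * (C * (C * T))`, which is below `ε₀
  -- / 2`.
  set ε := ε₀ / (2 * (C * (C * T) + 1)) with hε
  have hεpos : 0 < ε := by positivity
  have hloc : ∀ x : ↥(K ∩ {x | Δ x = δ}), _ := fun x =>
    exists_nhds_tube_approx hΔ (hreg x x.2.1 x.2.2).1 (hreg x x.2.1 x.2.2).2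
      (hO.mem_nhds (hKO x.2.1)) hεpos
  choose N hNo hxN hNO hNfin hN using hloc
  obtain ⟨I, hI⟩ := (isCompact_levelSet (δ := δ) hK hcont).elim_finite_subcover N hNo
    (fun x hx => Set.mem_iUnion.2 ⟨⟨x, hx⟩, hxN _⟩)
  obtain ⟨η, hη, hηN⟩ := exists_tube_subset hK hcont (isOpen_biUnion fun i (_ : i ∈ I) => hNo i) hI
  -- The partition of unity must sum to one on a whole tube, because the layers lie beside the level
  -- set; for large `k` they are contained in this tube.
  set Kη : Set (Cov n) := K ∩ Δ ⁻¹' Metric.closedBall δ η with hKη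
  have hKηc : IsCompact Kη := by
    obtain ⟨v, hv, hv'⟩ := continuousOn_iff_isClosed.1 hcont _
      (Metric.isClosed_closedBall (x := δ) (ε := η))
    rw [hKη, Set.inter_comm, hv', Set.inter_comm]
    exact hK.inter_right hv
  let e := I.equivFin
  obtain ⟨χ, hχs, hχ1, hχ01, -⟩ := exists_continuous_sum_one_of_isOpen_isCompact
    (s := fun j => N (e.symm j)) (fun j => hNo _) hKηc (fun x hx => by
      obtain ⟨i, hi, hxi⟩ := Set.mem_iUnion₂.1 (hηN x hx.1 (by
        have := hx.2; rwa [Set.mem_preimage, Metric.mem_closedBall, Real.dist_eq] at this))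
      exact Set.mem_iUnion.2 ⟨e ⟨i, hi⟩, by simpa using hxi⟩)
  have hχsum : ∀ x ∈ K, |Δ x - δ| ≤ η → ∑ j, χ j x = 1 := fun x hx hx' => by
    have := hχ1 (show x ∈ Kη from ⟨hx, by
      rwa [Set.mem_preimage, Metric.mem_closedBall, Real.dist_eq]⟩)
    simpa using this
  let uj : Fin I.card → ℕ → Cov n → ℝ := fun j k x => χ j x * u k x
  have hujm : ∀ j k, Measurable (uj j k) := fun j k => (χ j).continuous.measurable.mul (hu k)
  have hujle : ∀ j k x, |uj j k x| ≤ χ j x * |u k x| := fun j k x => by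
    rw [abs_mul, abs_of_nonneg (hχ01 j x).1]
  have hujC : ∀ j k x, |uj j k x| ≤ C := fun j k x => (hujle j k x).trans (by
    calc χ j x * |u k x| ≤ 1 * C :=
          mul_le_mul (hχ01 j x).2 (huC k x) (abs_nonneg _) zero_le_one
      _ = C := one_mul C)
  have huj0 : ∀ j k, ∀ x ∉ K, uj j k x = 0 := fun j k x hx => by simp [uj, hu0 k x hx]
  have hujosc : ∀ j, ∀ᵐ x ∂(levelMeasure Δ δ), x ∈ N (e.symm j) → OscillationVanishesAt (uj j) x := by
    intro j
    filter_upwards [hosc] with x hx _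
    refine OscillationVanishesAt.mul_left ?_ huC (χ j).continuous.continuousAt
    by_cases hxK : x ∈ K
    · exact hx hxK
    · have hnear : ∀ᶠ y in 𝓝 x, y ∉ K := hK.isClosed.isOpen_compl.mem_nhds hxK
      refine tendsto_const_nhds.congr' ?_
      filter_upwards [tendsto_snd.eventually hnear] with q hq
      rw [hu0 _ _ hq, hu0 _ _ hxK, sub_zero]
  have hε'pos : 0 < ε₀ / (2 * (I.card + 1)) := by positivity
  have hev : ∀ j, ∀ᶠ k in atTop,
      |(t k)⁻¹ * (∫ x, uj j k x * stepDiff δ (δ + t k * d k x) (Δ x)) -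
        ∫ x, uj j k x * d₀ x / ‖gradient Δ x‖ ∂(levelMeasure Δ δ)| ≤
        ε₀ / (2 * (I.card + 1)) + ε * (C * ∫ x, |uj j k x| ∂(levelMeasure Δ δ)) := by
    intro j
    have hlev : Δ (e.symm j : ↥(K ∩ {x | Δ x = δ})) = δ := (e.symm j).1.2.2
    have := hN (e.symm j) C t (uj j) d d₀ ht ht0 (hujm j) hd hd₀ (hujC j) hdC hd₀C
      (fun k x hx => by
        have : χ j x = 0 := by
          by_contra h
          exact hx (hχs j (subset_tsupport _ h))
        simp [uj, this])
      (by rw [hlev]; exact hujosc j) (fun x hx => hlim x (hNO _ hx)) _ hε'pos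
    rwa [hlev] at this
  have hsmall : ∀ᶠ k in atTop, |t k| * C < η := by
    have : Tendsto (fun k => |t k| * C) atTop (𝓝 0) := by simpa using ht.abs.mul_const C
    exact this.eventually_lt_const hη
  filter_upwards [eventually_all.2 hev, hsmall] with k hk hks
  have hstepm : Measurable fun x => stepDiff δ (δ + t k * d k x) (Δ x) := by
    have := hd k
    unfold stepDiff
    refine Measurable.sub (Measurable.ite ?_ measurable_const measurable_const)
      (Measurable.ite ?_ measurable_const measurable_const)
    · exact measurableSet_le hΔ (by fun_prop)
    · exact measurableSet_le hΔ measurable_const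
  have hvol : ∀ j, Integrable (fun x => uj j k x * stepDiff δ (δ + t k * d k x) (Δ x)) := by
    intro j
    have hb : Integrable (K.indicator fun _ => C) (volume : Measure (Cov n)) :=
      (integrable_indicator_iff hK.measurableSet).2 (integrableOn_const hK.measure_lt_top.ne)
    refine hb.mono' ((hujm j k).mul hstepm).aestronglyMeasurable (Eventually.of_forall fun x => ?_)
    by_cases hxK : x ∈ K
    · rw [Set.indicator_of_mem hxK, Real.norm_eq_abs, abs_mul]
      calc _ ≤ C * 1 := mul_le_mul (hujC j k x) (abs_stepDiff_le _ _ _) (abs_nonneg _) hC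
        _ = C := mul_one C
    · simp [huj0 j k x hxK, hxK]
  have e1 : ∫ x, u k x * stepDiff δ (δ + t k * d k x) (Δ x) =
      ∑ j, ∫ x, uj j k x * stepDiff δ (δ + t k * d k x) (Δ x) := by
    rw [← integral_finsetSum _ fun j _ => hvol j]
    congr 1
    funext x
    simp only [uj]
    rw [← Finset.sum_mul, ← Finset.sum_mul]
    by_cases hx : x ∈ K
    swap
    · simp [hu0 k x hx]
    by_cases hs : stepDiff δ (δ + t k * d k x) (Δ x) = 0
    · simp [hs]
    have := abs_sub_le_of_stepDiff_ne hs
    rw [add_sub_cancel_left, abs_mul] at this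
    rw [hχsum x hx (this.trans ((mul_le_mul_of_nonneg_left (hdC k x) (abs_nonneg _)).trans hks.le)),
      one_mul]
  have hsurf : ∀ j, Integrable (fun x => uj j k x * d₀ x / ‖gradient Δ x‖) (levelMeasure Δ δ) := by
    intro j
    refine integrable_div_gradient hΔ hK hcont hreg ((hujm j k).mul hd₀) (C := C * C) (fun x => ?_)
      (fun x hx => by simp [huj0 j k x hx])
    simp only [abs_mul]
    exact mul_le_mul (hujC j k x) (hd₀C x) (abs_nonneg _) hC
  have hlevae : ∀ᵐ x ∂(levelMeasure Δ δ), Δ x = δ :=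
    ae_restrict_mem (hΔ (measurableSet_singleton δ))
  have hsum_ae : ∀ᵐ x ∂(levelMeasure Δ δ), x ∈ K → ∑ j, χ j x = 1 :=
    hlevae.mono fun x hx hxK => hχsum x hxK (by rw [hx, sub_self, abs_zero]; exact hη.le)
  have e2 : ∫ x, u k x * d₀ x / ‖gradient Δ x‖ ∂(levelMeasure Δ δ) =
      ∑ j, ∫ x, uj j k x * d₀ x / ‖gradient Δ x‖ ∂(levelMeasure Δ δ) := by
    rw [← integral_finsetSum _ fun j _ => hsurf j]
    refine integral_congr_ae (hsum_ae.mono fun x hx => ?_)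
    simp only [uj]
    rw [← Finset.sum_div, ← Finset.sum_mul, ← Finset.sum_mul]
    by_cases hxK : x ∈ K
    · rw [hx hxK, one_mul]
    · simp [hu0 k x hxK]
  have hint : ∀ j, Integrable (fun x => |uj j k x|) (levelMeasure Δ δ) := fun j =>
    (integrable_levelMeasure hΔ hK hcont hreg (hujm j k) (hujC j k) (huj0 j k)).abs
  -- The weights sum to one on the level set, so this bound does not involve the number of charts,
  -- which itself depends on `ε`.
  have e3 : ∑ j, ∫ x, |uj j k x| ∂(levelMeasure Δ δ) ≤ C * T := by
    rw [← integral_finsetSum _ fun j _ => hint j]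
    have : ∫ x, K.indicator (fun _ => C) x ∂(levelMeasure Δ δ) = C * T := by
      rw [integral_indicator_const _ hK.measurableSet, smul_eq_mul, mul_comm]
    rw [← this]
    refine integral_mono_ae (integrable_finsetSum _ fun j _ => hint j)
      ((integrable_indicator_iff hK.measurableSet).2 (integrableOn_const hfin.ne)) ?_
    filter_upwards [hsum_ae] with x hx
    by_cases hxK : x ∈ K
    · rw [Set.indicator_of_mem hxK]
      calc ∑ j, |uj j k x| ≤ ∑ j, χ j x * |u k x| := Finset.sum_le_sum fun j _ => hujle j k x
        _ = |u k x| := by rw [← Finset.sum_mul, hx hxK, one_mul]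
        _ ≤ C := huC k x
    · rw [Set.indicator_of_notMem hxK]
      simp [huj0 _ k x hxK]
  rw [Real.dist_eq, sub_zero, e1, e2, Finset.mul_sum, ← Finset.sum_sub_distrib]
  calc _ ≤ ∑ j, |(t k)⁻¹ * (∫ x, uj j k x * stepDiff δ (δ + t k * d k x) (Δ x)) -
        ∫ x, uj j k x * d₀ x / ‖gradient Δ x‖ ∂(levelMeasure Δ δ)| := Finset.abs_sum_le_sum_abs _ _
    _ ≤ ∑ j : Fin I.card, (ε₀ / (2 * (I.card + 1)) + ε * (C * ∫ x, |uj j k x| ∂(levelMeasure Δ δ))) :=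
        Finset.sum_le_sum fun j _ => hk j
    _ = I.card * (ε₀ / (2 * (I.card + 1))) + ε * (C * ∑ j, ∫ x, |uj j k x| ∂(levelMeasure Δ δ)) := by
        rw [Finset.sum_add_distrib, ← Finset.mul_sum, ← Finset.mul_sum]
        simp
    _ ≤ I.card * (ε₀ / (2 * (I.card + 1))) + ε * (C * (C * T)) := by gcongr
    _ < (I.card + 1) * (ε₀ / (2 * (I.card + 1))) + ε * (C * (C * T) + 1) := by nlinarith
    _ = ε₀ := by
        rw [hε]
        have : (C * (C * T) + 1) ≠ 0 := by positivity
        field_simp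
        ring

end

/-! ## Transfer to the open set `B` -/

section extension
variable {n : ℕ} {B : Set (Cov n)}

/-- Extension by zero of a function on `B`. -/
def zeroExt (g : B → ℝ) : Cov n → ℝ := Function.extend Subtype.val g 0

lemma zeroExt_coe (g : B → ℝ) (x : B) : zeroExt g x = g x :=
  Subtype.val_injective.extend_apply g 0 x

lemma zeroExt_of_notMem (g : B → ℝ) {x : Cov n} (hx : x ∉ B) : zeroExt g x = 0 :=
  Function.extend_apply' g (0 : Cov n → ℝ) x (by rintro ⟨y, rfl⟩; exact hx y.2)

lemma measurable_zeroExt (hB : IsOpen B) {g : B → ℝ} (hg : Measurable g) : Measurable (zeroExt g) :=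
  (MeasurableEmbedding.subtype_coe hB.measurableSet).measurable_extend hg measurable_const

lemma abs_zeroExt_le {g : B → ℝ} {C : ℝ} (hC : 0 ≤ C) (hg : ∀ x, |g x| ≤ C) (x : Cov n) :
    |zeroExt g x| ≤ C := by
  by_cases hx : x ∈ B
  · exact (zeroExt_coe g ⟨x, hx⟩).symm ▸ hg ⟨x, hx⟩
  · simpa [zeroExt_of_notMem g hx] using hC

lemma integral_comap_val (hB : IsOpen B) (g : B → ℝ) :
    ∫ x, g x ∂((volume : Measure (Cov n)).comap (Subtype.val : B → Cov n)) = ∫ x, zeroExt g x := by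
  have hm := MeasurableEmbedding.subtype_coe hB.measurableSet
  have h1 : ∫ x in B, zeroExt g x = ∫ x, zeroExt g x :=
    setIntegral_eq_integral_of_forall_compl_eq_zero fun x hx => zeroExt_of_notMem g hx
  rw [← h1, ← map_comap_subtype_coe hB.measurableSet, hm.integral_map]
  simp only [zeroExt_coe]

lemma tendsto_zeroExt {l : Filter ℝ} (hB : IsOpen B) {g : ℕ → B → ℝ} (x : B)
    (h : Tendsto (fun q : ℕ × B => g q.1 q.2) (atTop ×ˢ 𝓝 x) l) :
    Tendsto (fun q : ℕ × Cov n => zeroExt (g q.1) q.2) (atTop ×ˢ 𝓝 (x : Cov n)) l := by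
  rw [← hB.isOpenEmbedding_subtypeVal.map_nhds_eq x, prod_map_right, tendsto_map'_iff]
  refine h.congr fun q => ?_
  simp [zeroExt_coe]

end extension

/-- Truncation of a real number to `[-C, C]`. -/
def clip (C y : ℝ) : ℝ := max (-C) (min C y)

lemma continuous_clip (C : ℝ) : Continuous (clip C) := by
  unfold clip
  fun_prop

lemma abs_clip_le {C : ℝ} (hC : 0 ≤ C) (y : ℝ) : |clip C y| ≤ C := by
  unfold clip
  rw [abs_le]
  exact ⟨le_max_left _ _, max_le (by linarith) (min_le_left _ _)⟩

lemma clip_of_abs_le {C y : ℝ} (h : |y| ≤ C) : clip C y = y := by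
  unfold clip
  rw [abs_le] at h
  rw [min_eq_right h.2, max_eq_right h.1]

namespace CondS1

variable {n : ℕ} {X B : Set (Cov n)} {Δ : Cov n → ℝ} {dens : B → ℝ} {μ : Measure B} {δ : ℝ}
  (hS1 : CondS1 X B Δ dens μ)
include hS1

lemma subset_B : X ⊆ B := subset_closure.trans hS1.closure_subset

lemma contDiffAt {x : Cov n} (hx : x ∈ B) : ContDiffAt ℝ 1 Δ x :=
  hS1.contDiffOn.contDiffAt (hS1.isOpen_B.mem_nhds hx)

lemma continuous_restrict : Continuous fun x : B => Δ x :=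
  hS1.contDiffOn.continuousOn.domRestrict

lemma zeroExt_eventuallyEq {x : Cov n} (hx : x ∈ B) :
    zeroExt (fun x : B => Δ x) =ᶠ[𝓝 x] Δ := by
  filter_upwards [hS1.isOpen_B.mem_nhds hx] with y hy
  exact zeroExt_coe (fun x : B => Δ x) ⟨y, hy⟩

lemma gradient_zeroExt {x : Cov n} (hx : x ∈ B) :
    gradient (zeroExt (fun x : B => Δ x)) x = gradient Δ x := by
  unfold gradient
  rw [(hS1.zeroExt_eventuallyEq hx).fderiv_eq]

lemma measurable_zeroExt_self : Measurable (zeroExt fun x : B => Δ x) :=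
  measurable_zeroExt hS1.isOpen_B hS1.continuous_restrict.measurable

lemma continuousOn_zeroExt : ContinuousOn (zeroExt fun x : B => Δ x) (closure X) := fun _ hx =>
  ((hS1.contDiffAt (hS1.closure_subset hx)).continuousAt.congr
    (hS1.zeroExt_eventuallyEq (hS1.closure_subset hx)).symm).continuousWithinAt

lemma regular_zeroExt (hδ : IsRegularValue Δ (closure X) δ) :
    ∀ x ∈ closure X, zeroExt (fun x : B => Δ x) x = δ →
      ContDiffAt ℝ 1 (zeroExt fun x : B => Δ x) x ∧ gradient (zeroExt fun x : B => Δ x) x ≠ 0 := by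
  intro x hx hxδ
  have hxB := hS1.closure_subset hx
  have e := hS1.zeroExt_eventuallyEq hxB
  refine ⟨(hS1.contDiffAt hxB).congr_of_eventuallyEq e, ?_⟩
  rw [hS1.gradient_zeroExt hxB]
  exact hδ x hx (by rw [← e.eq_of_nhds]; exact hxδ)

/-- The inclusion of `B` is an isometry, so it carries Hausdorff measure to Hausdorff measure.
Restricting to `X` removes any points off `B` where the extension by zero happens to equal `δ`. -/
lemma map_levelSetIn : ((μHE[n] : Measure B).restrict (levelSetIn B X Δ δ)).map Subtype.val =
    (levelMeasure (zeroExt fun x : B => Δ x) δ).restrict X := by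
  have hm := MeasurableEmbedding.subtype_coe hS1.isOpen_B.measurableSet
  rw [levelSetIn, ← hm.restrict_map, isometry_subtype_coe.map_euclideanHausdorffMeasure,
    Subtype.range_coe, levelMeasure, Measure.restrict_restrict hS1.isOpen_X.measurableSet,
    Measure.restrict_restrict' hS1.isOpen_B.measurableSet]
  congr 1
  ext x
  constructor
  · rintro ⟨⟨h1, h2⟩, h3⟩
    exact ⟨h1, (zeroExt_coe (fun x : B => Δ x) ⟨x, h3⟩).trans h2⟩
  · rintro ⟨h1, h2⟩
    have h3 := hS1.subset_B h1
    exact ⟨⟨h1, (zeroExt_coe (fun x : B => Δ x) ⟨x, h3⟩).symm.trans h2⟩, h3⟩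

lemma isFiniteMeasure_levelSetIn (hδ : IsRegularValue Δ (closure X) δ) :
    IsFiniteMeasure ((μHE[n] : Measure B).restrict (levelSetIn B X Δ δ)) := by
  have h := levelMeasure_lt_top hS1.measurable_zeroExt_self hS1.isCompact_closure
    hS1.continuousOn_zeroExt (hS1.regular_zeroExt hδ)
  refine ⟨?_⟩
  have e := congrArg (fun m => m Set.univ) (hS1.map_levelSetIn (δ := δ))
  simp only [Measure.map_apply measurable_subtype_coe MeasurableSet.univ, Set.preimage_univ,
    Measure.restrict_apply MeasurableSet.univ (μ := levelMeasure _ _), Set.univ_inter] at e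
  rw [e]
  exact (measure_mono subset_closure).trans_lt h

lemma integral_levelSetIn {g : B → ℝ} (hg : ∀ x : B, (x : Cov n) ∉ X → g x = 0) :
    ∫ x in levelSetIn B X Δ δ, g x ∂μHE[n] =
      ∫ x, zeroExt g x ∂(levelMeasure (zeroExt fun x : B => Δ x) δ) := by
  have hm := MeasurableEmbedding.subtype_coe hS1.isOpen_B.measurableSet
  have h1 : ∫ x in X, zeroExt g x ∂(levelMeasure (zeroExt fun x : B => Δ x) δ) =
      ∫ x, zeroExt g x ∂(levelMeasure (zeroExt fun x : B => Δ x) δ) :=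
    setIntegral_eq_integral_of_forall_compl_eq_zero fun x hx => by
      by_cases hxB : x ∈ B
      · exact (zeroExt_coe g ⟨x, hxB⟩).trans (hg _ hx)
      · exact zeroExt_of_notMem g hxB
  rw [← h1, ← hS1.map_levelSetIn, hm.integral_map]
  simp only [zeroExt_coe]

lemma integral_eq_zeroExt (f : B → ℝ) : ∫ x, f x ∂μ = ∫ x, zeroExt (fun x => dens x * f x) x := by
  rw [← integral_comap_val hS1.isOpen_B, hS1.eq_withDensity]
  have hm : Measurable fun x => Real.toNNReal (dens x) :=
    hS1.dens_continuous.measurable.real_toNNReal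
  have := integral_withDensity_eq_integral_smul
    (μ := (volume : Measure (Cov n)).comap (Subtype.val : B → Cov n)) hm f
  refine Eq.trans this ?_
  congr 1
  funext x
  rw [NNReal.smul_def, Real.coe_toNNReal _ (hS1.dens_nonneg x), smul_eq_mul]

lemma isCompact_preimage_closure : IsCompact ((Subtype.val : B → Cov n) ⁻¹' closure X) :=
  Topology.IsInducing.subtypeVal.isCompact_preimage' hS1.isCompact_closure
    (by rw [Subtype.range_coe]; exact hS1.closure_subset)

lemma exists_dens_le : ∃ C : ℝ, 0 ≤ C ∧ ∀ x, dens x ≤ C := by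
  have hc := hS1.isCompact_preimage_closure
  obtain ⟨C, hC⟩ := hc.bddAbove_image hS1.dens_continuous.continuousOn
  refine ⟨max C 0, le_max_right _ _, fun x => ?_⟩
  by_cases hx : (x : Cov n) ∈ X
  · exact (hC ⟨x, subset_closure hx, rfl⟩).trans (le_max_left _ _)
  · rw [hS1.dens_eq_zero x hx]; exact le_max_right _ _

lemma ae_mem : ∀ᵐ x : B ∂μ, dens x ≠ 0 := by
  rw [hS1.eq_withDensity, ae_withDensity_iff hS1.dens_continuous.measurable.ennreal_ofReal]
  exact Eventually.of_forall fun x hx h => hx (by rw [h, ENNReal.ofReal_zero])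

lemma mem_of_dens_ne {x : B} (hx : dens x ≠ 0) : (x : Cov n) ∈ X := by
  by_contra h
  exact hx (hS1.dens_eq_zero x h)

/-- Difference quotients of truncated integrals are asymptotic to surface integrals. -/
theorem tendsto_integral_trunc_sub (hδ : IsRegularValue Δ (closure X) δ) {C : ℝ} {t : ℕ → ℝ}
    {φ : ℕ → B → ℝ} {G : ℕ → C(B, ℝ)} {G₀ : C(B, ℝ)} {K : ℕ → ℝ} {K₀ : ℝ}
    (ht : Tendsto t atTop (𝓝 0)) (ht0 : ∀ k, t k ≠ 0)
    (hφm : ∀ k, Measurable (φ k)) (hφi : ∀ k, Integrable (φ k) μ)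
    (hφC : ∀ k (x : B), (x : Cov n) ∈ closure X → |φ k x| ≤ C)
    (hG : TendstoUniformly (fun k => ⇑(G k)) G₀ atTop) (hK : Tendsto K atTop (𝓝 K₀))
    (hosc : ∀ᵐ x ∂(μHE[n] : Measure B).restrict (levelSetIn B X Δ δ),
      dens x ≠ 0 → OscillationVanishesAt φ x) :
    Tendsto (fun k => (t k)⁻¹ * (∫ x, trunc (φ k) (hS1.toC + t k • G k : C(B, ℝ)) (δ + t k * K k) x ∂μ -
        ∫ x, trunc (φ k) hS1.toC δ x ∂μ) -
      ∫ x in levelSetIn B X Δ δ, φ k x * ((K₀ - G₀ x) / ‖gradient Δ (x : Cov n)‖) * dens x ∂μHE[n])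
      atTop (𝓝 0) := by
  obtain ⟨Cd, hCd0, hCd⟩ := hS1.exists_dens_le
  have hcpt := hS1.isCompact_preimage_closure
  obtain ⟨C₁, hC₁⟩ := hcpt.exists_bound_of_continuousOn (f := fun x => K₀ - G₀ x)
    (by fun_prop)
  -- `G k` is controlled only on the compact closure of `X`, where for large `k` both `K k` and `G
  -- k` are within one of their limits. Clipping at `C'` gives global bounds and changes nothing
  -- there.
  set C' := |C₁| + 2 with hC'
  have hC'0 : 0 ≤ C' := by positivity
  have hlimK : ∀ x : B, (x : Cov n) ∈ closure X → |K₀ - G₀ x| ≤ C' := fun x hx =>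
    (hC₁ x hx).trans (by rw [hC']; linarith [le_abs_self C₁])
  have hevK : ∀ᶠ k in atTop, ∀ x : B, (x : Cov n) ∈ closure X → |K k - G k x| ≤ C' := by
    filter_upwards [Metric.tendstoUniformly_iff.1 hG 1 one_pos, Metric.tendsto_nhds.1 hK 1 one_pos]
      with k h1 h2 x hx
    have h1' := abs_lt.1 (by simpa [Real.dist_eq] using h1 x)
    have h2' := abs_lt.1 (by simpa [Real.dist_eq] using h2)
    have h3 := abs_le.1 (hC₁ x hx)
    have h4 := le_abs_self C₁
    rw [abs_le]
    constructor <;> linarith [h1'.1, h1'.2, h2'.1, h2'.2, h3.1, h3.2]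
  let ψ : ℕ → B → ℝ := fun k => ((Subtype.val : B → Cov n) ⁻¹' X).indicator (φ k)
  have hXm : MeasurableSet ((Subtype.val : B → Cov n) ⁻¹' X) :=
    measurable_subtype_coe hS1.isOpen_X.measurableSet
  have hψm : ∀ k, Measurable (ψ k) := fun k => (hφm k).indicator hXm
  have hψC : ∀ k x, |ψ k x| ≤ |C| := fun k x => by
    by_cases hx : (x : Cov n) ∈ X
    · rw [show ψ k x = φ k x from Set.indicator_of_mem (by exact hx) _]
      exact (hφC k x (subset_closure hx)).trans (le_abs_self C)
    · rw [show ψ k x = 0 from Set.indicator_of_notMem (by exact hx) _]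
      simp
  have hψφ : ∀ k x, dens x * ψ k x = dens x * φ k x := fun k x => by
    by_cases hx : (x : Cov n) ∈ X
    · rw [show ψ k x = φ k x from Set.indicator_of_mem (by exact hx) _]
    · rw [hS1.dens_eq_zero x hx, zero_mul, zero_mul]
  let u : ℕ → Cov n → ℝ := fun k => zeroExt fun x => dens x * ψ k x
  let d : ℕ → Cov n → ℝ := fun k => zeroExt fun x => clip C' (K k - G k x)
  let d₀ : Cov n → ℝ := zeroExt fun x => clip C' (K₀ - G₀ x)
  have huC : ∀ k x, |u k x| ≤ max (Cd * |C|) C' := fun k x => by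
    refine (abs_zeroExt_le (C := Cd * |C|) (by positivity) (fun y => ?_) x).trans (le_max_left _ _)
    rw [abs_mul, abs_of_nonneg (hS1.dens_nonneg y)]
    exact mul_le_mul (hCd y) (hψC k y) (abs_nonneg _) hCd0
  have hdC : ∀ k x, |d k x| ≤ max (Cd * |C|) C' := fun k x =>
    (abs_zeroExt_le hC'0 (fun y => abs_clip_le hC'0 _) x).trans (le_max_right _ _)
  have hd₀C : ∀ x, |d₀ x| ≤ max (Cd * |C|) C' := fun x =>
    (abs_zeroExt_le hC'0 (fun y => abs_clip_le hC'0 _) x).trans (le_max_right _ _)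
  have hu0 : ∀ k, ∀ x ∉ closure X, u k x = 0 := fun k x hx => by
    by_cases hxB : x ∈ B
    · refine (zeroExt_coe _ ⟨x, hxB⟩).trans ?_
      rw [hS1.dens_eq_zero ⟨x, hxB⟩ (fun h => hx (subset_closure h)), zero_mul]
    · exact zeroExt_of_notMem _ hxB
  have hoscB : ∀ x : B, (dens x ≠ 0 → OscillationVanishesAt φ x) →
      OscillationVanishesAt (fun k y => dens y * ψ k y) x := by
    intro x hx
    -- Where the continuous density vanishes it suppresses the oscillation of the bounded functions
    -- `ψ k` by itself; so `φ` has to be controlled only where the density is positive.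
    by_cases hdx : dens x = 0
    · have h1 : Tendsto (fun q : ℕ × B => dens q.2 * |C|) (atTop ×ˢ 𝓝 x) (𝓝 0) := by
        have := (hS1.dens_continuous.continuousAt (x := x)).tendsto.comp
          (tendsto_snd (f := (atTop : Filter ℕ)))
        rw [hdx] at this
        simpa using this.mul_const |C|
      refine squeeze_zero_norm (fun q => ?_) h1
      simp only
      rw [hdx, zero_mul, sub_zero, norm_mul, Real.norm_of_nonneg (hS1.dens_nonneg _)]
      exact mul_le_mul_of_nonneg_left (hψC _ _) (hS1.dens_nonneg _)
    · refine OscillationVanishesAt.mul_left ?_ hψC hS1.dens_continuous.continuousAt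
      have hxX := hS1.mem_of_dens_ne hdx
      have hnear : ∀ᶠ y : B in 𝓝 x, (y : Cov n) ∈ X :=
        (hS1.isOpen_X.preimage continuous_subtype_val).mem_nhds hxX
      refine (hx hdx).congr' ?_
      filter_upwards [tendsto_snd.eventually hnear] with q hq
      simp only [ψ]
      rw [Set.indicator_of_mem (by exact hq), Set.indicator_of_mem (by exact hxX)]
  have hoscE : ∀ᵐ x ∂(levelMeasure (zeroExt fun x : B => Δ x) δ), x ∈ closure X →
      OscillationVanishesAt u x := by
    have h1 : ∀ᵐ x ∂(levelMeasure (zeroExt fun x : B => Δ x) δ), x ∈ X →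
        ∀ h : x ∈ B, dens ⟨x, h⟩ ≠ 0 → OscillationVanishesAt φ ⟨x, h⟩ := by
      rw [← ae_restrict_iff' hS1.isOpen_X.measurableSet, ← hS1.map_levelSetIn,
        (MeasurableEmbedding.subtype_coe hS1.isOpen_B.measurableSet).ae_map_iff]
      exact hosc.mono fun x hx h => hx
    filter_upwards [h1] with x hx hxc
    have hxB := hS1.closure_subset hxc
    have h2 := hoscB ⟨x, hxB⟩ fun hd => hx (hS1.mem_of_dens_ne hd) hxB hd
    have h3 : ∀ k, u k x = dens ⟨x, hxB⟩ * ψ k ⟨x, hxB⟩ := fun k => zeroExt_coe _ ⟨x, hxB⟩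
    unfold OscillationVanishesAt at h2 ⊢
    have h4 := hS1.isOpen_B.isOpenEmbedding_subtypeVal.map_nhds_eq ⟨x, hxB⟩
    simp only at h4
    rw [← h4, prod_map_right, tendsto_map'_iff]
    refine h2.congr fun q => ?_
    simp only [Function.comp_apply, Prod.map_fst, Prod.map_snd, id_eq, h3]
    rw [show u q.1 (q.2 : Cov n) = dens q.2 * ψ q.1 q.2 from zeroExt_coe _ q.2]
  have hlim : ∀ x ∈ B, Tendsto (fun q : ℕ × Cov n => d q.1 q.2) (atTop ×ˢ 𝓝 x) (𝓝 (d₀ x)) := by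
    intro x hx
    rw [show d₀ x = clip C' (K₀ - G₀ ⟨x, hx⟩) from zeroExt_coe _ ⟨x, hx⟩]
    refine tendsto_zeroExt (g := fun k y => clip C' (K k - G k y)) hS1.isOpen_B ⟨x, hx⟩ ?_
    refine ((continuous_clip C').tendsto _).comp ((hK.comp tendsto_fst).sub ?_)
    have h1 : Tendsto (fun q : ℕ × B => G₀ q.2) (atTop ×ˢ 𝓝 ⟨x, hx⟩) (𝓝 (G₀ ⟨x, hx⟩)) :=
      (G₀.continuous.tendsto _).comp tendsto_snd
    have h2 : Tendsto (fun q : ℕ × B => G q.1 q.2 - G₀ q.2) (atTop ×ˢ 𝓝 ⟨x, hx⟩) (𝓝 0) := by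
      rw [Metric.tendsto_nhds]
      intro ε hε
      filter_upwards [tendsto_fst.eventually (Metric.tendstoUniformly_iff.1 hG ε hε)] with q hq
      simpa [Real.dist_eq, abs_sub_comm] using hq q.2
    simpa using h1.add h2
  have hum : ∀ k, Measurable (u k) := fun k =>
    measurable_zeroExt hS1.isOpen_B (hS1.dens_continuous.measurable.mul (hψm k))
  have hdm : ∀ k, Measurable (d k) := fun k => measurable_zeroExt hS1.isOpen_B
    ((continuous_clip C').comp (by fun_prop)).measurable
  have hd₀m : Measurable d₀ := measurable_zeroExt hS1.isOpen_B
    ((continuous_clip C').comp (by fun_prop)).measurable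
  have main := tendsto_tube_sub_surface hS1.measurable_zeroExt_self hS1.isCompact_closure
    hS1.continuousOn_zeroExt (hS1.regular_zeroExt hδ) hS1.isOpen_B hS1.closure_subset ht ht0
    hum hdm hd₀m huC hdC hd₀C hu0 hoscE hlim
  refine main.congr' ?_
  filter_upwards [hevK] with k hk
  congr 1
  · congr 1
    have hi1 : Integrable (trunc (φ k) (hS1.toC + t k • G k : C(B, ℝ)) (δ + t k * K k)) μ :=
      (hφi k).indicator (measurableSet_sublevel _ _)
    have hi2 : Integrable (trunc (φ k) hS1.toC δ) μ :=
      (hφi k).indicator (measurableSet_sublevel _ _)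
    rw [← integral_sub hi1 hi2, hS1.integral_eq_zeroExt]
    congr 1
    funext x
    by_cases hxB : x ∈ B
    swap
    · rw [show u k x = 0 from zeroExt_of_notMem _ hxB, zero_mul]
      exact (zeroExt_of_notMem _ hxB).symm
    lift x to B using hxB
    rw [zeroExt_coe, zeroExt_coe, show u k x = dens x * ψ k x from zeroExt_coe _ x, hψφ,
      show d k x = clip C' (K k - G k x) from zeroExt_coe _ x]
    by_cases hxX : (x : Cov n) ∈ X
    swap
    · simp [hS1.dens_eq_zero x hxX]
    rw [clip_of_abs_le (hk x (subset_closure hxX)), mul_assoc]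
    congr 1
    have e1 : hS1.toC x = Δ x := rfl
    -- Moving the perturbation of `Δ` to the other side turns it into a variable level.
    have e2 : (Δ x + t k * G k x ≤ δ + t k * K k) ↔ Δ x ≤ δ + t k * (K k - G k x) := by
      constructor <;> intro h <;> linarith
    simp only [trunc, Set.indicator_apply, Set.mem_ofPred_eq, ContinuousMap.add_apply,
      ContinuousMap.smul_apply, smul_eq_mul, e1, e2, stepDiff]
    split_ifs <;> simp
  · rw [hS1.integral_levelSetIn fun x hx => by rw [hS1.dens_eq_zero x hx, mul_zero]]
    congr 1
    funext x
    by_cases hxB : x ∈ B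
    swap
    · rw [show u k x = 0 from zeroExt_of_notMem _ hxB, zeroExt_of_notMem _ hxB]
      simp
    lift x to B using hxB
    rw [zeroExt_coe, hS1.gradient_zeroExt x.2, show u k x = dens x * ψ k x from zeroExt_coe _ x, hψφ,
      show d₀ x = clip C' (K₀ - G₀ x) from zeroExt_coe _ x]
    by_cases hxX : (x : Cov n) ∈ X
    swap
    · simp [hS1.dens_eq_zero x hxX]
    rw [clip_of_abs_le (hlimK x (subset_closure hxX))]
    ring

end CondS1

/-! ## Operators on the test class -/

section operators
variable {n p : ℕ} {B : Set (Cov n)}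

lemma opEval_eq_onClass {𝒢 : Set (B → ℝ)} (H : Submodule.span ℝ 𝒢 →ₗ[ℝ] ℝ) {g : B → ℝ}
    (hg : g ∈ 𝒢) : opEval H g = onClass H ⟨g, hg⟩ :=
  dif_pos (Submodule.subset_span hg)

lemma opEval_add_smul {𝒢 : Set (B → ℝ)} (H H' : Submodule.span ℝ 𝒢 →ₗ[ℝ] ℝ) (c : ℝ) (g : B → ℝ) :
    opEval (H + c • H') g = opEval H g + c * opEval H' g := by
  unfold opEval
  split_ifs <;> simp

lemma opEval_combination {𝒢 : Set (B → ℝ)} (H : Submodule.span ℝ 𝒢 →ₗ[ℝ] ℝ) {g g' : B → ℝ}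
    (hg : g ∈ 𝒢) (hg' : g' ∈ 𝒢) (a b : ℝ) :
    opEval H (a • g + b • g') = a * opEval H g + b * opEval H g' := by
  have h1 : g ∈ Submodule.span ℝ 𝒢 := Submodule.subset_span hg
  have h2 : g' ∈ Submodule.span ℝ 𝒢 := Submodule.subset_span hg'
  have h3 := Submodule.add_mem _ (Submodule.smul_mem _ a h1) (Submodule.smul_mem _ b h2)
  rw [opEval, opEval, opEval, dif_pos h1, dif_pos h2, dif_pos h3, ← smul_eq_mul, ← smul_eq_mul,
    ← map_smul, ← map_smul, ← map_add]
  rfl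

lemma enorm_onClass_le_opNorm {𝒢 : Set (B → ℝ)} (H : Submodule.span ℝ 𝒢 →ₗ[ℝ] ℝ) (g : 𝒢) :
    ‖onClass H g‖ₑ ≤ opNorm H :=
  le_iSup (fun g : 𝒢 => ‖onClass H g‖ₑ) g

/-- Joint continuity of the evaluation of operators at members of the class. -/
lemma tendsto_opEval_sub {μ : Measure B} {𝒢 : Set (B → ℝ)}
    {H : ℕ → Submodule.span ℝ 𝒢 →ₗ[ℝ] ℝ} {H₀ : Submodule.span ℝ 𝒢 →ₗ[ℝ] ℝ}
    (hH₀ : H₀ ∈ opSpace μ 𝒢) (hH : Tendsto (fun k => opNorm (H k - H₀)) atTop (𝓝 0))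
    {g g' : ℕ → B → ℝ} (hg : ∀ k, g k ∈ 𝒢) (hg' : ∀ k, g' k ∈ 𝒢)
    (hgg : Tendsto (fun k => eLpNorm (g k - g' k) 2 μ) atTop (𝓝 0)) :
    Tendsto (fun k => opEval (H k) (g k) - opEval H₀ (g' k)) atTop (𝓝 0) := by
  have h1 : Tendsto (fun k => onClass (H k - H₀) ⟨g k, hg k⟩) atTop (𝓝 0) := by
    rw [tendsto_zero_iff_enorm_tendsto_zero]
    exact tendsto_of_tendsto_of_tendsto_of_le_of_le tendsto_const_nhds hH (fun _ => zero_le)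
      fun k => enorm_onClass_le_opNorm _ _
  have h2 : Tendsto (fun k => onClass H₀ ⟨g k, hg k⟩ - onClass H₀ ⟨g' k, hg' k⟩) atTop (𝓝 0) := by
    rw [Metric.tendsto_nhds]
    intro ε hε
    obtain ⟨η, hη, hηH⟩ := hH₀.2 ε hε
    filter_upwards [hgg.eventually_lt_const (ENNReal.ofReal_pos.2 hη)] with k hk
    simpa [Real.dist_eq] using hηH ⟨g k, hg k⟩ ⟨g' k, hg' k⟩ hk
  have h3 := h1.add h2
  rw [add_zero] at h3
  refine h3.congr fun k => ?_
  rw [opEval_eq_onClass _ (hg k), opEval_eq_onClass _ (hg' k)]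
  simp only [onClass, LinearMap.sub_apply]
  ring

lemma opEval_integralOp (μ : Measure B) [IsProbabilityMeasure μ] (κ : Kernel B (Fin p → ℝ))
    [IsMarkovKernel κ] (M : ℕ) (F : Set C(B, ℝ)) (V : Set ℝ) {g : B → ℝ}
    (hg : g ∈ testClass μ κ M F V) : opEval (integralOp μ κ M F V) g = ∫ x, g x ∂μ :=
  dif_pos (Submodule.subset_span hg)

/-- The monomial of degree zero; thus the denominator is covered by the results on the numerator. -/
lemma one_mem_momentClass (μ : Measure B) [IsProbabilityMeasure μ] (κ : Kernel B (Fin p → ℝ))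
    [IsMarkovKernel κ] (M : ℕ) : (1 : B → ℝ) ∈ momentClass μ κ M := by
  have h : (zMonomial 0 0 : B × (Fin p → ℝ) → ℝ) = fun _ => 1 := by
    funext z
    simp [zMonomial]
  refine ⟨0, 0, by simp, ?_, ?_⟩
  · rw [h]
    exact integrable_const 1
  · funext x
    rw [h]
    simp [condMean]

/-- Pointwise `|f|² ≤ C |f|`. It links the `L¹` distance on test functions with the `L²` continuity
of operators. -/
lemma eLpNorm_two_le_of_bound {α : Type*} [MeasurableSpace α] {μ : Measure α} {f : α → ℝ} {C : ℝ}
    (hf : ∀ᵐ x ∂μ, |f x| ≤ C) :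
    eLpNorm f 2 μ ≤ (ENNReal.ofReal C * eLpNorm f 1 μ) ^ (1 / 2 : ℝ) := by
  rw [eLpNorm_eq_lintegral_rpow_enorm_toReal (by norm_num) (by norm_num),
    eLpNorm_one_eq_lintegral_enorm]
  simp only [ENNReal.toReal_ofNat]
  refine ENNReal.rpow_le_rpow ?_ (by norm_num)
  rw [← lintegral_const_mul' _ _ ENNReal.ofReal_ne_top]
  refine lintegral_mono_ae (hf.mono fun x hx => ?_)
  rw [ENNReal.rpow_two, sq]
  gcongr
  rw [Real.enorm_eq_ofReal_abs]
  exact ENNReal.ofReal_le_ofReal hx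

lemma tendsto_eLpNorm_two_of_one {α : Type*} [MeasurableSpace α] {μ : Measure α} {f : ℕ → α → ℝ}
    {C : ℝ} (hf : ∀ k, ∀ᵐ x ∂μ, |f k x| ≤ C)
    (h1 : Tendsto (fun k => eLpNorm (f k) 1 μ) atTop (𝓝 0)) :
    Tendsto (fun k => eLpNorm (f k) 2 μ) atTop (𝓝 0) := by
  have h2 : Tendsto (fun k => (ENNReal.ofReal C * eLpNorm (f k) 1 μ) ^ (1 / 2 : ℝ)) atTop (𝓝 0) := by
    have h3 := ENNReal.Tendsto.const_mul (a := ENNReal.ofReal C) h1 (Or.inr ENNReal.ofReal_ne_top)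
    have h4 := (ENNReal.continuous_rpow_const (y := (1 / 2 : ℝ))).tendsto (ENNReal.ofReal C * 0) |>.comp h3
    simpa [Function.comp_def] using h4
  exact tendsto_of_tendsto_of_tendsto_of_le_of_le tendsto_const_nhds h2 (fun _ => zero_le)
    fun k => eLpNorm_two_le_of_bound (hf k)

lemma tendsto_eLpNorm_one_of_ae {α : Type*} [MeasurableSpace α] {μ : Measure α}
    [IsFiniteMeasure μ] {f : ℕ → α → ℝ} {C : ℝ} (hm : ∀ k, AEStronglyMeasurable (f k) μ)
    (hf : ∀ k, ∀ᵐ x ∂μ, |f k x| ≤ C)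
    (h1 : ∀ᵐ x ∂μ, Tendsto (fun k => f k x) atTop (𝓝 0)) :
    Tendsto (fun k => eLpNorm (f k) 1 μ) atTop (𝓝 0) := by
  simp only [eLpNorm_one_eq_lintegral_enorm]
  have := tendsto_lintegral_of_dominated_convergence' (μ := μ) (F := fun k x => ‖f k x‖ₑ)
    (f := fun _ => 0) (fun _ => ENNReal.ofReal C) (fun k => (hm k).enorm)
    (fun k => (hf k).mono fun x hx => by
      simpa only [Real.enorm_eq_ofReal_abs] using ENNReal.ofReal_le_ofReal hx)
    (by simpa using ENNReal.mul_ne_top ENNReal.ofReal_ne_top (measure_ne_top μ _))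
    (h1.mono fun x hx => tendsto_zero_iff_enorm_tendsto_zero.1 hx)
  simpa using this

/-- If uniformity fails, choosing at each `k` a violating index, whenever there is one, gives a
sequence contradicting the hypothesis. -/
lemma tendstoUniformlyOn_of_forall_seq {Θ : Type*} {f : ℕ → Θ → ℝ} {g : Θ → ℝ} {S : Set Θ}
    (h : ∀ θ : ℕ → Θ, (∀ k, θ k ∈ S) → Tendsto (fun k => f k (θ k) - g (θ k)) atTop (𝓝 0)) :
    TendstoUniformlyOn f g atTop S := by
  rcases S.eq_empty_or_nonempty with rfl | ⟨θ₀, hθ₀⟩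
  · exact tendstoUniformlyOn_empty
  rw [Metric.tendstoUniformlyOn_iff]
  intro ε hε
  classical
  have hc : ∀ k, ∃ θ ∈ S, (∃ θ' ∈ S, ε ≤ |f k θ' - g θ'|) → ε ≤ |f k θ - g θ| := by
    intro k
    by_cases hk : ∃ θ' ∈ S, ε ≤ |f k θ' - g θ'|
    · obtain ⟨θ, h1, h2⟩ := hk
      exact ⟨θ, h1, fun _ => h2⟩
    · exact ⟨θ₀, hθ₀, fun h => absurd h hk⟩
  choose θ hθ hθ' using hc
  filter_upwards [Metric.tendsto_nhds.1 (h θ hθ) ε hε] with k hk θ' hθ'S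
  rw [Real.dist_eq, sub_zero] at hk
  by_contra hcon
  rw [Real.dist_eq, abs_sub_comm, not_lt] at hcon
  exact absurd (hθ' k ⟨θ', hθ'S, hcon⟩) (not_le.2 hk)

section dNorm
variable {μ : Measure B} {κ : Kernel B (Fin p → ℝ)} {M : ℕ} {F : Set C(B, ℝ)} {V : Set ℝ}

lemma tendsto_components {h : ℕ → DTilde μ κ M F V} {h₀ : DTilde μ κ M F V}
    (hh : Tendsto (fun k => dNorm (h k - h₀)) atTop (𝓝 0)) :
    TendstoUniformly (fun k => ⇑(h k).1) h₀.1 atTop ∧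
    Tendsto (fun k => opNorm ((h k).2.1.1 - h₀.2.1.1)) atTop (𝓝 0) ∧
    Tendsto (fun k => (h k).2.2) atTop (𝓝 h₀.2.2) := by
  refine ⟨?_, ?_, ?_⟩
  · rw [Metric.tendstoUniformly_iff]
    intro ε hε
    filter_upwards [hh.eventually_lt_const (ENNReal.ofReal_pos.2 hε)] with k hk x
    have h1 : ‖(h k - h₀).1 x‖ₑ ≤ dNorm (h k - h₀) :=
      (le_iSup (fun x : B => ‖(h k - h₀).1 x‖ₑ) x).trans (le_add_right (le_add_right le_rfl))
    have h2 := h1.trans_lt hk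
    rw [Real.enorm_eq_ofReal_abs, ENNReal.ofReal_lt_ofReal_iff hε] at h2
    rw [dist_comm, Real.dist_eq]
    exact h2
  · exact tendsto_of_tendsto_of_tendsto_of_le_of_le tendsto_const_nhds hh (fun _ => zero_le)
      fun k => le_add_right (le_add_left le_rfl)
  · rw [← tendsto_sub_nhds_zero_iff, tendsto_zero_iff_enorm_tendsto_zero]
    exact tendsto_of_tendsto_of_tendsto_of_le_of_le tendsto_const_nhds hh (fun _ => zero_le)
      fun k => le_add_left le_rfl

end dNorm
end operators

/-! ### Test subclasses and continuity of the surface integral -/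

section
variable {n p : ℕ} {B : Set (Cov n)}

lemma OscillationVanishesAt.const {α : Type*} [TopologicalSpace α] {u : α → ℝ} {x : α}
    (h : ContinuousAt u x) : OscillationVanishesAt (fun _ : ℕ => u) x := by
  have h1 : Tendsto (fun q : ℕ × α => u q.2) (atTop ×ˢ 𝓝 x) (𝓝 (u x)) := h.tendsto.comp tendsto_snd
  have h2 := h1.sub_const (u x)
  rwa [sub_self] at h2

lemma OscillationVanishesAt.continuousAt {α : Type*} [TopologicalSpace α] {u : α → ℝ} {x : α}
    (h : OscillationVanishesAt (fun _ : ℕ => u) x) : ContinuousAt u x := by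
  have h1 : Tendsto (fun q : ℕ × α => u q.2 - u x) (atTop ×ˢ 𝓝 x) (𝓝 0) := h
  have h2 : Tendsto (fun y => u y - u x) (𝓝 x) (𝓝 0) := by
    rw [← map_snd_prod (atTop : Filter ℕ) (𝓝 x)]
    exact tendsto_map'_iff.2 h1
  exact tendsto_sub_nhds_zero_iff.1 h2

/-- The properties of a class of functions on which uniform Hadamard differentiability rests. -/
structure IsTestSubclass (X : Set (Cov n)) (Δ : Cov n → ℝ) (dens : B → ℝ) (δ : ℝ) (μ : Measure B)
    (κ : Kernel B (Fin p → ℝ)) (M : ℕ) (Θ : Set (B → ℝ)) : Prop where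
  subset : Θ ⊆ momentClass μ κ M ∪ indicatorClass κ
  bounded : ∃ C : ℝ, ∀ φ ∈ Θ, ∀ x : B, (x : Cov n) ∈ closure X → |φ x| ≤ C
  compact : ∀ φ : ℕ → B → ℝ, (∀ k, φ k ∈ Θ) → ∃ s : ℕ → ℕ, Tendsto s atTop atTop ∧
    ∀ᵐ x ∂(μHE[n] : Measure B).restrict (levelSetIn B X Δ δ),
      dens x ≠ 0 → OscillationVanishesAt (fun k => φ (s k)) x

/-- Compactness is applied to the constant sequence. -/
lemma IsTestSubclass.continuousAt {X : Set (Cov n)} {Δ : Cov n → ℝ} {dens : B → ℝ} {δ : ℝ}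
    {μ : Measure B} {κ : Kernel B (Fin p → ℝ)} {M : ℕ} {Θ : Set (B → ℝ)}
    (h : IsTestSubclass X Δ dens δ μ κ M Θ) {φ : B → ℝ} (hφ : φ ∈ Θ) :
    ∀ᵐ x ∂(μHE[n] : Measure B).restrict (levelSetIn B X Δ δ), dens x ≠ 0 → ContinuousAt φ x := by
  obtain ⟨s, -, hs⟩ := h.compact (fun _ => φ) fun _ => hφ
  exact hs.mono fun x hx hd => (hx hd).continuousAt

variable {X : Set (Cov n)} {Δ : Cov n → ℝ} {dens : B → ℝ} {δ : ℝ} {μ : Measure B}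
  [IsProbabilityMeasure μ] {κ : Kernel B (Fin p → ℝ)} [IsMarkovKernel κ] {M : ℕ}
  {F : Set C(B, ℝ)} {V : Set ℝ} {Θ : Set (B → ℝ)}

lemma isTestSubclass_one :
    IsTestSubclass X Δ dens δ μ κ M {(1 : B → ℝ)} where
  subset := by
    rintro _ rfl
    exact Or.inl (one_mem_momentClass μ κ M)
  bounded := ⟨1, by rintro _ rfl x -; simp⟩
  compact := fun φ hφ => ⟨id, tendsto_id, Eventually.of_forall fun x _ => by
    have : φ = fun _ => 1 := funext hφ
    subst this
    exact OscillationVanishesAt.const (u := (1 : B → ℝ)) continuousAt_const⟩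

namespace CondS1
variable (hS1 : CondS1 X B Δ dens μ)
include hS1

lemma continuous_gradient : Continuous fun x : B => gradient Δ (x : Cov n) :=
  continuous_iff_continuousAt.2 fun x =>
    (continuousAt_gradient (hS1.contDiffAt x.2)).comp continuous_subtype_val.continuousAt

lemma exists_weight_bound (hδ : IsRegularValue Δ (closure X) δ) :
    ∃ J : ℝ, 0 ≤ J ∧ ∀ x ∈ levelSetIn B X Δ δ, dens x / ‖gradient Δ (x : Cov n)‖ ≤ J := by
  obtain ⟨Cd, hCd0, hCd⟩ := hS1.exists_dens_le
  obtain ⟨m, hm, hmK⟩ := exists_gradient_lower_bound hS1.isCompact_closure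
    hS1.continuousOn_zeroExt (hS1.regular_zeroExt hδ)
  refine ⟨Cd / m, by positivity, fun x hx => ?_⟩
  have h1 := hmK x (subset_closure hx.1) ((zeroExt_coe (fun x : B => Δ x) x).trans hx.2)
  rw [hS1.gradient_zeroExt x.2] at h1
  exact div_le_div₀ hCd0 (hCd x) hm h1

lemma measurableSet_levelSetIn : MeasurableSet (levelSetIn B X Δ δ) := by
  have : levelSetIn B X Δ δ = ((Subtype.val : B → Cov n) ⁻¹' X) ∩ {x : B | Δ x = δ} := rfl
  rw [this]
  exact (measurable_subtype_coe hS1.isOpen_X.measurableSet).inter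
    (hS1.continuous_restrict.measurable (measurableSet_singleton δ))

lemma exists_bound_sub (G : C(B, ℝ)) (K : ℝ) :
    ∃ C : ℝ, 0 ≤ C ∧ ∀ x : B, (x : Cov n) ∈ closure X → |K - G x| ≤ C := by
  obtain ⟨C, hC⟩ := hS1.isCompact_preimage_closure.exists_bound_of_continuousOn
    (f := fun x => K - G x) (by fun_prop)
  exact ⟨|C|, abs_nonneg _, fun x hx => (hC x hx).trans (le_abs_self C)⟩

lemma measurable_surface {φ : B → ℝ} (hφ : Measurable φ) (G : C(B, ℝ)) (K : ℝ) :
    Measurable fun x : B => φ x * ((K - G x) / ‖gradient Δ (x : Cov n)‖) * dens x := by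
  have h1 := hS1.continuous_gradient.measurable
  have h2 := hS1.dens_continuous.measurable
  fun_prop

lemma abs_surface_le {φ G : B → ℝ} {K C C' J : ℝ} {x : B} (hC' : 0 ≤ C')
    (hφ : |φ x| ≤ C) (hG : |K - G x| ≤ C') (hJ : dens x / ‖gradient Δ (x : Cov n)‖ ≤ J) :
    |φ x * ((K - G x) / ‖gradient Δ (x : Cov n)‖) * dens x| ≤ C * C' * J := by
  have hC : 0 ≤ C := (abs_nonneg _).trans hφ
  have h0 := hS1.dens_nonneg x
  have e : φ x * ((K - G x) / ‖gradient Δ (x : Cov n)‖) * dens x =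
      φ x * (K - G x) * (dens x / ‖gradient Δ (x : Cov n)‖) := by ring
  rw [e, abs_mul, abs_mul, abs_of_nonneg (a := dens x / _) (by positivity)]
  gcongr

lemma integrable_surface (hδ : IsRegularValue Δ (closure X) δ) {φ : B → ℝ} (hφ : Measurable φ)
    {C : ℝ} (hφC : ∀ x : B, (x : Cov n) ∈ closure X → |φ x| ≤ C) (G : C(B, ℝ)) (K : ℝ) :
    Integrable (fun x : B => φ x * ((K - G x) / ‖gradient Δ (x : Cov n)‖) * dens x)
      ((μHE[n] : Measure B).restrict (levelSetIn B X Δ δ)) := by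
  have := hS1.isFiniteMeasure_levelSetIn hδ
  obtain ⟨J, hJ0, hJ⟩ := hS1.exists_weight_bound hδ
  obtain ⟨C', hC'0, hC'⟩ := hS1.exists_bound_sub G K
  refine Integrable.of_bound (hS1.measurable_surface hφ G K).aestronglyMeasurable (C * C' * J) ?_
  filter_upwards [ae_restrict_mem hS1.measurableSet_levelSetIn] with x hx
  have hxc : (x : Cov n) ∈ closure X := subset_closure hx.1
  exact hS1.abs_surface_le hC'0 (hφC x hxc) (hC' x hxc) (hJ x hx)

/-- A set of finite `n`-dimensional Hausdorff measure is null in dimension `n + 1`, hence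
Lebesgue-null, and `μ` has a density. -/
lemma ae_ne_level (hδ : IsRegularValue Δ (closure X) δ) : ∀ᵐ x : B ∂μ, Δ x ≠ δ := by
  have h := levelMeasure_lt_top hS1.measurable_zeroExt_self hS1.isCompact_closure
    hS1.continuousOn_zeroExt (hS1.regular_zeroExt hδ)
  rw [levelMeasure, Measure.restrict_apply' (show MeasurableSet {x | zeroExt (fun x : B => Δ x) x = δ} from
    hS1.measurable_zeroExt_self (measurableSet_singleton δ))] at h
  have h1 := (Measure.euclideanHausdorffMeasure_zero_or_top (Nat.lt_succ_self n)
    (closure X ∩ {x | zeroExt (fun x : B => Δ x) x = δ})).resolve_right h.ne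
  rw [Nat.succ_eq_add_one, EuclideanSpace.euclideanHausdorffMeasure_eq_volume] at h1
  have hm := MeasurableEmbedding.subtype_coe hS1.isOpen_B.measurableSet
  have h2 : ∀ᵐ x : B ∂((volume : Measure (Cov n)).comap (Subtype.val : B → Cov n)),
      (x : Cov n) ∉ closure X ∩ {x | zeroExt (fun x : B => Δ x) x = δ} := by
    rw [← hm.ae_map_iff (p := fun x : Cov n => x ∉ closure X ∩ {x | zeroExt (fun x : B => Δ x) x = δ}),
      map_comap_subtype_coe hS1.isOpen_B.measurableSet]
    exact ae_restrict_of_ae (measure_eq_zero_iff_ae_notMem.1 h1)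
  have h3 : μ ≪ (volume : Measure (Cov n)).comap (Subtype.val : B → Cov n) := by
    rw [hS1.eq_withDensity]
    exact withDensity_absolutelyContinuous _ _
  filter_upwards [h3 h2, hS1.ae_mem] with x hx hd hxδ
  exact hx ⟨subset_closure (hS1.mem_of_dens_ne hd), (zeroExt_coe (fun x : B => Δ x) x).trans hxδ⟩

lemma measure_pos_of_isOpen {U : Set B} (hU : IsOpen U) {x : B} (hx : x ∈ U) (hd : dens x ≠ 0) :
    0 < μ U := by
  by_contra! h
  have h0 : μ U = 0 := le_antisymm h zero_le
  have hm := MeasurableEmbedding.subtype_coe hS1.isOpen_B.measurableSet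
  have hW : IsOpen (U ∩ {y | dens y ≠ 0}) :=
    hU.inter (isOpen_ne_fun hS1.dens_continuous continuous_const)
  have h1 : ∀ᵐ y ∂μ, y ∉ U := measure_eq_zero_iff_ae_notMem.1 h0
  rw [hS1.eq_withDensity, ae_withDensity_iff hS1.dens_continuous.measurable.ennreal_ofReal] at h1
  have h2 : ((volume : Measure (Cov n)).comap (Subtype.val : B → Cov n))
      (U ∩ {y | dens y ≠ 0}) = 0 := by
    rw [measure_eq_zero_iff_ae_notMem]
    refine h1.mono fun y hy hy' => hy ?_ hy'.1
    rw [Ne, ENNReal.ofReal_eq_zero, not_le]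
    exact lt_of_le_of_ne (hS1.dens_nonneg y) (Ne.symm hy'.2)
  rw [hm.comap_apply] at h2
  have h3 : IsOpen (Subtype.val '' (U ∩ {y | dens y ≠ 0})) :=
    hS1.isOpen_B.isOpenMap_subtype_val _ hW
  exact (h3.measure_pos volume ⟨x, x, ⟨hx, hd⟩, rfl⟩).ne' h2

/-- Under asymptotic equicontinuity, convergence in mean forces pointwise convergence. -/
lemma tendsto_of_eLpNorm {φ : ℕ → B → ℝ} {φ₀ : B → ℝ} {x : B} (hd : dens x ≠ 0)
    (hosc : OscillationVanishesAt φ x) (hc : ContinuousAt φ₀ x)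
    (hL : Tendsto (fun k => eLpNorm (φ k - φ₀) 1 μ) atTop (𝓝 0)) :
    Tendsto (fun k => φ k x) atTop (𝓝 (φ₀ x)) := by
  rw [Metric.tendsto_nhds]
  intro ε hε
  have h1 := Metric.tendsto_nhds.1 hosc (ε / 3) (by positivity)
  obtain ⟨pa, hpa, pb, hpb, hab⟩ := eventually_prod_iff.1 h1
  have h2 := Metric.tendsto_nhds.1 hc (ε / 3) (by positivity)
  obtain ⟨U, hU, hUo, hxU⟩ := eventually_nhds_iff.1 (hpb.and h2)
  have hpos := hS1.measure_pos_of_isOpen hUo hxU hd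
  have hpos' : 0 < ENNReal.ofReal (ε / 3) * μ U :=
    ENNReal.mul_pos (ENNReal.ofReal_pos.2 (by positivity)).ne' hpos.ne'
  filter_upwards [hpa, hL.eventually_lt_const hpos'] with k hk hkL
  by_contra! hcon
  rw [Real.dist_eq] at hcon
  -- If the values at `x` differ by at least `ε`, the two oscillation bounds leave a difference of
  -- at least `ε / 3` throughout `U`, so the `L¹` distance is at least `ε / 3 * μ U`, a positive
  -- number independent of `k`.
  refine absurd hkL (not_lt.2 ?_)
  rw [eLpNorm_one_eq_lintegral_enorm, ← setLIntegral_const]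
  refine (setLIntegral_mono' hUo.measurableSet fun y hy => ?_).trans
    (setLIntegral_le_lintegral U _)
  rw [Pi.sub_apply, Real.enorm_eq_ofReal_abs]
  refine ENNReal.ofReal_le_ofReal ?_
  have a1 := hab hk (hU y hy).1
  have a2 := (hU y hy).2
  rw [Real.dist_eq, sub_zero] at a1
  rw [Real.dist_eq] at a2
  have a3 : |φ k x - φ₀ x| ≤ |φ k y - φ k x| + |φ k y - φ₀ y| + |φ₀ y - φ₀ x| := by
    rw [abs_sub_comm (φ k y) (φ k x)]
    exact (abs_sub_le _ (φ k y) _).trans (by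
      rw [add_assoc]
      exact add_le_add_right (abs_sub_le _ (φ₀ y) _) _)
  linarith

/-- The surface integral is jointly continuous in the test function and the perturbation. -/
lemma tendsto_surface (hδ : IsRegularValue Δ (closure X) δ)
    (hΘ : IsTestSubclass X Δ dens δ μ κ M Θ) {φ : ℕ → B → ℝ} {φ₀ : B → ℝ}
    (hφ : ∀ k, φ k ∈ Θ) (hφ₀ : φ₀ ∈ Θ)
    (hL : Tendsto (fun k => eLpNorm (φ k - φ₀) 1 μ) atTop (𝓝 0))
    {G : ℕ → C(B, ℝ)} {G₀ : C(B, ℝ)} {K : ℕ → ℝ} {K₀ : ℝ}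
    (hG : TendstoUniformly (fun k => ⇑(G k)) G₀ atTop) (hK : Tendsto K atTop (𝓝 K₀)) :
    Tendsto (fun k => ∫ x in levelSetIn B X Δ δ,
      φ k x * ((K k - G k x) / ‖gradient Δ (x : Cov n)‖) * dens x ∂μHE[n]) atTop
      (𝓝 (∫ x in levelSetIn B X Δ δ,
        φ₀ x * ((K₀ - G₀ x) / ‖gradient Δ (x : Cov n)‖) * dens x ∂μHE[n])) := by
  have := hS1.isFiniteMeasure_levelSetIn hδ
  obtain ⟨J, hJ0, hJ⟩ := hS1.exists_weight_bound hδ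
  obtain ⟨C', hC'0, hC'⟩ := hS1.exists_bound_sub G₀ K₀
  obtain ⟨C, hC⟩ := hΘ.bounded
  have hev : ∀ᶠ k in atTop, ∀ x : B, (x : Cov n) ∈ closure X → |K k - G k x| ≤ C' + 2 := by
    filter_upwards [Metric.tendstoUniformly_iff.1 hG 1 one_pos, Metric.tendsto_nhds.1 hK 1 one_pos]
      with k h1 h2 x hx
    have h1' := abs_lt.1 (by simpa [Real.dist_eq] using h1 x)
    have h2' := abs_lt.1 (by simpa [Real.dist_eq] using h2)
    have h3 := abs_le.1 (hC' x hx)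
    rw [abs_le]
    constructor <;> linarith [h1'.1, h1'.2, h2'.1, h2'.2, h3.1, h3.2]
  -- It suffices to find, within each subsequence, a further one that converges; this is the form in
  -- which `hΘ.compact` can be used.
  refine tendsto_of_subseq_tendsto fun ns hns => ?_
  obtain ⟨s, hs, hosc⟩ := hΘ.compact (fun k => φ (ns k)) fun k => hφ _
  refine ⟨s, ?_⟩
  have hns' : Tendsto (fun k => ns (s k)) atTop atTop := hns.comp hs
  refine tendsto_integral_filter_of_dominated_convergence (fun _ => C * (C' + 2) * J)
    (Eventually.of_forall fun k => (hS1.measurable_surface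
      (stronglyMeasurable_class μ κ M (hΘ.subset (hφ _))).measurable _ _).aestronglyMeasurable)
    ?_ (integrable_const _) ?_
  · filter_upwards [hns'.eventually hev] with k hk
    filter_upwards [ae_restrict_mem hS1.measurableSet_levelSetIn] with x hx
    have hxc : (x : Cov n) ∈ closure X := subset_closure hx.1
    exact hS1.abs_surface_le (by positivity) (hC _ (hφ _) x hxc) (hk x hxc) (hJ x hx)
  · filter_upwards [hosc, hΘ.continuousAt hφ₀] with x hx1 hx2
    by_cases hd : dens x = 0
    · simp [hd]
    · have h1 := hS1.tendsto_of_eLpNorm hd (hx1 hd) (hx2 hd) (hL.comp hns')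
      have h2 : Tendsto (fun k => G (ns (s k)) x) atTop (𝓝 (G₀ x)) :=
        (hG.tendsto_at x).comp hns'
      exact (h1.mul (((hK.comp hns').sub h2).div_const _)).mul_const _

end CondS1
end

/-! ## Hadamard differentiability on a test subclass -/

section
variable {n p : ℕ} {B X : Set (Cov n)} {Δ : Cov n → ℝ} {dens : B → ℝ} {δ : ℝ} {μ : Measure B}
  [IsProbabilityMeasure μ] {κ : Kernel B (Fin p → ℝ)} [IsMarkovKernel κ] {M : ℕ}
  {F : Set C(B, ℝ)} {V : Set ℝ} {Θ : Set (B → ℝ)}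

/-- The derivative of the numerator `(f, ν, d) ↦ ν(φ 1{f ≤ d})` of the classification operator. -/
def numDeriv (X : Set (Cov n)) (Δ : Cov n → ℝ) (dens : B → ℝ) (δ : ℝ) (φ : B → ℝ)
    (h : DTilde μ κ M F V) : ℝ :=
  (∫ x in levelSetIn B X Δ δ,
    φ x * ((h.2.2 - h.1 x) / ‖gradient Δ (x : Cov n)‖) * dens x ∂μHE[n]) +
      opEval h.2.1.1 (trunc φ (fun x => Δ x) δ)

lemma trunc_mem_testClass {φ : B → ℝ} (hφ : φ ∈ momentClass μ κ M ∪ indicatorClass κ)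
    {f : C(B, ℝ)} (hf : f ∈ F) {d : ℝ} (hd : d ∈ V) : trunc φ f d ∈ testClass μ κ M F V :=
  ⟨f, hf, φ, hφ, d, hd, rfl⟩

lemma IsTestSubclass.measurable_integrable (hΘ : IsTestSubclass X Δ dens δ μ κ M Θ) {φ : B → ℝ} (hφ : φ ∈ Θ) :
    Measurable φ ∧ Integrable φ μ :=
  ⟨(stronglyMeasurable_class μ κ M (hΘ.subset hφ)).measurable, integrable_class μ κ M (hΘ.subset hφ)⟩

namespace CondS1
variable (hS1 : CondS1 X B Δ dens μ)
include hS1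

/-- This is the quotient rule: with numerator `A`, denominator `D` and their derivatives `a`, `b`,
the derivative of `A / D` is `(a - (A / D) b) / D`. The normalisation of `φ` encodes exactly this
combination. -/
lemma classDeriv_eq (hF : hS1.toC ∈ F) (hδV : δ ∈ V) (hδ : IsRegularValue Δ (closure X) δ)
    (hΘ : IsTestSubclass X Δ dens δ μ κ M Θ) {φ : B → ℝ} (hφ : φ ∈ Θ) (h : DTilde μ κ M F V) :
    classDeriv X Δ dens δ φ h =
      (numDeriv X Δ dens δ φ h - (∫ x, trunc φ (fun x => Δ x) δ x ∂μ) /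
        distrFun μ (fun x => Δ x) δ * numDeriv X Δ dens δ 1 h) / distrFun μ (fun x => Δ x) δ := by
  obtain ⟨C, hC⟩ := hΘ.bounded
  set D := distrFun μ (fun x => Δ x) δ with hD
  set A := ∫ x, trunc φ (fun x => Δ x) δ x ∂μ with hA
  have hi1 := hS1.integrable_surface hδ (hΘ.measurable_integrable hφ).1 (hC φ hφ) h.1 h.2.2
  have hi2 := hS1.integrable_surface hδ (φ := 1) measurable_one (C := 1) (by simp) h.1 h.2.2
  have e1 : (∫ x in levelSetIn B X Δ δ, surfaceIntegrand Δ dens μ δ φ h.1 h.2.2 x ∂μHE[n]) =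
      D⁻¹ * (∫ x in levelSetIn B X Δ δ,
        φ x * ((h.2.2 - h.1 x) / ‖gradient Δ (x : Cov n)‖) * dens x ∂μHE[n]) -
      A / D * D⁻¹ * (∫ x in levelSetIn B X Δ δ,
        (1 : B → ℝ) x * ((h.2.2 - h.1 x) / ‖gradient Δ (x : Cov n)‖) * dens x ∂μHE[n]) := by
    rw [← integral_const_mul, ← integral_const_mul, ← integral_sub (hi1.const_mul _) (hi2.const_mul _)]
    congr 1
    funext x
    simp only [surfaceIntegrand, normalized, ← hD, ← hA, Pi.one_apply]
    ring
  have e2 : trunc (normalized μ (fun z => Δ z) δ φ) (fun z => Δ z) δ =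
      D⁻¹ • trunc φ (fun x => Δ x) δ + (-(A / D * D⁻¹)) • trunc 1 (fun x => Δ x) δ := by
    funext x
    simp only [trunc, Set.indicator_apply, Pi.add_apply, Pi.smul_apply, smul_eq_mul, normalized,
      Pi.one_apply, ← hD]
    split_ifs
    · change (φ x - A / D) / D = _
      ring
    · simp
  have m1 : trunc φ (fun x => Δ x) δ ∈ testClass μ κ M F V :=
    trunc_mem_testClass (hΘ.subset hφ) hF hδV
  have m2 : trunc 1 (fun x => Δ x) δ ∈ testClass μ κ M F V :=
    trunc_mem_testClass (Or.inl (one_mem_momentClass μ κ M)) hF hδV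
  rw [classDeriv, e1, e2, opEval_combination _ m1 m2, numDeriv, numDeriv]
  ring

lemma numDeriv_add_smul (hδ : IsRegularValue Δ (closure X) δ)
    (hΘ : IsTestSubclass X Δ dens δ μ κ M Θ) {φ : B → ℝ} (hφ : φ ∈ Θ) (h h' : DTilde μ κ M F V)
    (c : ℝ) : numDeriv X Δ dens δ φ (h + c • h') =
      numDeriv X Δ dens δ φ h + c * numDeriv X Δ dens δ φ h' := by
  obtain ⟨C, hC⟩ := hΘ.bounded
  have hi1 := hS1.integrable_surface hδ (hΘ.measurable_integrable hφ).1 (hC φ hφ) h.1 h.2.2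
  have hi2 := hS1.integrable_surface hδ (hΘ.measurable_integrable hφ).1 (hC φ hφ) h'.1 h'.2.2
  have e : opEval (h + c • h').2.1.1 (trunc φ (fun x => Δ x) δ) =
      opEval h.2.1.1 (trunc φ (fun x => Δ x) δ) + c * opEval h'.2.1.1 (trunc φ (fun x => Δ x) δ) :=
    opEval_add_smul _ _ _ _
  rw [numDeriv, numDeriv, numDeriv, e, mul_add, ← integral_const_mul, add_add_add_comm,
    ← integral_add hi1 (hi2.const_mul c)]
  congr 2
  funext x
  change φ x * ((h.2.2 + c * h'.2.2 - (h.1 x + c * h'.1 x)) / _) * _ = _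
  ring

lemma classDeriv_add_smul (hF : hS1.toC ∈ F) (hδV : δ ∈ V) (hδ : IsRegularValue Δ (closure X) δ)
    (hΘ : IsTestSubclass X Δ dens δ μ κ M Θ) {φ : B → ℝ} (hφ : φ ∈ Θ) (h h' : DTilde μ κ M F V)
    (c : ℝ) : classDeriv X Δ dens δ φ (h + c • h') =
      classDeriv X Δ dens δ φ h + c * classDeriv X Δ dens δ φ h' := by
  rw [hS1.classDeriv_eq hF hδV hδ hΘ hφ, hS1.classDeriv_eq hF hδV hδ hΘ hφ,
    hS1.classDeriv_eq hF hδV hδ hΘ hφ, hS1.numDeriv_add_smul hδ hΘ hφ,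
    hS1.numDeriv_add_smul hδ (isTestSubclass_one (κ := κ) (M := M)) rfl]
  ring

lemma abs_trunc_le {φ : B → ℝ} {C : ℝ}
    (hC : ∀ x : B, (x : Cov n) ∈ closure X → |φ x| ≤ C) (f : B → ℝ) (d : ℝ) :
    ∀ᵐ x ∂μ, |trunc φ f d x| ≤ C := by
  filter_upwards [hS1.ae_mem] with x hx
  have h1 := hC x (subset_closure (hS1.mem_of_dens_ne hx))
  simp only [trunc, Set.indicator_apply]
  split_ifs
  · exact h1
  · simpa using (abs_nonneg _).trans h1

/-- Since `numDeriv` along a sequence of test functions need not converge, a uniform bound replaces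
its limit in the quotient rule. -/
lemma exists_bound_numDeriv (hF : hS1.toC ∈ F) (hδV : δ ∈ V) (hδ : IsRegularValue Δ (closure X) δ)
    (hΘ : IsTestSubclass X Δ dens δ μ κ M Θ) (h : DTilde μ κ M F V) :
    ∃ C : ℝ, ∀ φ ∈ Θ, |numDeriv X Δ dens δ φ h| ≤ C := by
  have := hS1.isFiniteMeasure_levelSetIn hδ
  obtain ⟨C, hC⟩ := hΘ.bounded
  obtain ⟨J, hJ0, hJ⟩ := hS1.exists_weight_bound hδ
  obtain ⟨C', hC'0, hC'⟩ := hS1.exists_bound_sub h.1 h.2.2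
  obtain ⟨C'', hC''⟩ := h.2.1.2.1
  refine ⟨C * C' * J * ((μHE[n] : Measure B).restrict (levelSetIn B X Δ δ)).real Set.univ + C'',
    fun φ hφ => (abs_add_le _ _).trans (add_le_add ?_ ?_)⟩
  · refine norm_integral_le_of_norm_le_const
      (μ := (μHE[n] : Measure B).restrict (levelSetIn B X Δ δ))
      (f := fun x : B => φ x * ((h.2.2 - h.1 x) / ‖gradient Δ (x : Cov n)‖) * dens x)
      (C := C * C' * J) ?_
    filter_upwards [ae_restrict_mem hS1.measurableSet_levelSetIn] with x hx
    have hxc : (x : Cov n) ∈ closure X := subset_closure hx.1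
    exact hS1.abs_surface_le hC'0 (hC φ hφ x hxc) (hC' x hxc) (hJ x hx)
  · have m1 : trunc φ (fun x => Δ x) δ ∈ testClass μ κ M F V :=
      trunc_mem_testClass (hΘ.subset hφ) hF hδV
    rw [opEval_eq_onClass _ m1]
    exact hC'' _

/-- The truncation error tends to zero in mean square. -/
lemma tendsto_eLpNorm_trunc (hδ : IsRegularValue Δ (closure X) δ) {t : ℕ → ℝ}
    {φ : ℕ → B → ℝ} {G : ℕ → C(B, ℝ)} {G₀ : C(B, ℝ)} {K : ℕ → ℝ} {K₀ C : ℝ}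
    (ht : Tendsto t atTop (𝓝 0)) (hφm : ∀ k, Measurable (φ k))
    (hφC : ∀ k (x : B), (x : Cov n) ∈ closure X → |φ k x| ≤ C)
    (hG : TendstoUniformly (fun k => ⇑(G k)) G₀ atTop) (hK : Tendsto K atTop (𝓝 K₀)) :
    Tendsto (fun k => eLpNorm (trunc (φ k) (hS1.toC + t k • G k : C(B, ℝ)) (δ + t k * K k) -
      trunc (φ k) (fun x => Δ x) δ) 2 μ) atTop (𝓝 0) := by
  have hbd : ∀ k, ∀ᵐ x ∂μ, |(trunc (φ k) (hS1.toC + t k • G k : C(B, ℝ)) (δ + t k * K k) -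
      trunc (φ k) (fun x => Δ x) δ) x| ≤ C + C := fun k => by
    filter_upwards [hS1.abs_trunc_le (hφC k) (hS1.toC + t k • G k : C(B, ℝ)) (δ + t k * K k),
      hS1.abs_trunc_le (hφC k) (fun x => Δ x) δ] with x h1 h2
    exact (abs_sub _ _).trans (add_le_add h1 h2)
  refine tendsto_eLpNorm_two_of_one hbd (tendsto_eLpNorm_one_of_ae (fun k => ?_) hbd ?_)
  · exact (((hφm k).indicator (measurableSet_sublevel _ _)).sub
      ((hφm k).indicator (measurableSet_sublevel hS1.toC _))).aestronglyMeasurable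
  · filter_upwards [hS1.ae_ne_level hδ] with x hx
    have h1 : Tendsto (fun k => Δ x + t k * G k x) atTop (𝓝 (Δ x)) := by
      simpa using (ht.mul (hG.tendsto_at x)).const_add (Δ x)
    have h2 : Tendsto (fun k => δ + t k * K k) atTop (𝓝 δ) := by
      simpa using (ht.mul hK).const_add δ
    have h3 : ∀ᶠ k in atTop, (Δ x + t k * G k x ≤ δ + t k * K k) ↔ Δ x ≤ δ := by
      rcases lt_or_gt_of_ne hx with h | h
      · filter_upwards [h1.eventually_lt h2 h] with k hk
        exact ⟨fun _ => h.le, fun _ => hk.le⟩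
      · filter_upwards [h2.eventually_lt h1 h] with k hk
        exact iff_of_false hk.not_ge h.not_ge
    refine tendsto_const_nhds.congr' ?_
    filter_upwards [h3] with k hk
    have e1 : hS1.toC x = Δ x := rfl
    simp only [trunc, Pi.sub_apply, Set.indicator_apply, Set.mem_ofPred_eq, ContinuousMap.add_apply,
      ContinuousMap.smul_apply, smul_eq_mul, e1, hk, sub_self]

/-- Differentiability of the numerator along sequences of test functions. -/
lemma tendsto_numerator (hF : hS1.toC ∈ F) (hδV : δ ∈ V) (hδ : IsRegularValue Δ (closure X) δ)
    (hΘ : IsTestSubclass X Δ dens δ μ κ M Θ) {t : ℕ → ℝ} {h : ℕ → DTilde μ κ M F V}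
    {h₀ : DTilde μ κ M F V} (ht : Tendsto t atTop (𝓝 0)) (ht0 : ∀ k, t k ≠ 0)
    (hh : Tendsto (fun k => dNorm (h k - h₀)) atTop (𝓝 0))
    (hFk : ∀ k, hS1.toC + t k • (h k).1 ∈ F) (hVk : ∀ k, δ + t k * (h k).2.2 ∈ V)
    {φ : ℕ → B → ℝ} (hφ : ∀ k, φ k ∈ Θ) :
    Tendsto (fun k => (t k)⁻¹ * (opEval (integralOp μ κ M F V + t k • (h k).2.1.1)
        (trunc (φ k) (hS1.toC + t k • (h k).1 : C(B, ℝ)) (δ + t k * (h k).2.2)) -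
        ∫ x, trunc (φ k) (fun x => Δ x) δ x ∂μ) - numDeriv X Δ dens δ (φ k) h₀) atTop (𝓝 0) := by
  obtain ⟨C, hC⟩ := hΘ.bounded
  refine tendsto_of_subseq_tendsto fun ns hns => ?_
  obtain ⟨s, hs, hosc⟩ := hΘ.compact (fun k => φ (ns k)) fun k => hφ _
  refine ⟨s, ?_⟩
  set m : ℕ → ℕ := fun k => ns (s k) with hm
  have hmt : Tendsto m atTop atTop := hns.comp hs
  obtain ⟨hG, hH, hK⟩ := tendsto_components (h := fun k => h (m k)) (hh.comp hmt)
  have h1 := hS1.tendsto_integral_trunc_sub hδ (φ := fun k => φ (m k)) (t := fun k => t (m k))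
    (ht.comp hmt) (fun k => ht0 _) (fun k => (hΘ.measurable_integrable (hφ _)).1) (fun k => (hΘ.measurable_integrable (hφ _)).2)
    (fun k => hC _ (hφ _)) hG hK hosc
  have h2 := hS1.tendsto_eLpNorm_trunc hδ (φ := fun k => φ (m k)) (t := fun k => t (m k))
    (ht.comp hmt) (fun k => (hΘ.measurable_integrable (hφ _)).1) (fun k => hC _ (hφ _)) hG hK
  have h3 := tendsto_opEval_sub h₀.2.1.2 hH
    (fun k => trunc_mem_testClass (hΘ.subset (hφ (m k))) (hFk (m k)) (hVk (m k)))
    (fun k => trunc_mem_testClass (hΘ.subset (hφ (m k))) hF hδV) h2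
  have h4 := h1.add h3
  rw [add_zero] at h4
  refine h4.congr fun k => ?_
  have e1 := opEval_integralOp μ κ M F V
    (trunc_mem_testClass (hΘ.subset (hφ (m k))) (hFk (m k)) (hVk (m k)))
  have hne := ht0 (m k)
  have e2 : trunc (φ (m k)) hS1.toC δ = trunc (φ (m k)) (fun x => Δ x) δ := rfl
  -- Here `a`, `b` are the `μ`-integrals of the perturbed and unperturbed truncations and `d`, `e`
  -- the values of the perturbing and limiting operators; the cross term `t * d` becomes `d` after
  -- division.
  have key : ∀ t a b c d e : ℝ, t ≠ 0 →
      t⁻¹ * (a - b) - c + (d - e) = t⁻¹ * (a + t * d - b) - (c + e) := fun t a b c d e ht => by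
    field_simp
    ring
  change _ = (t (m k))⁻¹ * (opEval (integralOp μ κ M F V + t (m k) • (h (m k)).2.1.1)
    (trunc (φ (m k)) (hS1.toC + t (m k) • (h (m k)).1 : C(B, ℝ)) (δ + t (m k) * (h (m k)).2.2)) -
    ∫ x, trunc (φ (m k)) (fun x => Δ x) δ x ∂μ) - numDeriv X Δ dens δ (φ (m k)) h₀
  rw [opEval_add_smul, e1, numDeriv, ← e2]
  exact key _ _ _ _ _ _ hne

/-- Continuity of the derivative of the numerator. -/
lemma tendsto_numDeriv (hF : hS1.toC ∈ F) (hδV : δ ∈ V) (hδ : IsRegularValue Δ (closure X) δ)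
    (hΘ : IsTestSubclass X Δ dens δ μ κ M Θ) {h : ℕ → DTilde μ κ M F V}
    {h₀ : DTilde μ κ M F V} (hh : Tendsto (fun k => dNorm (h k - h₀)) atTop (𝓝 0))
    {φ : ℕ → B → ℝ} {φ₀ : B → ℝ} (hφ : ∀ k, φ k ∈ Θ) (hφ₀ : φ₀ ∈ Θ)
    (hL : Tendsto (fun k => eLpNorm (φ k - φ₀) 1 μ) atTop (𝓝 0)) :
    Tendsto (fun k => numDeriv X Δ dens δ (φ k) (h k)) atTop (𝓝 (numDeriv X Δ dens δ φ₀ h₀)) := by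
  obtain ⟨C, hC⟩ := hΘ.bounded
  obtain ⟨hG, hH, hK⟩ := tendsto_components hh
  refine (hS1.tendsto_surface hδ hΘ hφ hφ₀ hL hG hK).add ?_
  have h2 : Tendsto (fun k => eLpNorm (φ k - φ₀) 2 μ) atTop (𝓝 0) := by
    refine tendsto_eLpNorm_two_of_one (C := C + C) (fun k => ?_) hL
    filter_upwards [hS1.ae_mem] with x hx
    have hxc : (x : Cov n) ∈ closure X := subset_closure (hS1.mem_of_dens_ne hx)
    exact (abs_sub _ _).trans (add_le_add (hC _ (hφ k) x hxc) (hC _ hφ₀ x hxc))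
  have h3 : Tendsto (fun k => eLpNorm (trunc (φ k) (fun x => Δ x) δ - trunc φ₀ (fun x => Δ x) δ) 2 μ)
      atTop (𝓝 0) := by
    refine tendsto_of_tendsto_of_tendsto_of_le_of_le tendsto_const_nhds h2 (fun _ => zero_le)
      fun k => eLpNorm_mono fun x => ?_
    simp only [trunc, Pi.sub_apply, Set.indicator_apply]
    split_ifs
    · exact le_rfl
    · simp
  exact tendsto_sub_nhds_zero_iff.1 (tendsto_opEval_sub h₀.2.1.2 hH
    (fun k => trunc_mem_testClass (hΘ.subset (hφ k)) hF hδV)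
    (fun _ => trunc_mem_testClass (hΘ.subset hφ₀) hF hδV) h3)

lemma tendsto_integral_trunc {φ : ℕ → B → ℝ} {φ₀ : B → ℝ} (hφ : ∀ k, Integrable (φ k) μ)
    (hφ₀ : Integrable φ₀ μ) (hL : Tendsto (fun k => eLpNorm (φ k - φ₀) 1 μ) atTop (𝓝 0)) :
    Tendsto (fun k => ∫ x, trunc (φ k) (fun x => Δ x) δ x ∂μ) atTop
      (𝓝 (∫ x, trunc φ₀ (fun x => Δ x) δ x ∂μ)) := by
  have hm : MeasurableSet {x : B | Δ x ≤ δ} := measurableSet_sublevel hS1.toC δ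
  refine tendsto_integral_of_L1 _ (hφ₀.indicator hm).aestronglyMeasurable
    (Eventually.of_forall fun k => (hφ k).indicator hm) ?_
  refine tendsto_of_tendsto_of_tendsto_of_le_of_le tendsto_const_nhds hL (fun _ => zero_le)
    fun k => ?_
  rw [eLpNorm_one_eq_lintegral_enorm]
  refine lintegral_mono fun x => ?_
  simp only [trunc, Pi.sub_apply, Set.indicator_apply]
  split_ifs
  · exact le_rfl
  · simp

/-- Differentiability follows from the numerator along arbitrary sequences `φ k` and from the fixed
function `1`, combined by an exact form of the quotient rule. Continuity follows from sequential
continuity of each ingredient of `classDeriv_eq`. -/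
theorem hasUniformHadamardDeriv (hF : hS1.toC ∈ F) (hδV : δ ∈ V)
    (hδ : IsRegularValue Δ (closure X) δ) (hpos : 0 < distrFun μ (fun x => Δ x) δ)
    (hΘ : IsTestSubclass X Δ dens δ μ κ M Θ) :
    HasUniformHadamardDeriv dNorm (l1Dist μ) Θ (opDomain μ κ M F V)
      (tangentSpace μ κ M F V) classOp (hS1.toC, measureOp μ κ M F V, δ)
      (classDeriv X Δ dens δ) := by
  set D := distrFun μ (fun x => Δ x) δ with hD
  have h1 := isTestSubclass_one (X := X) (Δ := Δ) (dens := dens) (δ := δ) (μ := μ) (κ := κ) (M := M)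
  have one_mem : ∀ {f : C(B, ℝ)} {d : ℝ}, f ∈ F → d ∈ V → trunc 1 f d ∈ testClass μ κ M F V :=
    fun hf hd => trunc_mem_testClass (Or.inl (one_mem_momentClass μ κ M)) hf hd
  have hden : opEval (integralOp μ κ M F V) (trunc 1 hS1.toC δ) = D :=
    opEval_integralOp μ κ M F V (one_mem hF hδV)
  refine ⟨⟨hF, hδV, ?_⟩, fun φ hφ => ⟨fun a b => ?_, fun c a => ?_⟩, ?_, ?_⟩
  · change opEval (integralOp μ κ M F V) (trunc 1 hS1.toC δ) ≠ 0
    rw [hden]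
    exact hpos.ne'
  · have := hS1.classDeriv_add_smul hF hδV hδ hΘ hφ (a : DTilde μ κ M F V) b 1
    simpa using this
  · have e1 := hS1.classDeriv_add_smul hF hδV hδ hΘ hφ (0 : DTilde μ κ M F V) a c
    -- With all increments zero, additivity forces the value at the origin to vanish; homogeneity is
    -- then additivity based at the origin.
    have e2 := hS1.classDeriv_add_smul hF hδV hδ hΘ hφ (0 : DTilde μ κ M F V) 0 1
    rw [smul_zero, add_zero, one_mul, left_eq_add] at e2
    rw [e2, zero_add, zero_add] at e1
    exact e1
  · intro t h h₀ ht ht0 hh _ hdom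
    have hFk : ∀ k, hS1.toC + t k • (h k).1 ∈ F := fun k => (hdom k).1
    have hVk : ∀ k, δ + t k * (h k).2.2 ∈ V := fun k => (hdom k).2.1
    refine tendstoUniformlyOn_of_forall_seq fun φ hφ => ?_
    obtain ⟨C, hC⟩ := hΘ.bounded
    obtain ⟨C', hC'⟩ := hS1.exists_bound_numDeriv hF hδV hδ hΘ h₀
    set N : ℕ → ℝ := fun k => opEval (integralOp μ κ M F V + t k • (h k).2.1.1)
        (trunc (φ k) (hS1.toC + t k • (h k).1 : C(B, ℝ)) (δ + t k * (h k).2.2)) with hN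
    set Dk : ℕ → ℝ := fun k => opEval (integralOp μ κ M F V + t k • (h k).2.1.1)
        (trunc 1 (hS1.toC + t k • (h k).1 : C(B, ℝ)) (δ + t k * (h k).2.2)) with hDk
    set A : ℕ → ℝ := fun k => ∫ x, trunc (φ k) (fun x => Δ x) δ x ∂μ with hA
    set a : ℕ → ℝ := fun k => numDeriv X Δ dens δ (φ k) h₀ with ha
    set b : ℝ := numDeriv X Δ dens δ 1 h₀ with hb
    have n1 : Tendsto (fun k => (t k)⁻¹ * (N k - A k) - a k) atTop (𝓝 0) :=
      hS1.tendsto_numerator hF hδV hδ hΘ ht ht0 hh hFk hVk hφ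
    have n2 : Tendsto (fun k => (t k)⁻¹ * (Dk k - D) - b) atTop (𝓝 0) :=
      hS1.tendsto_numerator hF hδV hδ h1 ht ht0 hh hFk hVk (φ := fun _ => 1) fun _ => rfl
    have hAC : ∀ k, |A k| ≤ C := fun k => by
      have := norm_integral_le_of_norm_le_const (μ := μ)
        (f := trunc (φ k) (fun x => Δ x) δ) (C := C)
        (hS1.abs_trunc_le (hC _ (hφ k)) (fun x => Δ x) δ)
      simpa using this
    have haC : ∀ k, |a k| ≤ C' := fun k => hC' _ (hφ k)
    have hDl : Tendsto Dk atTop (𝓝 D) := by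
      have := (ht.mul (n2.add_const b)).add_const D
      rw [zero_mul, zero_add] at this
      refine this.congr fun k => ?_
      have := ht0 k
      field_simp
      ring
    -- An exact identity: the first summand contains only errors already known to vanish, the second
    -- is a bounded factor times `(Dk k)⁻¹ - D⁻¹`.
    have e : ∀ k, (t k)⁻¹ • (classOp (φ k) ((hS1.toC, measureOp μ κ M F V, δ) + t k • h k) -
        classOp (φ k) (hS1.toC, measureOp μ κ M F V, δ)) - classDeriv X Δ dens δ (φ k) h₀ =
        ((((t k)⁻¹ * (N k - A k) - a k) - A k / D * ((t k)⁻¹ * (Dk k - D) - b)) * (Dk k)⁻¹) +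
        (a k - A k / D * b) * ((Dk k)⁻¹ - D⁻¹) := fun k => by
      have q1 : classOp (φ k) ((hS1.toC, measureOp μ κ M F V, δ) + t k • h k) = N k / Dk k := rfl
      have q2 : classOp (φ k) (hS1.toC, measureOp μ κ M F V, δ) = A k / D := by
        rw [← hden]
        exact congrArg (· / _) (opEval_integralOp μ κ M F V
          (trunc_mem_testClass (hΘ.subset (hφ k)) hF hδV))
      have hDk0 : Dk k ≠ 0 := (hdom k).2.2
      have hD0 : D ≠ 0 := hpos.ne'
      have htk := ht0 k
      rw [q1, q2, hS1.classDeriv_eq hF hδV hδ hΘ (hφ k), smul_eq_mul]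
      change _ - (a k - A k / D * b) / D = _
      field_simp
      ring
    simp only [e]
    have hinv : Tendsto (fun k => (Dk k)⁻¹) atTop (𝓝 D⁻¹) := hDl.inv₀ hpos.ne'
    have z1 : Tendsto (fun k => A k / D * ((t k)⁻¹ * (Dk k - D) - b)) atTop (𝓝 0) := by
      refine squeeze_zero_norm (a := fun k => C / D * |(t k)⁻¹ * (Dk k - D) - b|) (fun k => ?_)
        (by simpa using n2.abs.const_mul (C / D))
      rw [norm_mul, norm_div, Real.norm_of_nonneg hpos.le]
      exact mul_le_mul_of_nonneg_right (div_le_div_of_nonneg_right (hAC k) hpos.le) (norm_nonneg _)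
    have z2 : Tendsto (fun k => (a k - A k / D * b) * ((Dk k)⁻¹ - D⁻¹)) atTop (𝓝 0) := by
      refine squeeze_zero_norm (a := fun k => (C' + C / D * |b|) * |(Dk k)⁻¹ - D⁻¹|) (fun k => ?_) ?_
      · rw [norm_mul]
        refine mul_le_mul_of_nonneg_right ((abs_sub _ _).trans (add_le_add (haC k) ?_))
          (norm_nonneg _)
        rw [abs_mul, abs_div, abs_of_pos hpos]
        exact mul_le_mul_of_nonneg_right (div_le_div_of_nonneg_right (hAC k) hpos.le) (abs_nonneg _)
      · simpa using (hinv.sub_const D⁻¹).abs.const_mul (C' + C / D * |b|)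
    simpa using ((n1.sub z1).mul hinv).add z2
  · intro φ hφ h _ ε hε
    by_contra! hcon
    -- Failure of continuity is tested at the radii `1 / (k + 1)`, which gives a sequence converging
    -- in both distances.
    have hseq : ∀ k : ℕ, ∃ φ' ∈ Θ, ∃ h' : DTilde μ κ M F V,
        l1Dist μ φ' φ < ((k : ℝ≥0∞) + 1)⁻¹ ∧ dNorm (h' - h) < ((k : ℝ≥0∞) + 1)⁻¹ ∧
        ε ≤ ‖classDeriv X Δ dens δ φ' h' - classDeriv X Δ dens δ φ h‖ := fun k => by
      obtain ⟨φ', h1, h', -, h3, h4, h5⟩ := hcon ((k : ℝ≥0∞) + 1)⁻¹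
        (ENNReal.inv_pos.2 (by simp))
      exact ⟨φ', h1, h', h3, h4, h5⟩
    choose φ' hφ' h' hl hd hε' using hseq
    have hinv : Tendsto (fun k : ℕ => ((k : ℝ≥0∞) + 1)⁻¹) atTop (𝓝 0) := by
      have := ENNReal.tendsto_inv_nat_nhds_zero.comp (tendsto_add_atTop_nat 1)
      simpa [Function.comp_def] using this
    have hL : Tendsto (fun k => eLpNorm (φ' k - φ) 1 μ) atTop (𝓝 0) :=
      tendsto_of_tendsto_of_tendsto_of_le_of_le tendsto_const_nhds hinv (fun _ => zero_le)
        fun k => (hl k).le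
    have hh : Tendsto (fun k => dNorm (h' k - h)) atTop (𝓝 0) :=
      tendsto_of_tendsto_of_tendsto_of_le_of_le tendsto_const_nhds hinv (fun _ => zero_le)
        fun k => (hd k).le
    have c1 := hS1.tendsto_numDeriv hF hδV hδ hΘ hh hφ' hφ hL
    have c2 := hS1.tendsto_numDeriv hF hδV hδ h1 hh (φ := fun _ => 1) (φ₀ := 1) (fun _ => rfl) rfl
      (by simp)
    have c3 := hS1.tendsto_integral_trunc (δ := δ) (fun k => (hΘ.measurable_integrable (hφ' k)).2)
      (hΘ.measurable_integrable hφ).2 hL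
    have c4 : Tendsto (fun k => classDeriv X Δ dens δ (φ' k) (h' k)) atTop
        (𝓝 (classDeriv X Δ dens δ φ h)) := by
      rw [hS1.classDeriv_eq hF hδV hδ hΘ hφ]
      simp only [hS1.classDeriv_eq hF hδV hδ hΘ (hφ' _)]
      exact (c1.sub ((c3.div_const _).mul c2)).div_const _
    obtain ⟨k, hk⟩ := ((Metric.tendsto_nhds.1 c4) ε hε).exists
    rw [dist_eq_norm] at hk
    exact absurd hk (not_lt.2 (hε' k))

end CondS1
end

/-! ## Continuity of the moment functions -/

section
variable {α : Type*} [TopologicalSpace α] [FirstCountableTopology α] [MeasurableSpace α] {p : ℕ}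
  {κ : Kernel α (Fin p → ℝ)} [IsMarkovKernel κ] {R : ℝ}

/-- Measurable functions, bounded on the cube `[-R, R]^p`, all of whose lower partial integrals
depend continuously on the conditioning variable. -/
structure HasContinuousPartialIntegrals (κ : Kernel α (Fin p → ℝ)) (R : ℝ)
    (f : (Fin p → ℝ) → ℝ) : Prop where
  measurable : Measurable f
  bounded : ∃ C : ℝ, ∀ y : Fin p → ℝ, (∀ j, |y j| ≤ R) → |f y| ≤ C
  continuous : ∀ t : Fin p → ℝ, Continuous fun x => ∫ y in Set.Iic t, f y ∂κ x

/-- Cutting an orthant by a coordinate half-space gives another orthant; this keeps the class of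
lower partial integrals closed. -/
lemma Iic_inter_coordinate (t : Fin p → ℝ) (i : Fin p) (u : ℝ) :
    Set.Iic t ∩ {y | y i ≤ u} = Set.Iic (Function.update t i (min (t i) u)) := by
  ext y
  simp only [Set.mem_inter_iff, Set.mem_Iic, Set.mem_ofPred_eq, Pi.le_def]
  refine ⟨fun h j => ?_, fun h => ⟨fun j => ?_, ?_⟩⟩
  · rcases eq_or_ne j i with rfl | hj
    · simpa using ⟨h.1 j, h.2⟩
    · simpa [hj] using h.1 j
  · rcases eq_or_ne j i with rfl | hj
    · have := h j
      simp only [Function.update_self, le_min_iff] at this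
      exact this.1
    · simpa [hj] using h j
  · have := h i
    simp only [Function.update_self, le_min_iff] at this
    exact this.2

lemma integral_indicator_le_coordinate {y R : ℝ} (hy : |y| ≤ R) (c : ℝ) :
    ∫ u in Set.Ioc (-R) R, Set.indicator {u | y ≤ u} (fun _ => c) u = c * (R - y) := by
  have h := abs_le.1 hy
  rw [setIntegral_indicator (s := Set.Ioc (-R) R) (t := {u | y ≤ u}) measurableSet_Ici, setIntegral_const, smul_eq_mul]
  have e : volume.real (Set.Ioc (-R) R ∩ {u | y ≤ u}) = R - y := by
    have : (Set.Ioc (-R) R ∩ {u | y ≤ u} : Set ℝ) =ᵐ[volume] Set.Ioc y R := by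
      have h1 : Set.Ioc (-R) R ∩ Set.Ioi y = Set.Ioc y R := by
        ext u
        simp only [Set.mem_inter_iff, Set.mem_Ioc, Set.mem_Ioi]
        exact ⟨fun q => ⟨q.2, q.1.2⟩, fun q => ⟨⟨h.1.trans_lt q.1, q.2⟩, q.1⟩⟩
      rw [← h1]
      exact (ae_eq_refl _).inter Ioi_ae_eq_Ici.symm
    rw [measureReal_congr this, Real.volume_real_Ioc_of_le h.2]
  rw [e, mul_comm]

namespace HasContinuousPartialIntegrals

lemma integrable {f : (Fin p → ℝ) → ℝ} (hf : HasContinuousPartialIntegrals κ R f)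
    (hR : ∀ x, ∀ᵐ y ∂κ x, ∀ j, |y j| ≤ R) (x : α) : Integrable f (κ x) := by
  obtain ⟨C, hC⟩ := hf.bounded
  exact Integrable.of_bound hf.measurable.aestronglyMeasurable C ((hR x).mono fun y hy => hC y hy)

/-- On the cube, `R - y i` is the length of the part of `(-R, R]` lying above `y i`. Multiplying by
`f` and exchanging the integrals expresses multiplication by `y i` through lower partial integrals
of `f` alone. -/
lemma setIntegral_mul_coordinate {f : (Fin p → ℝ) → ℝ} (hf : HasContinuousPartialIntegrals κ R f)
    (hR : ∀ x, ∀ᵐ y ∂κ x, ∀ j, |y j| ≤ R) (i : Fin p) (t : Fin p → ℝ) (x : α) :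
    ∫ y in Set.Iic t, f y * y i ∂κ x = R * (∫ y in Set.Iic t, f y ∂κ x) -
      ∫ u in Set.Ioc (-R) R, ∫ y in Set.Iic (Function.update t i (min (t i) u)), f y ∂κ x := by
  have hi := hf.integrable hR x
  have hm : MeasurableSet {z : (Fin p → ℝ) × ℝ | z.1 i ≤ z.2} :=
    measurableSet_le (by fun_prop) measurable_snd
  have hI : Integrable (Function.uncurry fun (y : Fin p → ℝ) (u : ℝ) =>
      Set.indicator {z : (Fin p → ℝ) × ℝ | z.1 i ≤ z.2} (fun z => f z.1) (y, u))
      (((κ x).restrict (Set.Iic t)).prod (volume.restrict (Set.Ioc (-R) R))) :=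
    (hi.restrict.comp_fst _).indicator hm
  have hsw := integral_integral_swap hI
  have e1 : ∀ u, (∫ y in Set.Iic t, Set.indicator {z : (Fin p → ℝ) × ℝ | z.1 i ≤ z.2}
      (fun z => f z.1) (y, u) ∂κ x) =
      ∫ y in Set.Iic (Function.update t i (min (t i) u)), f y ∂κ x := fun u => by
    rw [← Iic_inter_coordinate, ← setIntegral_indicator (measurableSet_le (by fun_prop) measurable_const)]
    rfl
  have e2 : ∫ y in Set.Iic t, (∫ u in Set.Ioc (-R) R,
      Set.indicator {z : (Fin p → ℝ) × ℝ | z.1 i ≤ z.2} (fun z => f z.1) (y, u)) ∂κ x =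
      ∫ y in Set.Iic t, (R * f y - f y * y i) ∂κ x := by
    refine integral_congr_ae (ae_restrict_of_ae ((hR x).mono fun y hy => ?_))
    refine (integral_indicator_le_coordinate (hy i) (f y)).trans ?_
    ring
  have hi2 : Integrable (fun y => f y * y i) (κ x) := by
    obtain ⟨C, hC⟩ := hf.bounded
    refine Integrable.of_bound (hf.measurable.mul (measurable_pi_apply i)).aestronglyMeasurable
      (C * R) ((hR x).mono fun y hy => ?_)
    rw [norm_mul]
    exact mul_le_mul (hC y hy) (hy i) (norm_nonneg _) ((abs_nonneg _).trans (hC y hy))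
  rw [e2, integral_sub (hi.restrict.const_mul R) hi2.restrict, integral_const_mul] at hsw
  simp only [e1] at hsw
  linarith

/-- By the preceding formula the new partial integrals are averages over `u` of continuous,
uniformly bounded functions of `x`; dominated convergence applies. -/
lemma mul_coordinate {f : (Fin p → ℝ) → ℝ} (hf : HasContinuousPartialIntegrals κ R f)
    (hR : ∀ x, ∀ᵐ y ∂κ x, ∀ j, |y j| ≤ R) (i : Fin p) :
    HasContinuousPartialIntegrals κ R fun y => f y * y i := by
  obtain ⟨C, hC⟩ := hf.bounded
  refine ⟨hf.measurable.mul (measurable_pi_apply i), ⟨C * R, fun y hy => ?_⟩, fun t => ?_⟩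
  · rw [abs_mul]
    exact mul_le_mul (hC y hy) (hy i) (abs_nonneg _) ((abs_nonneg _).trans (hC y hy))
  · simp only [hf.setIntegral_mul_coordinate hR]
    refine ((hf.continuous t).const_mul R).sub ?_
    refine continuous_of_dominated (bound := fun _ => |C|) (fun x => ?_)
      (fun x => Eventually.of_forall fun u => ?_) (integrable_const _)
      (Eventually.of_forall fun u => hf.continuous _)
    · have hm : MeasurableSet {z : ℝ × (Fin p → ℝ) | z.2 i ≤ z.1} :=
        measurableSet_le (by fun_prop) measurable_fst
      have h1 : StronglyMeasurable (Set.indicator {z : ℝ × (Fin p → ℝ) | z.2 i ≤ z.1}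
          fun z => f z.2) := ((hf.measurable.comp measurable_snd).indicator hm).stronglyMeasurable
      refine (h1.integral_prod_right' (ν := (κ x).restrict (Set.Iic t))).aestronglyMeasurable.congr
        (Eventually.of_forall fun u => ?_)
      simp only
      rw [← Iic_inter_coordinate,
        ← setIntegral_indicator (measurableSet_le (by fun_prop) measurable_const)]
      rfl
    · have h1 : ∀ᵐ y ∂(κ x).restrict (Set.Iic (Function.update t i (min (t i) u))),
          ‖f y‖ ≤ |C| := ae_restrict_of_ae ((hR x).mono fun y hy => (hC y hy).trans (le_abs_self C))
      refine (norm_integral_le_of_norm_le_const h1).trans ?_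
      refine mul_le_of_le_one_right (abs_nonneg _) ?_
      rw [measureReal_restrict_apply_univ]
      exact measureReal_le_one

lemma mul_monomial {f : (Fin p → ℝ) → ℝ} (hf : HasContinuousPartialIntegrals κ R f)
    (hR : ∀ x, ∀ᵐ y ∂κ x, ∀ j, |y j| ≤ R) (b : Fin p → ℕ) (s : Finset (Fin p)) :
    HasContinuousPartialIntegrals κ R fun y => f y * ∏ j ∈ s, y j ^ b j := by
  classical
  induction s using Finset.induction_on with
  | empty => simpa using hf
  | insert i s hi ih =>
    have key : ∀ k : ℕ, HasContinuousPartialIntegrals κ R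
        fun y => (f y * ∏ j ∈ s, y j ^ b j) * y i ^ k := fun k => by
      induction k with
      | zero => simpa using ih
      | succ k ihk => simpa only [pow_succ, mul_assoc] using ihk.mul_coordinate hR i
    have h := key (b i)
    simp only [Finset.prod_insert hi]
    convert h using 2 with y
    ring

end HasContinuousPartialIntegrals

/-- For `f = 1` the lower partial integrals are the conditional distribution function; multiplying
by one coordinate at a time reaches every monomial. The orthant below `(R, …, R)` carries all the
mass. -/
lemma continuous_integral_monomial (hR : ∀ x, ∀ᵐ y ∂κ x, ∀ j, |y j| ≤ R)
    (hcdf : ∀ y : Fin p → ℝ, Continuous fun x => (κ x).real (Set.Iic y)) (b : Fin p → ℕ) :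
    Continuous fun x => ∫ y, ∏ j, y j ^ b j ∂κ x := by
  have h1 : HasContinuousPartialIntegrals κ R fun _ => 1 :=
    ⟨measurable_const, ⟨1, by simp⟩, fun t => by simpa using hcdf t⟩
  refine ((h1.mul_monomial hR b Finset.univ).continuous fun _ => R).congr fun x => ?_
  simp only [one_mul]
  rw [Measure.restrict_eq_self_of_ae_mem]
  exact (hR x).mono fun y hy j => (le_abs_self _).trans (hy j)

end

section
variable {n p : ℕ} {B X : Set (Cov n)} {Δ : Cov n → ℝ} {dens : B → ℝ} {δ : ℝ} {μ : Measure B}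
  [IsProbabilityMeasure μ] {κ : Kernel B (Fin p → ℝ)} [IsMarkovKernel κ] {M : ℕ}

lemma continuous_of_mem_momentClass
    (hY : ∃ Y : Set (Fin p → ℝ), IsCompact Y ∧ ∀ x, κ x Yᶜ = 0)
    (hcdf : ∀ y : Fin p → ℝ, Continuous (condCdf κ y)) {φ : B → ℝ} (hφ : φ ∈ momentClass μ κ M) :
    Continuous φ := by
  obtain ⟨a, b, -, -, rfl⟩ := hφ
  obtain ⟨Y, hYc, hY0⟩ := hY
  obtain ⟨R, hYR⟩ := hYc.isBounded.exists_norm_le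
  have hR : ∀ x, ∀ᵐ y ∂κ x, ∀ j, |y j| ≤ R := fun x => by
    have h0 : ∀ᵐ y ∂κ x, y ∈ Y := hY0 x
    exact h0.mono fun y hy j => (norm_le_pi_norm y j).trans (hYR y hy)
  have h1 := continuous_integral_monomial hR hcdf b
  have e : condMean κ (zMonomial a b) =
      fun x : B => (∏ i, (x : Cov n) i ^ a i) * ∫ y, ∏ j, y j ^ b j ∂κ x := by
    funext x
    exact integral_const_mul (μ := κ x) (∏ i, (x : Cov n) i ^ a i) fun y => ∏ j, y j ^ b j
  rw [e]
  fun_prop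

lemma CondS1.isTestSubclass_momentClass (hS1 : CondS1 X B Δ dens μ)
    (hY : ∃ Y : Set (Fin p → ℝ), IsCompact Y ∧ ∀ x, κ x Yᶜ = 0)
    (hcdf : ∀ y : Fin p → ℝ, Continuous (condCdf κ y)) :
    IsTestSubclass X Δ dens δ μ κ M (momentClass μ κ M) where
  subset := Set.subset_union_left
  bounded := by
    have hb : ∀ φ ∈ momentClass μ κ M, ∃ C : ℝ, ∀ x : B, (x : Cov n) ∈ closure X → |φ x| ≤ C :=
      fun φ hφ => hS1.isCompact_preimage_closure.exists_bound_of_continuousOn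
        (continuous_of_mem_momentClass hY hcdf hφ).continuousOn
    choose! C hC using hb
    obtain ⟨C', hC'⟩ := ((finite_momentClass μ κ M).image C).bddAbove
    exact ⟨C', fun φ hφ x hx => (hC φ hφ x hx).trans (hC' ⟨φ, hφ, rfl⟩)⟩
  compact := fun φ hφ => by
    -- The class is finite, so some member recurs infinitely often and a subsequence is constant.
    obtain ⟨ψ, hψ, hfr⟩ : ∃ ψ ∈ momentClass μ κ M, ∃ᶠ k in atTop, φ k = ψ := by
      by_contra! h
      have h1 : ∀ᶠ k in atTop, ∀ ψ ∈ momentClass μ κ M, φ k ≠ ψ :=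
        (eventually_all_finite (finite_momentClass μ κ M)).2 fun ψ hψ => h ψ hψ
      obtain ⟨k, hk⟩ := h1.exists
      exact hk _ (hφ k) rfl
    obtain ⟨s, hs, hs'⟩ := extraction_of_frequently_atTop hfr
    refine ⟨s, hs.tendsto_atTop, Eventually.of_forall fun x _ => ?_⟩
    simp only [hs']
    exact OscillationVanishesAt.const
      (continuous_of_mem_momentClass hY hcdf hψ).continuousAt

end

/-! ## Coordinate slices of the level set -/

section
variable {n p : ℕ} {B X : Set (Cov n)} {Δ : Cov n → ℝ} {dens : B → ℝ} {δ : ℝ} {μ : Measure B}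
  [IsProbabilityMeasure μ] {V : Set ℝ}

/-- Insertion of the coordinate `s` at position `i`. -/
def insertCoord (i : Fin (n + 1)) (q : ℝ × (Fin n → ℝ)) : Cov n :=
  WithLp.toLp 2 (i.insertNth q.1 q.2 : Fin (n + 1) → ℝ)

lemma continuous_insertCoord (i : Fin (n + 1)) : Continuous (insertCoord i) :=
  (PiLp.continuous_toLp 2 _).comp (Continuous.finInsertNth (A := fun _ => ℝ) i continuous_fst continuous_snd)

lemma removeNth_insertCoord (i : Fin (n + 1)) (q : ℝ × (Fin n → ℝ)) :
    i.removeNth (insertCoord i q).ofLp = q.2 :=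
  Fin.removeNth_insertNth (α := fun _ => ℝ) i q.1 q.2

lemma insertCoord_removeNth (i : Fin (n + 1)) (x : Cov n) :
    insertCoord i (x i, i.removeNth x.ofLp) = x := by
  ext j
  exact congrFun (Fin.insertNth_self_removeNth i x.ofLp) j

lemma measurePreserving_insertCoord (i : Fin (n + 1)) :
    MeasurePreserving (insertCoord i : ℝ × (Fin n → ℝ) → Cov n) :=
  (PiLp.volume_preserving_toLp (Fin (n + 1))).comp
    (volume_preserving_piFinSuccAbove (fun _ : Fin (n + 1) => ℝ) i).symm

lemma isometry_insertCoord (i : Fin (n + 1)) (s : ℝ) :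
    Isometry fun w : EuclideanSpace ℝ (Fin n) => insertCoord i (s, w.ofLp) := by
  refine Isometry.of_dist_eq fun v w => ?_
  rw [EuclideanSpace.dist_eq, EuclideanSpace.dist_eq, Fin.sum_univ_succAbove _ i]
  simp [insertCoord]

/-- Inside a coordinate hyperplane, deleting the fixed coordinate is an isometry, and
`n`-dimensional Hausdorff measure becomes Lebesgue measure. -/
lemma euclideanHausdorffMeasure_slice_eq_zero {A : Set B} (i : Fin (n + 1)) {s : ℝ}
    (hA : ∀ x ∈ A, (x : Cov n) i = s)
    (h0 : volume ((fun x : B => (i.removeNth (x : Cov n).ofLp : Fin n → ℝ)) '' A) = 0) :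
    (μHE[n] : Measure B) A = 0 := by
  have h1 : Subtype.val '' A ⊆ (fun w : EuclideanSpace ℝ (Fin n) => insertCoord i (s, w.ofLp)) ''
      (WithLp.ofLp ⁻¹' ((fun x : B => (i.removeNth (x : Cov n).ofLp : Fin n → ℝ)) '' A)) := by
    rintro _ ⟨x, hx, rfl⟩
    refine ⟨WithLp.toLp 2 (i.removeNth (x : Cov n).ofLp), ⟨x, hx, rfl⟩, ?_⟩
    simp only [← hA x hx]
    exact insertCoord_removeNth i x
  rw [← (isometry_subtype_coe (s := B)).euclideanHausdorffMeasure_image]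
  refine measure_mono_null h1 ?_
  rw [(isometry_insertCoord i s).euclideanHausdorffMeasure_image,
    EuclideanSpace.euclideanHausdorffMeasure_eq_volume]
  exact (PiLp.volume_preserving_ofLp (Fin n)).quasiMeasurePreserving.preimage_null h0

namespace CondS1
variable (hS1 : CondS1 X B Δ dens μ)
include hS1

/-- If `x` shares its other coordinates with a point of level `δ` at height `s`, those coordinates
lie in the slice tube of every width, to which AS.1 gives mass at most any prescribed `ε`. -/
lemma measure_preimage_slice_eq_zero (hAS : CondAS1 B Δ μ V) (hδV : δ ∈ V) (i : Fin (n + 1))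
    (s : ℝ) : μ {x : B | ∃ z : B, Δ z = δ ∧ (z : Cov n) i = s ∧
      (i.removeNth (z : Cov n).ofLp : Fin n → ℝ) = i.removeNth (x : Cov n).ofLp} = 0 := by
  refine le_antisymm (ENNReal.le_of_forall_pos_le_add fun ε hε _ => ?_) zero_le
  obtain ⟨η₀, hη₀, h⟩ := hAS ε (by exact_mod_cast hε)
  have h1 := h (η₀ / 2) (half_pos hη₀) (half_lt_self hη₀) δ hδV s i
  rw [zero_add, ← ENNReal.ofReal_coe_nnreal]
  refine le_trans (measure_mono ?_) ((Measure.le_map_apply ?_ _).trans h1)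
  · rintro x ⟨z, hz, hzs, hzx⟩
    have e : insertCoord i (s, i.removeNth (x : Cov n).ofLp) = z := by
      rw [← hzx, ← hzs]
      exact insertCoord_removeNth i z
    change insertCoord i (s, i.removeNth (x : Cov n).ofLp) ∈ B ∧
      Δ (insertCoord i (s, i.removeNth (x : Cov n).ofLp)) ∈ _
    rw [e, hz]
    exact ⟨z.2, by constructor <;> linarith⟩
  · refine (measurable_pi_iff.2 fun j => ?_).aemeasurable
    change Measurable fun x : B => (x : Cov n) (i.succAbove j)
    fun_prop

/-- Indicators jump only on hyperplanes `x i = s`. AS.1 makes the projection `P` of the level set's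
part there null for the marginal, and positivity of the density turns this into Lebesgue-nullity of
`P` near each relevant point. -/
lemma slice_eq_zero (hAS : CondAS1 B Δ μ V) (hδV : δ ∈ V) (i : Fin (n + 1)) (s : ℝ) :
    ∀ᵐ x ∂(μHE[n] : Measure B).restrict (levelSetIn B X Δ δ), dens x ≠ 0 → (x : Cov n) i ≠ s := by
  set P : Set (Fin n → ℝ) := {w | ∃ z : B, Δ z = δ ∧ (z : Cov n) i = s ∧
      (i.removeNth (z : Cov n).ofLp : Fin n → ℝ) = w} with hP
  set O : Set (Cov n) := Subtype.val '' {x : B | dens x ≠ 0} with hO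
  have hOo : IsOpen O := hS1.isOpen_B.isOpenMap_subtype_val _
    (isOpen_ne_fun hS1.dens_continuous continuous_const)
  have hm := MeasurableEmbedding.subtype_coe hS1.isOpen_B.measurableSet
  have hvol : volume {z : Cov n | z ∈ O ∧ i.removeNth z.ofLp ∈ P} = 0 := by
    have h1 : ∀ᵐ x : B ∂μ, i.removeNth (x : Cov n).ofLp ∉ P :=
      measure_eq_zero_iff_ae_notMem.1 (hS1.measure_preimage_slice_eq_zero hAS hδV i s)
    rw [hS1.eq_withDensity, ae_withDensity_iff hS1.dens_continuous.measurable.ennreal_ofReal] at h1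
    have h2 : ((volume : Measure (Cov n)).comap (Subtype.val : B → Cov n))
        {x : B | dens x ≠ 0 ∧ i.removeNth (x : Cov n).ofLp ∈ P} = 0 := by
      rw [measure_eq_zero_iff_ae_notMem]
      refine h1.mono fun y hy hy' => hy ?_ hy'.2
      rw [Ne, ENNReal.ofReal_eq_zero, not_le]
      exact lt_of_le_of_ne (hS1.dens_nonneg y) (Ne.symm hy'.1)
    rw [hm.comap_apply] at h2
    refine measure_mono_null ?_ h2
    rintro _ ⟨⟨x, hx, rfl⟩, hxP⟩
    exact ⟨x, ⟨hx, hxP⟩, rfl⟩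
  have hnull : (μHE[n] : Measure B) {x | Δ x = δ ∧ dens x ≠ 0 ∧ (x : Cov n) i = s} = 0 := by
    refine measure_null_of_locally_null _ fun x₀ hx₀ => ?_
    obtain ⟨h1, h2, h3⟩ := hx₀
    have e0 : insertCoord i (s, i.removeNth (x₀ : Cov n).ofLp) = x₀ := by
      rw [← h3]
      exact insertCoord_removeNth i x₀
    have hn : insertCoord i ⁻¹' O ∈ 𝓝 (s, i.removeNth (x₀ : Cov n).ofLp) :=
      (continuous_insertCoord i).continuousAt.preimage_mem_nhds
        (hOo.mem_nhds (by rw [e0]; exact ⟨x₀, h2, rfl⟩))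
    obtain ⟨I, hI, W, hW, hIW⟩ := mem_nhds_prod_iff.1 hn
    -- On the box `I ×ˢ W`, where the density is positive, the null set of points projecting into
    -- `P` is the product `I ×ˢ (P ∩ W)`, and `I` has positive length.
    have hPW : volume (P ∩ W) = 0 := by
      have h4 : (volume : Measure (ℝ × (Fin n → ℝ))) (I ×ˢ (P ∩ W)) = 0 := by
        refine measure_mono_null ?_
          ((measurePreserving_insertCoord i).quasiMeasurePreserving.preimage_null hvol)
        rintro ⟨r, w⟩ ⟨hr, hwP, hwW⟩
        refine ⟨hIW ⟨hr, hwW⟩, ?_⟩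
        rw [removeNth_insertCoord]
        exact hwP
      rw [Measure.volume_eq_prod, Measure.prod_prod] at h4
      exact (mul_eq_zero.1 h4).resolve_left (Measure.measure_pos_of_mem_nhds volume hI).ne'
    have hc : Continuous fun x : B => (i.removeNth (x : Cov n).ofLp : Fin n → ℝ) := by
      refine continuous_pi fun j => ?_
      change Continuous fun x : B => (x : Cov n) (i.succAbove j)
      fun_prop
    refine ⟨_, inter_mem self_mem_nhdsWithin
      (mem_nhdsWithin_of_mem_nhds (hc.continuousAt.preimage_mem_nhds hW)), ?_⟩
    refine euclideanHausdorffMeasure_slice_eq_zero i (s := s) (fun x hx => hx.1.2.2)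
      (measure_mono_null ?_ hPW)
    rintro _ ⟨x, ⟨hx, hxW⟩, rfl⟩
    exact ⟨⟨x, hx.1, hx.2.2, rfl⟩, hxW⟩
  rw [ae_restrict_iff' hS1.measurableSet_levelSetIn]
  filter_upwards [measure_eq_zero_iff_ae_notMem.1 hnull] with x hx hxl hd hs
  exact hx ⟨hxl.2, hd, hs⟩

end CondS1
end

/-! ## The class of indicator functions -/

section
variable {n p : ℕ} {B X : Set (Cov n)} {Δ : Cov n → ℝ} {dens : B → ℝ} {δ : ℝ} {μ : Measure B}
  [IsProbabilityMeasure μ] {κ : Kernel B (Fin p → ℝ)} [IsMarkovKernel κ] {M : ℕ} {V : Set ℝ}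

lemma condMean_zIndicator (s : Fin (n + 1) → ℝ) (t : Fin p → ℝ) (x : B) :
    condMean κ (zIndicator s t) x =
      Set.indicator {x : B | ∀ i, (x : Cov n) i ≤ s i} (condCdf κ t) x := by
  by_cases h : ∀ i, (x : Cov n) i ≤ s i
  · rw [Set.indicator_of_mem (by exact h)]
    have hm : MeasurableSet {z : Fin p → ℝ | ∀ j, z j ≤ t j} := measurableSet_Iic (a := t)
    rw [condCdf, ← integral_indicator_one hm]
    refine integral_congr_ae (Eventually.of_forall fun y => ?_)
    simp only [zIndicator, Set.indicator_apply, Set.mem_ofPred_eq, h, implies_true, true_and]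
    rfl
  · rw [Set.indicator_of_notMem (by exact h)]
    refine integral_eq_zero_of_ae (Eventually.of_forall fun y => ?_)
    simp only [zIndicator]
    exact Set.indicator_of_notMem (fun hy => h hy.1) _

/-- A number strictly between the coordinate of `x` and the limiting threshold eventually separates
all nearby points from all late thresholds, so the comparison cannot change near `x`. -/
lemma eventually_coordinate_le_iff {a : ℕ → ℝ} {b : EReal} {x : B} {i : Fin (n + 1)}
    (ha : Tendsto (fun k => (a k : EReal)) atTop (𝓝 b)) (hx : (((x : Cov n) i : ℝ) : EReal) ≠ b) :
    ∀ᶠ q : ℕ × B in atTop ×ˢ 𝓝 x, ((q.2 : Cov n) i ≤ a q.1 ↔ (x : Cov n) i ≤ a q.1) := by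
  have hc : Tendsto (fun y : B => (((y : Cov n) i : ℝ) : EReal)) (𝓝 x)
      (𝓝 (((x : Cov n) i : ℝ) : EReal)) :=
    (continuous_coe_real_ereal.comp (by fun_prop : Continuous fun y : B => (y : Cov n) i)).tendsto x
  rcases lt_or_gt_of_ne hx with h | h
  · obtain ⟨c, h1, h2⟩ := exists_between h
    filter_upwards [(ha.eventually_const_lt h2).prod_mk (hc.eventually_lt_const h1)] with q hq
    exact iff_of_true (EReal.coe_le_coe_iff.1 (hq.2.trans hq.1).le)
      (EReal.coe_le_coe_iff.1 (h1.trans hq.1).le)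
  · obtain ⟨c, h1, h2⟩ := exists_between h
    filter_upwards [(ha.eventually_lt_const h1).prod_mk (hc.eventually_const_lt h2)] with q hq
    exact iff_of_false (not_le.2 (EReal.coe_lt_coe_iff.1 (hq.1.trans hq.2)))
      (not_le.2 (EReal.coe_lt_coe_iff.1 (hq.1.trans h2)))

lemma CondS1.isTestSubclass_indicatorClass (hS1 : CondS1 X B Δ dens μ) (hAS : CondAS1 B Δ μ V)
    (hδV : δ ∈ V) (heq : Equicontinuous fun (y : Fin p → ℝ) (x : B) => condCdf κ y x) :
    IsTestSubclass X Δ dens δ μ κ M (indicatorClass κ) where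
  subset := Set.subset_union_right
  bounded := ⟨1, fun φ hφ x _ => abs_indicatorClass_le κ hφ x⟩
  compact := fun φ hφ => by
    choose a t hφe using hφ
    -- Compactness is taken in the extended reals since thresholds may escape to infinity; an
    -- infinite limit never equals a coordinate, a finite one does so only on a null part of the
    -- level set.
    obtain ⟨b, -, s, hs, hb⟩ := isCompact_univ.tendsto_subseq
      (x := fun k (i : Fin (n + 1)) => (a k i : EReal)) fun _ => Set.mem_univ _
    refine ⟨s, hs.tendsto_atTop, ?_⟩
    have hne : ∀ᵐ x ∂(μHE[n] : Measure B).restrict (levelSetIn B X Δ δ),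
        ∀ i, dens x ≠ 0 → (((x : Cov n) i : ℝ) : EReal) ≠ b i := by
      refine ae_all_iff.2 fun i => ?_
      induction hbi : b i with
      | bot => exact Eventually.of_forall fun x _ => EReal.coe_ne_bot _
      | top => exact Eventually.of_forall fun x _ => EReal.coe_ne_top _
      | coe r =>
        filter_upwards [hS1.slice_eq_zero hAS hδV i r] with x hx hd h
        exact hx hd (EReal.coe_injective h)
    filter_upwards [hne] with x hx hd
    have h1 : ∀ᶠ q : ℕ × B in atTop ×ˢ 𝓝 x, ∀ i,
        ((q.2 : Cov n) i ≤ a (s q.1) i ↔ (x : Cov n) i ≤ a (s q.1) i) :=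
      eventually_all.2 fun i => eventually_coordinate_le_iff
        (a := fun k => a (s k) i) (tendsto_pi_nhds.1 hb i) (hx i hd)
    have h2 : Tendsto (fun q : ℕ × B => condCdf κ (t (s q.1)) q.2 - condCdf κ (t (s q.1)) x)
        (atTop ×ˢ 𝓝 x) (𝓝 0) := by
      rw [Metric.tendsto_nhds]
      intro ε hε
      -- Equicontinuity is uniform over all thresholds in `y`, so these need no convergent
      -- subsequence.
      filter_upwards [tendsto_snd.eventually (Metric.equicontinuousAt_iff_right.1 (heq x) ε hε)]
        with q hq
      have := hq (t (s q.1))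
      rwa [dist_comm, Real.dist_eq, ← sub_zero (_ - _), ← Real.dist_eq] at this
    refine squeeze_zero_norm' ?_ (by simpa using h2.norm)
    filter_upwards [h1] with q hq
    simp only [hφe, condMean_zIndicator, Set.indicator_apply, Set.mem_ofPred_eq, hq]
    split_ifs
    · exact le_rfl
    · simp

end

end Classification

end

open Classification in
theorem mainTheorem4 {n p : ℕ} (X B : Set (Cov n)) (Δ : Cov n → ℝ) (dens : B → ℝ)
    (μ : Measure B) [IsProbabilityMeasure μ]
    (κ : Kernel B (Fin p → ℝ)) [IsMarkovKernel κ]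
    (M : ℕ) (F : Set C(B, ℝ)) (V : Set ℝ) (δ : ℝ)
    (hS1 : CondS1 X B Δ dens μ) (hS2 : CondS2 X Δ)
    (hY : ∃ Y : Set (Fin p → ℝ), IsCompact Y ∧ ∀ x, κ x Yᶜ = 0)
    (hcdf : ∀ y : Fin p → ℝ, Continuous (condCdf κ y))
    (hF : hS1.toC ∈ F) (hV : IsCompact V) (hδV : δ ∈ V)
    (hδ : IsRegularValue Δ (closure X) δ)
    (hpos : 0 < distrFun μ (fun x => Δ x) δ) :
    (∀ φ ∈ momentClass μ κ M ∪ indicatorClass κ, ∀ G ∈ uniformSpaceF B, ∀ K : ℝ,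
      IntegrableOn (surfaceIntegrand Δ dens μ δ φ G K) (levelSetIn B X Δ δ) μHE[n]) ∧
    HasUniformHadamardDeriv dNorm (l1Dist μ) (momentClass μ κ M) (opDomain μ κ M F V)
      (tangentSpace μ κ M F V) classOp (hS1.toC, measureOp μ κ M F V, δ)
      (classDeriv X Δ dens δ) ∧
    (CondAS1 B Δ μ V → Equicontinuous (fun (y : Fin p → ℝ) (x : B) => condCdf κ y x) →
      HasUniformHadamardDeriv dNorm (l1Dist μ) (indicatorClass κ) (opDomain μ κ M F V)
        (tangentSpace μ κ M F V) classOp (hS1.toC, measureOp μ κ M F V, δ)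
        (classDeriv X Δ dens δ)) := by
  have hM : IsTestSubclass X Δ dens δ μ κ M (momentClass μ κ M) :=
    hS1.isTestSubclass_momentClass hY hcdf
  refine ⟨fun φ hφ G _ K => ?_, hS1.hasUniformHadamardDeriv hF hδV hδ hpos hM,
    fun hAS heq => hS1.hasUniformHadamardDeriv hF hδV hδ hpos
      (hS1.isTestSubclass_indicatorClass hAS hδV heq)⟩
  obtain ⟨C, hC⟩ : ∃ C : ℝ, ∀ x : B, (x : Cov n) ∈ closure X → |φ x| ≤ C := by
    rcases hφ with hφ | hφ
    · exact hM.bounded.imp fun C hC => hC φ hφ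
    -- Integrability needs only boundedness, so for indicators it holds without AS.1 or
    -- equicontinuity.
    · exact ⟨1, fun x _ => abs_indicatorClass_le κ hφ x⟩
  have hm : Measurable (normalized μ (fun z => Δ z) δ φ) :=
    ((stronglyMeasurable_class μ κ M hφ).measurable.sub_const _).div_const _
  refine hS1.integrable_surface hδ hm (C := (C + |(∫ z, trunc φ (fun z => Δ z) δ z ∂μ) /
    distrFun μ (fun z => Δ z) δ|) / distrFun μ (fun z => Δ z) δ) (fun x hx => ?_) G K
  rw [normalized, abs_div, abs_of_pos hpos]
  exact div_le_div_of_nonneg_right ((abs_sub _ _).trans (add_le_add_left (hC x hx) _)) hpos.le
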